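/- **Setting.** Let $Q$ be a smooth $n$-dimensional manifold with a smooth contravariant pseudo-Riemannian metric $\mathbf G=(g^{ij})$ of arbitrary signature, $n=m+r$, $m\ge 1$, $r\ge 0$. A *separable Killing algebra* $(D_r,\mathcal K_m)$ with common eigenvectors $\mathbf E_1,\dots,\mathbf E_m$ consists of: (a) an $r$-dimensional abelian Lie algebra $D_r$ of Killing vectors spanning a distribution $\Delta$ of rank $r$ such that $\Delta\cap\Delta^\perp$ has constant rank $m_0$; (b) an $m$-dimensional space $\mathcal K_m$ of Killing tensors (smooth symmetric two-tensors $\mathbf K$ with Lie–Schouten bracket $[\mathbf K,\mathbf G]=0$) having in common $m$ pointwise independent smooth eigenvectors $\mathbf E_a$ that are orthogonal to $D_r$, normal (orthogonally integrable), and have real eigenvalues, where the tensors in $\mathcal K_m$ are independent in the sense that a tensor in $\mathcal K_m$ whose eigenvalues on $\mathbf E_1,\dots,\mathbf E_m$ all vanish at some point is zero; (c) $\mathcal L_{\mathbf X}\mathbf K=0$ for all $\mathbf X\in D_r$, $\mathbf K\in\mathcal K_m$; and the closure condition (d) below. Coordinates $(q^1,\dots,q^m,q^\alpha)$ are *adapted*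 to $(D_r,\mathcal K_m)$ if $\mathbf E_a^\flat$ is proportional to $dq^a$ for $a=1,\dots,m$, the fields $\partial_\alpha$ form a basis of $D_r$, the submanifolds $\{q^\alpha=\mathrm{const}\ \forall\alpha\}$ are tangent to every non-null $\mathbf E_a$, and (d) if $m_0>1$, then $d(\mathbf K\cdot dg^{\alpha\beta})=0$ for all $\mathbf K\in\mathcal K_m$ and all $\alpha,\beta$, where $g^{\alpha\beta}=\mathbf G(dq^\alpha,dq^\beta)$. The $q^a$, $a\le m$, are the *essential* coordinates. Let $(\mathbf K_1,\dots,\mathbf K_m=\mathbf G)$ be a basis of $\mathcal K_m$, let $\Lambda=(\lambda_c^b)$ (row $c$, column $b$) where $\lambda_c^b$ is the eigenvalue of $\mathbf K_c$ on $\mathbf E_b$, let $\Lambda_b^a$ be $\Lambda$ without its $b$-th row and $a$-th column, and let $$f_a^{bc}=\frac{\det\Lambda_b^a}{\det\Lambda_c^a}.$$ This function is *undefined* if $\det\Lambda_c^a$ vanishes identically on the coordinate domain; otherwise it is a function on the set where $\det\Lambda_c^a\ne0$, and it is *constant* if it takes only one value there. Coordinates $(q^a,q^\alpha)$ are *standard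 separable* if $\partial_\alpha g^{ij}=0$ and, for a subset of indices $\bar a\in\{1,\dots,m\}$ (the remaining ones being denoted $\hat a$), the only components $g^{ij}$ that may be nonzero are, up to symmetry, $$g^{\hat a\hat a}=\varphi^{\hat a}_{(m)},\qquad g^{\bar a\beta}=\theta^\beta_{\bar a}\,\varphi^{\bar a}_{(m)},\qquad g^{\alpha\beta}=\sum_{a=1}^m\eta_a^{\alpha\beta}\,\varphi^a_{(m)},$$ where $\theta_{\bar a}^\beta$ and $\eta_a^{\alpha\beta}$ are smooth functions of the coordinate with the lower index only and $(\varphi^a_{(m)})$ is the last row of the inverse of a regular smooth $m\times m$ Stäckel matrix (the entries of its $j$-th row depend on $q^j$ only). For such coordinates $\partial_a$ is a *conformal Stäckel symmetry* if, for some such representation, there is a function $F$ with $\partial_a\ln|\varphi^b_{(m)}|=F$ for all $b=1,\dots,m$, and a *Stäckel symmetry* if this holds with $F=0$. **Theorem.** Let $q^a$ be an essential coordinate of an adapted coordinate system with connected domain $U$. (i) If $m>2$, then the following are equivalent: every point of $U$ has an open neighbourhood on which there is a rescaling $\breve q^a=\breve q^a(q^a)$ such that, in the coordinates obtained by replacing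 $q^a$ with $\breve q^a$, which are standard separable there, $\breve\partial_a$ is a conformal Stäckel symmetry; the functions $f_a^{bc}$ with $c<b<m$ are all constant or undefined on $U$. (ii) For every $m\ge1$ the following are equivalent: every point of $U$ has an open neighbourhood on which there is a rescaling $\breve q^a=\breve q^a(q^a)$ such that the resulting coordinates are standard separable and $\breve\partial_a$ is a Stäckel symmetry; the functions $f_a^{bc}$ for all $b,c$ are constant or undefined on $U$. If $U$ is represented by a convex subset of $\mathbb R^n$ in the coordinates $(q^a,q^\alpha)$ (for instance a box), then in (i) and in (ii) the second statement is also equivalent to the existence of such a rescaling on the whole of $U$. -/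

import Mathlib

open scoped Manifold ContDiff

noncomputable section

namespace SepKilling

/-- Coordinate indices: `Sum.inl a` are the `m = k + 1` essential indices `a`, `Sum.inr α` the `r`
remaining (ignorable) indices `α`. The dimension of the manifold is `n = m + r`. -/
abbrev Idx (k r : ℕ) : Type := Fin (k + 1) ⊕ Fin r

/-- The coordinate space `ℝⁿ`, `n = m + r`. -/
abbrev Coord (k r : ℕ) : Type := Idx k r → ℝ

/-- Partial derivative `∂_j f` at the point `u` of the coordinate space. -/
def pd {k r : ℕ} (j : Idx k r) (f : Coord k r → ℝ) (u : Coord k r) : ℝ :=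
  fderiv ℝ f u (Pi.single j 1)

section Fields

variable {k r : ℕ} {M : Type*} [TopologicalSpace M] [ChartedSpace (Coord k r) M]

/-- The cotangent space at `x`. -/
abbrev Cotangent (x : M) : Type :=
  TangentSpace 𝓘(ℝ, Coord k r) x →L[ℝ] ℝ

/-- Vector fields (no regularity). -/
abbrev VField (k r : ℕ) (M : Type*) [TopologicalSpace M] [ChartedSpace (Coord k r) M] : Type _ :=
  ∀ x : M, TangentSpace 𝓘(ℝ, Coord k r) x

/-- Fields of contravariant two-tensors: bilinear forms on the cotangent spaces (no regularity). -/
abbrev Tensor2 (k r : ℕ) (M : Type*) [TopologicalSpace M] [ChartedSpace (Coord k r) M] : Type _ :=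
  ∀ x : M, Cotangent (k := k) (r := r) x →ₗ[ℝ] Cotangent (k := k) (r := r) x →ₗ[ℝ] ℝ

/-- The differential `dq^i` at `x` of the `i`-th coordinate function of the chart `e`. -/
def dq (e : OpenPartialHomeomorph M (Coord k r)) (i : Idx k r) (x : M) :
    Cotangent (k := k) (r := r) x :=
  mfderiv 𝓘(ℝ, Coord k r) 𝓘(ℝ, ℝ) (fun y => e y i) x

/-- The component `T^{ij} = T(dq^i, dq^j)`, as a function of the coordinates. -/
def tcomp (e : OpenPartialHomeomorph M (Coord k r)) (T : Tensor2 k r M) (i j : Idx k r)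
    (u : Coord k r) : ℝ :=
  T (e.symm u) (dq e i (e.symm u)) (dq e j (e.symm u))

/-- The matrix `(T^{ij})` of components. -/
def tmat (e : OpenPartialHomeomorph M (Coord k r)) (T : Tensor2 k r M) (u : Coord k r) :
    Matrix (Idx k r) (Idx k r) ℝ :=
  Matrix.of fun i j => tcomp e T i j u

/-- The component `X^i = dq^i(X)`, as a function of the coordinates. -/
def vcomp (e : OpenPartialHomeomorph M (Coord k r)) (X : VField k r M) (i : Idx k r)
    (u : Coord k r) : ℝ :=
  dq e i (e.symm u) (X (e.symm u))

/-- The smooth charts of `M` (local coordinate systems). -/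
abbrev Charts (k r : ℕ) (M : Type*) [TopologicalSpace M] [ChartedSpace (Coord k r) M] :
    Set (OpenPartialHomeomorph M (Coord k r)) :=
  IsManifold.maximalAtlas 𝓘(ℝ, Coord k r) ∞ M

/-- Smooth vector fields. -/
def SmoothV (X : VField k r M) : Prop :=
  ∀ e ∈ Charts k r M, ∀ i, ContDiffOn ℝ ∞ (vcomp e X i) e.target

/-- Smooth symmetric contravariant two-tensors. -/
structure IsSymTensor (T : Tensor2 k r M) : Prop where
  symm : ∀ x α β, T x α β = T x β α
  smooth : ∀ e ∈ Charts k r M, ∀ i j, ContDiffOn ℝ ∞ (tcomp e T i j) e.target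

/-- Contravariant pseudo-Riemannian metrics, of arbitrary signature. -/
structure IsMetric (G : Tensor2 k r M) : Prop extends IsSymTensor G where
  nondeg : ∀ x α, (∀ β, G x α β = 0) → α = 0

/-- `L_X T = 0`, with `(L_X T)^{ij} = X^h ∂_h T^{ij} - T^{hj} ∂_h X^i - T^{ih} ∂_h X^j`. -/
def LieInvariant (X : VField k r M) (T : Tensor2 k r M) : Prop :=
  ∀ e ∈ Charts k r M, ∀ u ∈ e.target, ∀ i j : Idx k r,
    ∑ h, (vcomp e X h u * pd h (tcomp e T i j) u
      - tcomp e T h j u * pd h (vcomp e X i) u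
      - tcomp e T i h u * pd h (vcomp e X j) u) = 0

/-- Killing vectors of the metric `G`. -/
def IsKillingVector (G : Tensor2 k r M) (X : VField k r M) : Prop :=
  SmoothV X ∧ LieInvariant X G

/-- `[K, G] = 0` for the Lie-Schouten bracket of symmetric two-tensors, i.e. the Poisson bracket of
the functions `K^{ij} p_i p_j` and `g^{ij} p_i p_j` vanishes. -/
def SchoutenZero (K G : Tensor2 k r M) : Prop :=
  ∀ e ∈ Charts k r M, ∀ u ∈ e.target, ∀ i j l : Idx k r,
    ∑ h, (tcomp e K h i u * pd h (tcomp e G j l) u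
        + tcomp e K h j u * pd h (tcomp e G l i) u
        + tcomp e K h l u * pd h (tcomp e G i j) u
        - tcomp e G h i u * pd h (tcomp e K j l) u
        - tcomp e G h j u * pd h (tcomp e K l i) u
        - tcomp e G h l u * pd h (tcomp e K i j) u) = 0

/-- Killing tensors of the metric `G`. -/
def IsKillingTensor (G K : Tensor2 k r M) : Prop :=
  IsSymTensor K ∧ SchoutenZero K G

/-- The covector `α` is `v^♭`, i.e. `α^♯ = v`. -/
def IsFlat (G : Tensor2 k r M) (x : M) (v : TangentSpace 𝓘(ℝ, Coord k r) x)
    (α : Cotangent (k := k) (r := r) x) : Prop :=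
  ∀ β, G x α β = β v

/-- The nonzero vector `v` is an eigenvector of the two-tensor `K` (made into an endomorphism by
`G`), with eigenvalue `l`. -/
def IsEigen (G K : Tensor2 k r M) (x : M) (v : TangentSpace 𝓘(ℝ, Coord k r) x) (l : ℝ) : Prop :=
  v ≠ 0 ∧ ∃ α, IsFlat G x v α ∧ ∀ β, K x α β = l * G x α β

/-- The distribution `Δ` spanned by a linear space `D` of vector fields. -/
def distr (D : Submodule ℝ (VField k r M)) (x : M) :
    Submodule ℝ (TangentSpace 𝓘(ℝ, Coord k r) x) :=
  D.map (LinearMap.proj x : VField k r M →ₗ[ℝ] TangentSpace 𝓘(ℝ, Coord k r) x)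

/-- The orthogonal distribution `Δ^⊥`: the vectors `v` such that `v^♭` annihilates `Δ`. -/
def distrPerp (G : Tensor2 k r M) (D : Submodule ℝ (VField k r M)) (x : M) :
    Submodule ℝ (TangentSpace 𝓘(ℝ, Coord k r) x) where
  carrier := {v | ∃ α, IsFlat G x v α ∧ ∀ w ∈ distr D x, α w = 0}
  add_mem' := by
    rintro v v' ⟨α, h1, h2⟩ ⟨α', h1', h2'⟩
    refine ⟨α + α', fun β => ?_, fun w hw => ?_⟩
    · rw [map_add, LinearMap.add_apply, h1, h1', map_add]
    · change α w + α' w = 0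
      rw [h2 w hw, h2' w hw, add_zero]
  zero_mem' := ⟨0, fun β => by simp, fun w _ => by simp⟩
  smul_mem' := by
    rintro c v ⟨α, h1, h2⟩
    refine ⟨c • α, fun β => ?_, fun w hw => ?_⟩
    · rw [map_smul, LinearMap.smul_apply, h1, map_smul]
    · change c • α w = 0
      rw [h2 w hw, smul_zero]

/-- The vector field `X` is normal (orthogonally integrable): locally there are hypersurfaces
`h = const` orthogonal to it, i.e. `X^♭` is proportional to some `dh`. -/
def IsNormal (G : Tensor2 k r M) (X : VField k r M) : Prop :=
  ∀ x : M, ∃ (N : Set M) (h : M → ℝ), IsOpen N ∧ x ∈ N ∧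
    ContMDiffOn 𝓘(ℝ, Coord k r) 𝓘(ℝ, ℝ) ∞ h N ∧
    ∀ y ∈ N, ∃ c : ℝ, IsFlat G y (X y)
      (c • (mfderiv 𝓘(ℝ, Coord k r) 𝓘(ℝ, ℝ) h y : Cotangent (k := k) (r := r) y))

/-- `(D, 𝒦)` is a separable Killing algebra of the metric `G`, with common essential eigenvectors
`E a`; `m₀` is the rank of `Δ ∩ Δ^⊥`. (The closure condition on the components `g^{αβ}`, which is
imposed for `m₀ > 1`, refers to the coordinates `q^α` and is part of `IsAdapted`.) -/
structure IsSepKillingAlgebra (G : Tensor2 k r M) (D : Submodule ℝ (VField k r M))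
    (𝒦 : Submodule ℝ (Tensor2 k r M)) (E : Fin (k + 1) → VField k r M) (m₀ : ℕ) : Prop where
  metric : IsMetric G
  /- `D` is an `r`-dimensional abelian algebra of Killing vectors ... -/
  dim_D : Module.finrank ℝ D = r
  killing_D : ∀ X ∈ D, IsKillingVector G X
  abelian : ∀ X ∈ D, ∀ Y ∈ D, VectorField.mlieBracket 𝓘(ℝ, Coord k r) X Y = 0
  /- ... which spans a distribution of rank `r`, and `Δ ∩ Δ^⊥` has constant rank. -/
  rank_distr : ∀ x, Module.finrank ℝ (distr D x) = r
  rank_iso : ∀ x, Module.finrank ℝ (distr D x ⊓ distrPerp G D x : Submodule ℝ _) = m₀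
  /- `𝒦` is an `m`-dimensional space of Killing tensors ... -/
  dim_K : Module.finrank ℝ 𝒦 = k + 1
  killing_K : ∀ K ∈ 𝒦, IsKillingTensor G K
  /- ... with `m` normal common eigenvectors orthogonal to `D`, with real eigenvalues. -/
  smooth_E : ∀ a, SmoothV (E a)
  indep_E : ∀ x, LinearIndependent ℝ (fun a => E a x)
  perp_E : ∀ a x, E a x ∈ distrPerp G D x
  normal_E : ∀ a, IsNormal G (E a)
  eigen_E : ∀ K ∈ 𝒦, ∀ a x, ∃ l : ℝ, IsEigen G K x (E a x) l
  /- Independence of the tensors in `𝒦`, pointwise and as regards the eigenvalues on the `E a`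
  (the matrix of essential eigenvalues of a basis of `𝒦` is regular). -/
  regular : ∀ K ∈ 𝒦, ∀ x, (∀ a, IsEigen G K x (E a x) 0) → K = 0
  /- `𝒦` is `D`-invariant. -/
  invariant : ∀ X ∈ D, ∀ K ∈ 𝒦, LieInvariant X K

/-- The components `g_{ih} K^{hj} ∂_j f` of the one-form `K · df`. -/
def kdform (e : OpenPartialHomeomorph M (Coord k r)) (G K : Tensor2 k r M) (f : Coord k r → ℝ)
    (i : Idx k r) (u : Coord k r) : ℝ :=
  (((tmat e G u)⁻¹ * tmat e K u).mulVec fun j => pd j f u) i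

/-- The chart `e = (q^a, q^α)` is adapted to the separable Killing algebra `(D, 𝒦)`. -/
structure IsAdapted (G : Tensor2 k r M) (D : Submodule ℝ (VField k r M))
    (𝒦 : Submodule ℝ (Tensor2 k r M)) (E : Fin (k + 1) → VField k r M) (m₀ : ℕ)
    (e : OpenPartialHomeomorph M (Coord k r)) : Prop where
  chart : e ∈ Charts k r M
  /- The coordinate hypersurfaces of `q^a` are orthogonal to `E a`. -/
  orth : ∀ a, ∀ x ∈ e.source, ∃ c : ℝ, IsFlat G x (E a x) (c • dq e (Sum.inl a) x)
  /- The vector fields `∂_α` form a basis of `D`. -/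
  basis : ∃ X : Module.Basis (Fin r) ℝ D, ∀ α, ∀ x ∈ e.source, ∀ j,
    dq e j x ((X α : VField k r M) x) = if j = Sum.inr α then 1 else 0
  /- The sections `q^α = const` are tangent to the non-null eigenvectors (for `m₀ = 0` this says that
  they are integral manifolds of `Δ^⊥`). -/
  sect : ∀ a, ∀ x ∈ e.source, tcomp e G (Sum.inl a) (Sum.inl a) (e x) ≠ 0 →
    ∀ α, dq e (Sum.inr α) x (E a x) = 0
  /- For `m₀ > 1`: `d(K · dg^{αβ}) = 0`, where `g^{αβ} = G(dq^α, dq^β)`. -/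
  closed : 1 < m₀ → ∀ K ∈ 𝒦, ∀ α β : Fin r, ∀ u ∈ e.target, ∀ i j : Idx k r,
    pd i (kdform e G K (tcomp e G (Sum.inr α) (Sum.inr β)) j) u
      = pd j (kdform e G K (tcomp e G (Sum.inr α) (Sum.inr β)) i) u

end Fields

section Staeckel

variable {k r : ℕ}

/-- The matrix `S = (φ_j^{(i)})` (row `j`, column `i`), whose entry `φ_j^{(i)} = s j i` is a function
of the coordinate `q^j` only. -/
def smat (s : Fin (k + 1) → Fin (k + 1) → ℝ → ℝ) (u : Coord k r) :
    Matrix (Fin (k + 1)) (Fin (k + 1)) ℝ :=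
  Matrix.of fun j i => s j i (u (Sum.inl j))

/-- The last row `φ^b_{(m)}` of the inverse of `S`. -/
def phi (s : Fin (k + 1) → Fin (k + 1) → ℝ → ℝ) (b : Fin (k + 1)) (u : Coord k r) : ℝ :=
  (smat s u)⁻¹ (Fin.last k) b

/-- The contravariant metric `g` on the coordinate domain `V` is in standard separable form, with
isotropic indices `ā ∈ null`, Stäckel matrix `S = smat s` and functions `θ^β_ā = θ ā β`,
`η^{αβ}_a = η a α β` of the coordinate of the lower index only. -/
structure IsStandardForm (g : Coord k r → Matrix (Idx k r) (Idx k r) ℝ) (V : Set (Coord k r))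
    (null : Set (Fin (k + 1))) (s : Fin (k + 1) → Fin (k + 1) → ℝ → ℝ)
    (θ : Fin (k + 1) → Fin r → ℝ → ℝ) (η : Fin (k + 1) → Fin r → Fin r → ℝ → ℝ) : Prop where
  smooth_s : ∀ j i, ContDiffOn ℝ ∞ (fun u : Coord k r => s j i (u (Sum.inl j))) V
  smooth_θ : ∀ a ∈ null, ∀ β, ContDiffOn ℝ ∞ (fun u : Coord k r => θ a β (u (Sum.inl a))) V
  smooth_η : ∀ a α β, ContDiffOn ℝ ∞ (fun u : Coord k r => η a α β (u (Sum.inl a))) V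
  regular_s : ∀ u ∈ V, (smat s u).det ≠ 0
  ignorable : ∀ u ∈ V, ∀ (α : Fin r) (i j : Idx k r), pd (Sum.inr α) (fun v => g v i j) u = 0
  symm_g : ∀ u ∈ V, (g u).IsSymm
  offdiag : ∀ u ∈ V, ∀ a b, a ≠ b → g u (Sum.inl a) (Sum.inl b) = 0
  hat_diag : ∀ u ∈ V, ∀ a ∉ null, g u (Sum.inl a) (Sum.inl a) = phi s a u
  hat_mixed : ∀ u ∈ V, ∀ a ∉ null, ∀ α, g u (Sum.inl a) (Sum.inr α) = 0
  bar_diag : ∀ u ∈ V, ∀ a ∈ null, g u (Sum.inl a) (Sum.inl a) = 0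
  bar_mixed : ∀ u ∈ V, ∀ a ∈ null, ∀ β,
    g u (Sum.inl a) (Sum.inr β) = θ a β (u (Sum.inl a)) * phi s a u
  ignorable_block : ∀ u ∈ V, ∀ α β,
    g u (Sum.inr α) (Sum.inr β) = ∑ a, η a α β (u (Sum.inl a)) * phi s a u

end Staeckel

section Symmetries

variable {k r : ℕ} {M : Type*} [TopologicalSpace M] [ChartedSpace (Coord k r) M]

/-- `e` is a system of standard separable coordinates and `∂_a` is a conformal Stäckel symmetry:
`∂_a ln φ^b_{(m)} = F` for all `b`. -/
def IsCSSymmetry (G : Tensor2 k r M) (e : OpenPartialHomeomorph M (Coord k r))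
    (a : Fin (k + 1)) : Prop :=
  ∃ null s θ η, IsStandardForm (tmat e G) e.target null s θ η ∧
    ∃ F : Coord k r → ℝ, ∀ u ∈ e.target, ∀ b,
      phi s b u ≠ 0 ∧ pd (Sum.inl a) (phi s b) u = F u * phi s b u

/-- `e` is a system of standard separable coordinates and `∂_a` is a Stäckel symmetry: a conformal
Stäckel symmetry with `F = 0`. -/
def IsSSymmetry (G : Tensor2 k r M) (e : OpenPartialHomeomorph M (Coord k r))
    (a : Fin (k + 1)) : Prop :=
  ∃ null s θ η, IsStandardForm (tmat e G) e.target null s θ η ∧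
    ∀ u ∈ e.target, ∀ b, phi s b u ≠ 0 ∧ pd (Sum.inl a) (phi s b) u = 0

/-- The chart `e'` arises from `e` (on the possibly smaller domain of `e'`) by a rescaling
`ρ(q^a)` of the single coordinate `q^a`. As `e'` is a smooth chart, `ρ` is
automatically smooth with nonvanishing derivative where it matters. -/
def IsRescaling (e e' : OpenPartialHomeomorph M (Coord k r)) (a : Fin (k + 1)) : Prop :=
  e' ∈ Charts k r M ∧ e'.source ⊆ e.source ∧
    ∃ ρ : ℝ → ℝ, ∀ x ∈ e'.source,
      e' x = Function.update (e x) (Sum.inl a) (ρ (e x (Sum.inl a)))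

end Symmetries

section Fundamental

variable {k : ℕ} {M : Type*}

/-- `det Λ_b^a`: the minor of `Λ` without the `b`-th row and the `a`-th column. -/
def minor (Λ : M → Matrix (Fin (k + 1)) (Fin (k + 1)) ℝ) (a b : Fin (k + 1)) (x : M) : ℝ :=
  ((Λ x).submatrix b.succAbove a.succAbove).det

/-- The fundamental function `f_a^{bc} = det Λ_b^a / det Λ_c^a`. -/
def fund (Λ : M → Matrix (Fin (k + 1)) (Fin (k + 1)) ℝ) (a b c : Fin (k + 1)) (x : M) : ℝ :=
  minor Λ a b x / minor Λ a c x

/-- On `U`, the function `f_a^{bc}` is undefined (its denominator vanishes identically) or constant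
(where its denominator does not vanish). -/
def FundConstOrUndef (Λ : M → Matrix (Fin (k + 1)) (Fin (k + 1)) ℝ) (U : Set M)
    (a b c : Fin (k + 1)) : Prop :=
  (∀ x ∈ U, minor Λ a c x = 0) ∨
    ∃ κ : ℝ, ∀ x ∈ U, minor Λ a c x ≠ 0 → fund Λ a b c x = κ

end Fundamental

end SepKilling

end

/-! In adapted coordinates, let `W_a^{ij} = λ_c^a ∂_a g^{ij} - ∂_a K_c^{ij}`. Orthogonality of the
eigenvectors and invariance under `D` turn the Killing equation `[K_c, G] = 0` into the vanishing of
the cyclic sum of `Σ_a g^{ai} W_a^{jl}`. Pointwise linear algebra then gives `W_a^{bj} = 0` for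
every essential `b`, null rows included. These are the Eisenhart equations `g^{bj} ∂_a λ_c^b =
(λ_c^a - λ_c^b) ∂_a g^{bj}` (`schouten_algebra`, `killing_equations`).

Choose functions `φ^b` proportional to the rows `g^{bj}` up to factors of `q^b` alone, and set `P =
(λ_c^b φ^b)`. The Eisenhart equations become `∂_a P = λ^a ⊗ ∂_a φ`, a matrix of rank one. For `S =
P⁻¹` one has `S λ^a = e_a / φ^a`, hence `∂_a S = -(e_a / φ^a) ⊗ (∂_a φ · S)`: only row `a` of `S`
depends on `q^a`, so `S` is a Stäckel matrix. Since `K_m = G` has eigenvalues 1, the last row of `P`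
is `φ`, and so `φ · S = e_m`. The closed forms `K_c · dg^{αβ}` supply the functions `η`, which
completes the standard form on convex domains.

The link with the fundamental functions is Cramer's rule (`EisenhartData.minor_eq`): `det Λ_c^a = ±
det Λ · φ^a · S_{ac}`, so `f_a^{bc}` is, up to sign, the ratio `S_{ab} / S_{ac}`. If `∂_a φ^b = F
φ^b` for all `b`, then `∂_a S_{ac} = -(F / φ^a) δ_{cm}`; row `a` is therefore constant except
possibly in column `m`, and constant there too when `F = 0`. This holds for the `φ` of any
admissible standard form (`minor_locally`), and connectedness globalizes it
(`fundConstOrUndef_of_locally`).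

Conversely, constant ratios make the relevant entries of row `a` constant multiples of one entry
without zeros (`exists_common_factor`). A rescaling with derivative `w` divides row `a` of `S` by
`w²`, so taking `w` to be the square root of the absolute value of that entry makes these entries
constant (`exists_rescaling`). Then `∂_a S` has at most the entry `(a, m)`, which forces `∂_a φ^b =
F φ^b`. Both parts of the theorem are instances of `symmetry_iff`, with `C` the set of columns
required to become constant: all but the last, or all. -/

namespace SepKilling

open Matrix

/-! ### Pointwise linear algebra of the Killing equation -/

section Algebra

theorem coeff_eq_zero {ι W : Type*} [Fintype ι] [AddCommMonoid W] [Module ℝ W] {S : Submodule ℝ W}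
    (K : Module.Basis ι ℝ S) {t : ι → ℝ} (h : ((∑ c, t c • K c : S) : W) = 0) : t = 0 := by
  have h1 : (∑ c, t c • K c : S) = 0 := Subtype.ext h
  rw [← K.repr_sum_self t, h1, map_zero]; rfl

theorem exists_dual_family {ι R : Type*} [Fintype ι] [DecidableEq ι] [Fintype R] [DecidableEq R]
    (B : Set ι) (g : ι → R → ℝ) (hg : LinearIndependent ℝ (fun a : B => g a))
    (h0 : ∀ a ∉ B, g a = 0) :
    ∃ ξ : ι → R → ℝ, ∀ a ∈ B, ∀ c, ξ a ⬝ᵥ g c = if a = c then 1 else 0 := by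
  classical
  obtain ⟨l, hl⟩ := LinearMap.exists_leftInverse_of_injective
    (Fintype.linearCombination ℝ (fun a : B => g a)) (LinearMap.ker_eq_bot.2
      (linearIndependent_iff_injective_fintypeLinearCombination.1 hg))
  refine ⟨fun a β => if h : a ∈ B then l (Pi.single β 1) ⟨a, h⟩ else 0, fun a ha c => ?_⟩
  by_cases hc : c ∈ B
  · have h1 : l (g c) = Pi.single (⟨c, hc⟩ : B) 1 := by
      have := LinearMap.congr_fun hl (Pi.single (⟨c, hc⟩ : B) 1)
      simpa [Fintype.linearCombination_apply_single] using this
    have h2 : l (g c) ⟨a, ha⟩ = ∑ β, g c β * l (Pi.single β 1) ⟨a, ha⟩ := by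
      conv_lhs => rw [pi_eq_sum_univ' (g c)]
      simp [Finset.sum_apply, Pi.smul_apply]
    rw [h1] at h2
    simp only [ha, dif_pos, dotProduct]
    rw [Finset.sum_congr rfl fun β _ => mul_comm _ _, ← h2, Pi.single_apply]
    simp
  · rw [h0 c hc, dotProduct_zero, if_neg]
    rintro rfl; exact hc ha

/-- With `W_a = (Λ^a - Λ^b) d_a - dL_a g_b`, the hypothesis says that the symmetric part of `Σ_a g_a
⊗ W_a` vanishes. Contracting with the dual family `ξ` once gives `W_e = -Σ_a (ξ_e · W_a) g_a`, and
twice gives that `ξ_f · W_e` is skew in `e, f`. The skew matrix is then shown to vanish, because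
combinations of the rows of `Λ` separate the indices. -/
theorem null_block {κ ι R : Type*} [Fintype κ] [Fintype ι] [DecidableEq ι] [Fintype R]
    [DecidableEq R] (Λ : Matrix κ ι ℝ)
    (hΛ : ∀ a, ∃ t : κ → ℝ, ∀ b, ∑ c, t c * Λ c b = if b = a then 1 else 0)
    (B : Set ι) (g : ι → R → ℝ) (hg : LinearIndependent ℝ (fun a : B => g a))
    (h0 : ∀ a ∉ B, g a = 0) {b : ι} (hb : b ∈ B) (d : ι → R → ℝ) (dL : κ → ι → ℝ)
    (h : ∀ c β γ, ∑ a, (g a β * ((Λ c a - Λ c b) * d a γ - dL c a * g b γ)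
      + g a γ * ((Λ c a - Λ c b) * d a β - dL c a * g b β)) = 0) :
    ∀ c, ∀ a ∈ B, ∀ γ, (Λ c a - Λ c b) * d a γ - dL c a * g b γ = 0 := by
  obtain ⟨ξ, hξ⟩ := exists_dual_family B g hg h0
  set W : κ → ι → R → ℝ := fun c a γ => (Λ c a - Λ c b) * d a γ - dL c a * g b γ with hW
  have hξW : ∀ c a e, e ∈ B → ξ e ⬝ᵥ W c a
      = (Λ c a - Λ c b) * (ξ e ⬝ᵥ d a) - dL c a * (if e = b then 1 else 0) := by
    intro c a e he
    have : W c a = (Λ c a - Λ c b) • d a - dL c a • g b := by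
      ext γ; simp [hW]
    rw [this, dotProduct_sub, dotProduct_smul, dotProduct_smul, hξ e he]; simp
  have h2 : ∀ c, ∀ e ∈ B, ∀ γ, W c e γ + ∑ a, g a γ * (ξ e ⬝ᵥ W c a) = 0 := by
    intro c e he γ
    have h3 : ∑ β, ξ e β * ∑ a, (g a β * W c a γ + g a γ * W c a β) = 0 :=
      Finset.sum_eq_zero fun β _ => by rw [h c β γ, mul_zero]
    have h4 : ∑ β, ξ e β * ∑ a, (g a β * W c a γ + g a γ * W c a β)
        = ∑ a, ((ξ e ⬝ᵥ g a) * W c a γ + g a γ * (ξ e ⬝ᵥ W c a)) := by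
      simp only [Finset.mul_sum, dotProduct, Finset.sum_mul]
      rw [Finset.sum_comm]
      refine Finset.sum_congr rfl fun a _ => ?_
      rw [← Finset.sum_add_distrib]
      exact Finset.sum_congr rfl fun β _ => by ring
    rw [h4, Finset.sum_add_distrib] at h3
    simpa [hξ e he] using h3
  have h5 : ∀ c, ∀ e ∈ B, ∀ f ∈ B, ξ f ⬝ᵥ W c e + ξ e ⬝ᵥ W c f = 0 := by
    intro c e he f hf
    have h3 : ∑ γ, ξ f γ * (W c e γ + ∑ a, g a γ * (ξ e ⬝ᵥ W c a)) = 0 :=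
      Finset.sum_eq_zero fun γ _ => by rw [h2 c e he γ, mul_zero]
    have h4 : ∑ γ, ξ f γ * (W c e γ + ∑ a, g a γ * (ξ e ⬝ᵥ W c a))
        = ξ f ⬝ᵥ W c e + ∑ a, (ξ f ⬝ᵥ g a) * (ξ e ⬝ᵥ W c a) := by
      simp only [mul_add, Finset.sum_add_distrib]
      congr 1
      simp only [Finset.mul_sum]
      rw [Finset.sum_comm]
      refine Finset.sum_congr rfl fun a _ => ?_
      rw [show ξ f ⬝ᵥ g a = ∑ γ, ξ f γ * g a γ from rfl, Finset.sum_mul]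
      exact Finset.sum_congr rfl fun β _ => by ring
    rw [h4] at h3
    simpa [hξ f hf] using h3
  -- The diagonal entry at `b` of a skew matrix: `W_b` reduces to `-dL_b g_b`.
  have hbb : ∀ c, dL c b = 0 := by
    intro c
    have := h5 c b hb b hb
    rw [hξW c b b hb] at this
    simp at this; linarith
  have hWb : ∀ c e, ξ e ⬝ᵥ W c b = 0 := by
    intro c e
    have : W c b = 0 := by ext γ; simp [hW, hbb]
    rw [this, dotProduct_zero]
  -- Away from `b` the `dL` term is invisible to `ξ`. The weights `t` turn the factor `Λ^e - Λ^b`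
  -- into 1, and, for `f ≠ e`, the factor `Λ^f - Λ^b` into 0.
  have hoff : ∀ e ∈ B, ∀ f ∈ B, e ≠ b → f ≠ b → ξ f ⬝ᵥ d e = 0 := by
    intro e he f hf heb hfb
    obtain ⟨t, ht⟩ := hΛ e
    have h6 : ∑ c, t c * (ξ f ⬝ᵥ W c e + ξ e ⬝ᵥ W c f) = 0 :=
      Finset.sum_eq_zero fun c _ => by rw [h5 c e he f hf, mul_zero]
    have h7 : ∀ c, t c * (ξ f ⬝ᵥ W c e + ξ e ⬝ᵥ W c f)
        = (t c * Λ c e - t c * Λ c b) * (ξ f ⬝ᵥ d e)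
          + (t c * Λ c f - t c * Λ c b) * (ξ e ⬝ᵥ d f) := by
      intro c
      rw [hξW c e f hf, hξW c f e he]; simp [hfb, heb]; ring
    simp only [h7, Finset.sum_add_distrib, ← Finset.sum_mul, Finset.sum_sub_distrib, ht] at h6
    by_cases hef : f = e
    · subst hef; simp [Ne.symm heb] at h6; linarith
    · simpa [hef, Ne.symm heb] using h6
  intro c a ha γ
  have hall : ∀ f ∈ B, ∀ e ∈ B, ξ e ⬝ᵥ W c f = 0 := by
    intro f hf e he
    by_cases hfb : f = b
    · subst hfb; exact hWb c e
    by_cases heb : e = b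
    · subst heb
      have := h5 c e he f hf
      rw [hWb, zero_add] at this
      exact this
    · rw [hξW c f e he, hoff f hf e he hfb heb]; simp [heb]
  have h8 := h2 c a ha γ
  rw [Finset.sum_eq_zero, add_zero] at h8
  · exact h8
  · intro f _
    by_cases hf : f ∈ B
    · rw [hall f hf a ha, mul_zero]
    · rw [h0 f hf]; simp

/-- The pointwise consequences of the Killing equation `[K_c, G] = 0` on a frame in which the metric
is block diagonal. Here `d a` and `dK c a` are the derivatives of the components of the metric and
of `K_c`, and `dL c a b` is the derivative of the eigenvalue `Λ c b`. -/
theorem schouten_algebra {κ : Type*} [Fintype κ] {k r : ℕ} (Λ : Matrix κ (Fin (k + 1)) ℝ)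
    (hΛ : ∀ a, ∃ t : κ → ℝ, ∀ b, ∑ c, t c * Λ c b = if b = a then 1 else 0)
    (N : Set (Fin (k + 1))) (g : Idx k r → Idx k r → ℝ)
    (hg0 : ∀ a b, a ≠ b → g (Sum.inl a) (Sum.inl b) = 0)
    (hgN : ∀ a, g (Sum.inl a) (Sum.inl a) = 0 ↔ a ∈ N)
    (hgm : ∀ a ∉ N, ∀ α, g (Sum.inl a) (Sum.inr α) = 0)
    (hind : LinearIndependent ℝ (fun a : N => fun α => g (Sum.inl a) (Sum.inr α)))
    (d : Fin (k + 1) → Idx k r → Idx k r → ℝ) (dL : κ → Fin (k + 1) → Fin (k + 1) → ℝ)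
    (W : κ → Fin (k + 1) → Idx k r → Idx k r → ℝ) (hWs : ∀ c a i j, W c a i j = W c a j i)
    (hWL : ∀ c a b j, W c a (Sum.inl b) j
      = (Λ c a - Λ c b) * d a (Sum.inl b) j - dL c a b * g (Sum.inl b) j)
    (hW0 : ∀ c a b b', b ≠ b' → W c a (Sum.inl b) (Sum.inl b') = 0)
    (hWm : ∀ c a, ∀ b ∉ N, ∀ α, W c a (Sum.inl b) (Sum.inr α) = 0)
    (hWN : ∀ c a, ∀ b ∈ N, W c a (Sum.inl b) (Sum.inl b) = 0)
    (hS : ∀ c i j l, ∑ a, (g (Sum.inl a) i * W c a j l + g (Sum.inl a) j * W c a l i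
      + g (Sum.inl a) l * W c a i j) = 0) :
    (∀ c a b j, W c a (Sum.inl b) j = 0) ∧
    (N.Subsingleton → ∀ c a α β, W c a (Sum.inr α) (Sum.inr β) = 0) := by
  classical
  have hsum : ∀ b (f : Fin (k + 1) → ℝ), ∑ a, g (Sum.inl a) (Sum.inl b) * f a
      = g (Sum.inl b) (Sum.inl b) * f b := fun b f =>
    Finset.sum_eq_single b (fun a _ hab => by rw [hg0 a b hab, zero_mul]) (by simp)
  have hclaim : ∀ c a, ∀ b ∉ N, ∀ l, l ≠ Sum.inl b → W c a l (Sum.inl b) = 0 := by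
    rintro c a b hb (b' | α) hl
    · exact hW0 _ _ _ _ fun h => hl (by rw [h])
    · rw [hWs]; exact hWm c a b hb α
  -- For a non-null `a`, putting the index `a` in the first slot isolates `g^{aa} W_a^{jl}`, since
  -- the other two terms involve components that vanish by `hclaim`.
  have h1 : ∀ c, ∀ a ∉ N, ∀ j l, W c a j l = 0 := by
    intro c a ha j l
    have hga : g (Sum.inl a) (Sum.inl a) ≠ 0 := fun h => ha ((hgN a).1 h)
    have hS1 := hS c (Sum.inl a) j l
    simp only [Finset.sum_add_distrib, hsum] at hS1
    by_cases hj : j = Sum.inl a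
    · by_cases hl : l = Sum.inl a
      · subst hj; subst hl
        simp only [hsum] at hS1
        have : g (Sum.inl a) (Sum.inl a) * W c a (Sum.inl a) (Sum.inl a) = 0 := by linarith
        exact (mul_eq_zero.1 this).resolve_left hga
      · subst hj; rw [hWs]; exact hclaim c a a ha l hl
    · by_cases hl : l = Sum.inl a
      · subst hl; exact hclaim c a a ha j hj
      · rw [Finset.sum_eq_zero (fun x _ => by rw [hclaim c x a ha l hl, mul_zero]),
          Finset.sum_eq_zero (fun x _ => by rw [hWs, hclaim c x a ha j hj, mul_zero]),
          add_zero, add_zero] at hS1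
        exact (mul_eq_zero.1 hS1).resolve_left hga
  set v : Fin (k + 1) → Fin r → ℝ := fun a α => g (Sum.inl a) (Sum.inr α) with hv
  have hv0 : ∀ a ∉ N, v a = 0 := fun a ha => funext fun α => hgm a ha α
  obtain ⟨ξ, hξ⟩ := exists_dual_family N v hind hv0
  -- The equation with indices `(γ, b, b)` reads `Σ_x v_x^γ W_x^{bb} = 0`; independence of the null
  -- rows removes the sum.
  have h2 : ∀ c, ∀ a ∈ N, ∀ b ∉ N, W c a (Sum.inl b) (Sum.inl b) = 0 := by
    intro c a ha b hb
    have h3 : ∀ γ, ∑ x, v x γ * W c x (Sum.inl b) (Sum.inl b) = 0 := by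
      intro γ
      have hS1 := hS c (Sum.inr γ) (Sum.inl b) (Sum.inl b)
      simp only [Finset.sum_add_distrib, hsum] at hS1
      rw [hWs c b (Sum.inr γ), hWm c b b hb γ] at hS1
      simpa using hS1
    have h4 : ∑ γ, ξ a γ * ∑ x, v x γ * W c x (Sum.inl b) (Sum.inl b)
        = ∑ x, (ξ a ⬝ᵥ v x) * W c x (Sum.inl b) (Sum.inl b) := by
      simp only [dotProduct, Finset.mul_sum, Finset.sum_mul]
      rw [Finset.sum_comm]
      simp only [mul_assoc]
    simpa [h3, hξ a ha] using h4.symm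
  have h3 : ∀ c, ∀ a ∈ N, ∀ b ∈ N, ∀ γ, W c a (Sum.inl b) (Sum.inr γ) = 0 := by
    intro c a ha b hb γ
    rw [hWL]
    refine null_block Λ hΛ N v hind hv0 hb (fun a γ => d a (Sum.inl b) (Sum.inr γ))
      (fun c a => dL c a b) (fun c β γ => ?_) c a ha γ
    have hS1 := hS c (Sum.inr β) (Sum.inr γ) (Sum.inl b)
    simp only [Finset.sum_add_distrib, hsum, (hgN b).2 hb, zero_mul, add_zero] at hS1
    rw [← Finset.sum_add_distrib] at hS1
    rw [← hS1]
    refine Finset.sum_congr rfl fun x _ => ?_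
    rw [hWs c x (Sum.inr γ), hWL, hWL]
  refine ⟨fun c a b j => ?_, fun hN c a α β => ?_⟩
  · by_cases ha : a ∈ N
    · rcases j with b' | γ
      · by_cases hbb : b = b'
        · subst hbb
          by_cases hb : b ∈ N
          · exact hWN c a b hb
          · exact h2 c a ha b hb
        · exact hW0 c a b b' hbb
      · by_cases hb : b ∈ N
        · exact h3 c a ha b hb γ
        · exact hWm c a b hb γ
    · exact h1 c a ha _ _
  · by_cases ha : a ∈ N
    · have h4 : ∀ β γ δ, v a β * W c a (Sum.inr γ) (Sum.inr δ)
          + v a γ * W c a (Sum.inr δ) (Sum.inr β) + v a δ * W c a (Sum.inr β) (Sum.inr γ) = 0 := by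
        intro β γ δ
        rw [← hS c (Sum.inr β) (Sum.inr γ) (Sum.inr δ), Finset.sum_eq_single a _ (by simp)]
        intro x _ hx
        have hxN : x ∉ N := fun h => hx (hN h ha)
        rw [hgm x hxN, hgm x hxN, hgm x hxN]; ring
      obtain ⟨δ, hδ⟩ : ∃ δ, v a δ ≠ 0 := by
        by_contra! h
        have := hξ a ha a
        rw [show v a = 0 from funext h, dotProduct_zero] at this
        simp at this
      have h5 : W c a (Sum.inr δ) (Sum.inr δ) = 0 := by
        have := h4 δ δ δ
        have h6 : v a δ * W c a (Sum.inr δ) (Sum.inr δ) = 0 := by linarith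
        exact (mul_eq_zero.1 h6).resolve_left hδ
      have h6 : ∀ β, W c a (Sum.inr δ) (Sum.inr β) = 0 := by
        intro β
        have := h4 δ δ β
        rw [h5, hWs c a (Sum.inr β)] at this
        have h6 : v a δ * W c a (Sum.inr δ) (Sum.inr β) = 0 := by linarith
        exact (mul_eq_zero.1 h6).resolve_left hδ
      have := h4 δ α β
      rw [h6 α, hWs c a (Sum.inr β), h6 β, mul_zero, mul_zero, add_zero, add_zero] at this
      exact (mul_eq_zero.1 this).resolve_left hδ
    · exact h1 c a ha _ _

/-- The derivative of `P` is the rank one matrix `L^a ⊗ dψ`, and `S` sends `L^a` to `e_a / ψ_a`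
because `L^a ψ_a` is column `a` of `P = S⁻¹`. Hence the derivative of `S` is concentrated in row
`a`. -/
theorem staeckel_derivative {ι : Type*} [Fintype ι] [DecidableEq ι] (L P S dP dS : Matrix ι ι ℝ)
    (ψ dψ : ι → ℝ) (hψ : ∀ b, ψ b ≠ 0) (a : ι) (hP : ∀ c b, P c b = L c b * ψ b)
    (hdP : ∀ c b, dP c b = L c a * dψ b) (hSP : S * P = 1) (hdS : dS = -(S * dP * S)) (j c : ι) :
    (S *ᵥ fun c => L c a) j = (if j = a then (ψ a)⁻¹ else 0) ∧
    dS j c = -(if j = a then (ψ a)⁻¹ else 0) * (dψ ᵥ* S) c := by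
  have h1 : ∀ j, (S *ᵥ fun c => L c a) j = (if j = a then (ψ a)⁻¹ else 0) := by
    intro j
    have h2 : (S * P) j a = (S *ᵥ fun c => L c a) j * ψ a := by
      simp only [mul_apply, mulVec, dotProduct, hP, Finset.sum_mul, mul_assoc]
    rw [hSP, one_apply] at h2
    rw [← mul_left_inj' (hψ a), ← h2]
    split_ifs <;> simp [hψ a]
  refine ⟨h1 j, ?_⟩
  have h3 : dP = vecMulVec (fun c => L c a) dψ := by
    ext c b; rw [hdP, vecMulVec_apply]
  rw [hdS, h3, mul_vecMulVec, vecMulVec_mul, Matrix.neg_apply, vecMulVec_apply, h1]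
  ring

end Algebra

/-! ### Partial derivatives on the coordinate space -/

section Calculus

variable {k r : ℕ}

theorem fderiv_eq_sum_pd (f : Coord k r → ℝ) (u v : Coord k r) :
    fderiv ℝ f u v = ∑ j, v j * pd j f u := by
  conv_lhs => rw [pi_eq_sum_univ' v]
  simp [pd]

theorem pd_congr {f g : Coord k r → ℝ} {u : Coord k r} (h : f =ᶠ[nhds u] g) (j : Idx k r) :
    pd j f u = pd j g u := by
  rw [pd, pd, h.fderiv_eq]

theorem pd_congr_on {V : Set (Coord k r)} (hV : IsOpen V) {f g : Coord k r → ℝ}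
    (h : ∀ u ∈ V, f u = g u) {u : Coord k r} (hu : u ∈ V) (j : Idx k r) : pd j f u = pd j g u :=
  pd_congr (Filter.eventuallyEq_of_mem (hV.mem_nhds hu) h) j

theorem pd_const (j : Idx k r) (c : ℝ) (u : Coord k r) : pd j (fun _ => c) u = 0 := by
  simp [pd]

theorem pd_mul {f g : Coord k r → ℝ} {u : Coord k r} (hf : DifferentiableAt ℝ f u)
    (hg : DifferentiableAt ℝ g u) (j : Idx k r) :
    pd j (fun v => f v * g v) u = pd j f u * g u + f u * pd j g u := by
  simp [pd, fderiv_fun_mul hf hg]; ring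

theorem pd_sum {ι : Type*} {s : Finset ι} {f : ι → Coord k r → ℝ} {u : Coord k r}
    (hf : ∀ i ∈ s, DifferentiableAt ℝ (f i) u) (j : Idx k r) :
    pd j (fun v => ∑ i ∈ s, f i v) u = ∑ i ∈ s, pd j (f i) u := by
  simp [pd, fderiv_fun_sum hf]

theorem pd_eq_of_hasFDerivAt {f : Coord k r → ℝ} {f' : Coord k r →L[ℝ] ℝ} {u : Coord k r}
    (h : HasFDerivAt f f' u) (j : Idx k r) : pd j f u = f' (Pi.single j 1) := by
  rw [pd, h.fderiv]

theorem contDiffOn_pd {V : Set (Coord k r)} (hV : IsOpen V) {f : Coord k r → ℝ}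
    (hf : ContDiffOn ℝ ∞ f V) (j : Idx k r) : ContDiffOn ℝ ∞ (pd j f) V :=
  (hf.fderiv_of_isOpen hV (m := ∞) (by simp)).clm_apply contDiffOn_const

theorem differentiableAt_of_contDiffOn {V : Set (Coord k r)} (hV : IsOpen V) {f : Coord k r → ℝ}
    (hf : ContDiffOn ℝ ∞ f V) {u : Coord k r} (hu : u ∈ V) : DifferentiableAt ℝ f u :=
  (hf.contDiffAt (hV.mem_nhds hu)).differentiableAt (by simp)

theorem pd_pd_comm {V : Set (Coord k r)} (hV : IsOpen V) {f : Coord k r → ℝ}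
    (hf : ContDiffOn ℝ ∞ f V) {u : Coord k r} (hu : u ∈ V) (i j : Idx k r) :
    pd i (pd j f) u = pd j (pd i f) u := by
  have hfu := hf.contDiffAt (hV.mem_nhds hu)
  have hd : DifferentiableAt ℝ (fderiv ℝ f) u :=
    (hfu.fderiv_right (m := 1) (by norm_cast)).differentiableAt (by simp)
  have h : ∀ i j, pd i (pd j f) u = fderiv ℝ (fderiv ℝ f) u (Pi.single i 1) (Pi.single j 1) := by
    intro i j
    rw [pd, show pd j f = fun v => fderiv ℝ f v (Pi.single j 1) from rfl,
      fderiv_clm_apply hd (differentiableAt_const _)]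
    simp
  rw [h, h]
  exact (hfu.isSymmSndFDerivAt 
    (minSmoothness_of_isRCLikeNormedField.trans_le
      (WithTop.coe_le_coe.2 (le_top : (2 : ℕ∞) ≤ ⊤)))).eq _ _

/-- No differentiability is required: where `f` is not differentiable, `fderiv` has the default
value 0. This allows arbitrary functions of one coordinate in `pd_coordinate_function`. -/
theorem pd_eq_zero_of_line {f : Coord k r → ℝ} {u : Coord k r} {j : Idx k r}
    (h : ∀ t : ℝ, f (u + t • Pi.single j 1) = f u) : pd j f u = 0 := by
  by_cases hf : DifferentiableAt ℝ f u
  · have h1 : HasDerivAt (fun t : ℝ => u + t • (Pi.single j 1 : Coord k r)) (Pi.single j 1) 0 := by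
      simpa using ((hasDerivAt_id (0 : ℝ)).smul_const (Pi.single j 1 : Coord k r)).const_add u
    have h2 : HasFDerivAt f (fderiv ℝ f u) (u + (0 : ℝ) • (Pi.single j 1 : Coord k r)) := by
      simpa using hf.hasFDerivAt
    have h3 := h2.comp_hasDerivAt (0 : ℝ) h1
    refine h3.unique ((hasDerivAt_const (0 : ℝ) (f u)).congr_of_eventuallyEq ?_)
    exact Filter.Eventually.of_forall h
  · simp [pd, fderiv_zero_of_not_differentiableAt hf]

theorem pd_coordinate_function {s : ℝ → ℝ} {i j : Idx k r} (hij : j ≠ i) (u : Coord k r) :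
    pd j (fun v => s (v i)) u = 0 :=
  pd_eq_zero_of_line fun t => by simp [hij.symm]

/-- On a convex open set, a function takes the same value at two points that differ only in
coordinates with respect to which its partial derivatives vanish. -/
theorem eq_of_pd_eq_zero {V : Set (Coord k r)} (hV : IsOpen V) (hc : Convex ℝ V)
    {f : Coord k r → ℝ} (hf : ContDiffOn ℝ ∞ f V) {u v : Coord k r} (hu : u ∈ V) (hv : v ∈ V)
    (h : ∀ z ∈ V, ∀ j, u j = v j ∨ pd j f z = 0) : f u = f v := by
  obtain ⟨z, hz, hz'⟩ := domain_mvt (f := f) (s := V) (f' := fderiv ℝ f)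
    (fun x hx => (differentiableAt_of_contDiffOn hV hf hx).hasFDerivAt.hasFDerivWithinAt) hc hv hu
  rw [fderiv_eq_sum_pd, Finset.sum_eq_zero] at hz'
  · linarith
  · intro j _
    rcases h z (hc.segment_subset hv hu hz) j with hj | hj
    · simp [hj]
    · rw [hj, mul_zero]

/-- The slices of a convex set by `u i = const` are convex, so `f` is constant on each of them. The
value of `s` at a point is read off at any chosen point of the slice, and is 0 if the slice is
empty. -/
theorem exists_coordinate_function {V : Set (Coord k r)} (hV : IsOpen V) (hc : Convex ℝ V)
    {f : Coord k r → ℝ} (hf : ContDiffOn ℝ ∞ f V) (i : Idx k r)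
    (h : ∀ u ∈ V, ∀ j, j ≠ i → pd j f u = 0) : ∃ s : ℝ → ℝ, ∀ u ∈ V, s (u i) = f u := by
  classical
  refine ⟨fun x => if hx : ∃ u ∈ V, u i = x then f hx.choose else 0, fun u hu => ?_⟩
  have hx : ∃ v ∈ V, v i = u i := ⟨u, hu, rfl⟩
  simp only [dif_pos hx]
  refine eq_of_pd_eq_zero hV hc hf hx.choose_spec.1 hu fun z hz j => ?_
  by_cases hj : j = i
  · left; rw [hj]; exact hx.choose_spec.2
  · exact Or.inr (h z hz j hj)

theorem contDiffOn_det {ι : Type*} [Fintype ι] [DecidableEq ι] {V : Set (Coord k r)}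
    {A : Coord k r → Matrix ι ι ℝ} (hA : ∀ i j, ContDiffOn ℝ ∞ (fun u => A u i j) V) :
    ContDiffOn ℝ ∞ (fun u => (A u).det) V := by
  simp only [det_apply']
  exact ContDiffOn.sum fun σ _ => contDiffOn_const.mul (contDiffOn_prod fun i _ => hA _ _)

theorem contDiffOn_inv_apply {ι : Type*} [Fintype ι] [DecidableEq ι] {V : Set (Coord k r)}
    {A : Coord k r → Matrix ι ι ℝ} (hA : ∀ i j, ContDiffOn ℝ ∞ (fun u => A u i j) V)
    (hd : ∀ u ∈ V, (A u).det ≠ 0) (i j : ι) : ContDiffOn ℝ ∞ (fun u => (A u)⁻¹ i j) V := by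
  simp only [inv_def, Ring.inverse_eq_inv', Matrix.smul_apply, smul_eq_mul, adjugate_apply]
  refine ((contDiffOn_det hA).inv hd).mul (contDiffOn_det fun a b => ?_)
  by_cases h : a = j
  · subst h; simpa only [updateRow_self] using contDiffOn_const
  · simpa only [updateRow_ne h] using hA a b

theorem pd_inverse {ι : Type*} [Fintype ι] [DecidableEq ι] {V : Set (Coord k r)} (hV : IsOpen V)
    {A B : Coord k r → Matrix ι ι ℝ} (hA : ∀ i j, ContDiffOn ℝ ∞ (fun u => A u i j) V)
    (hB : ∀ i j, ContDiffOn ℝ ∞ (fun u => B u i j) V) (hAB : ∀ u ∈ V, A u * B u = 1)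
    {u : Coord k r} (hu : u ∈ V) (l : Idx k r) :
    (Matrix.of fun i j => pd l (fun v => B v i j) u)
      = -(B u * (Matrix.of fun i j => pd l (fun v => A v i j) u) * B u) := by
  have h1 : (Matrix.of fun i j => pd l (fun v => A v i j) u) * B u
      + A u * (Matrix.of fun i j => pd l (fun v => B v i j) u) = 0 := by
    ext i j
    have h2 : pd l (fun v => ∑ x, A v i x * B v x j) u = 0 := by
      rw [pd_congr_on hV (g := fun _ => (1 : Matrix ι ι ℝ) i j) (fun v hv => ?_) hu, pd_const]
      rw [← mul_apply, hAB v hv]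
    rw [pd_sum (f := fun x v => A v i x * B v x j) (fun x _ => (differentiableAt_of_contDiffOn hV (hA i x) hu).mul
      (differentiableAt_of_contDiffOn hV (hB x j) hu))] at h2
    simp only [Matrix.add_apply, mul_apply, of_apply, Matrix.zero_apply]
    rw [← Finset.sum_add_distrib, ← h2]
    refine Finset.sum_congr rfl fun x _ => ?_
    rw [pd_mul (differentiableAt_of_contDiffOn hV (hA i x) hu)
      (differentiableAt_of_contDiffOn hV (hB x j) hu)]
  have h3 : B u * A u = 1 := mul_eq_one_comm.1 (hAB u hu)
  have h4 := congrArg (B u * ·) h1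
  simp only [mul_add, ← mul_assoc, h3, one_mul, mul_zero] at h4
  exact eq_neg_of_add_eq_zero_right h4

end Calculus

/-! ### Coordinate coframes and frames on the manifold -/

section Frames

variable {k r : ℕ} {M : Type*} [TopologicalSpace M] [ChartedSpace (Coord k r) M]

theorem mdifferentiable_chart {e : OpenPartialHomeomorph M (Coord k r)} (he : e ∈ Charts k r M) :
    e.MDifferentiable 𝓘(ℝ, Coord k r) 𝓘(ℝ, Coord k r) :=
  ⟨(contMDiffOn_of_mem_maximalAtlas he).mdifferentiableOn (by simp),
    (contMDiffOn_symm_of_mem_maximalAtlas he).mdifferentiableOn (by simp)⟩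

theorem dq_apply {e : OpenPartialHomeomorph M (Coord k r)} (he : e ∈ Charts k r M) {x : M}
    (hx : x ∈ e.source) (i : Idx k r) (v : TangentSpace 𝓘(ℝ, Coord k r) x) :
    dq e i x v = (mfderiv 𝓘(ℝ, Coord k r) 𝓘(ℝ, Coord k r) e x v : Coord k r) i := by
  have h1 := ((mdifferentiable_chart he).mdifferentiableAt hx).hasMFDerivAt
  have h2 : HasMFDerivAt 𝓘(ℝ, Coord k r) 𝓘(ℝ, ℝ) (fun w : Coord k r => w i) (e x)
      (ContinuousLinearMap.proj (R := ℝ) (φ := fun _ : Idx k r => ℝ) i) :=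
    (hasFDerivAt_apply i (e x)).hasMFDerivAt
  have h3 := h2.comp x h1
  have h4 : dq e i x = _ := h3.mfderiv
  rw [h4]; rfl

/-- The coordinate frame `∂_j` at a point of a chart domain. -/
theorem exists_frame {e : OpenPartialHomeomorph M (Coord k r)} (he : e ∈ Charts k r M) {x : M}
    (hx : x ∈ e.source) :
    ∃ fr : Idx k r → TangentSpace 𝓘(ℝ, Coord k r) x,
      (∀ i j, dq e i x (fr j) = if i = j then 1 else 0) ∧ ∀ v, v = ∑ j, dq e j x v • fr j := by
  have hm := mdifferentiable_chart he
  set A : TangentSpace 𝓘(ℝ, Coord k r) x →L[ℝ] Coord k r :=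
    mfderiv 𝓘(ℝ, Coord k r) 𝓘(ℝ, Coord k r) e x with hA
  set B : Coord k r →L[ℝ] TangentSpace 𝓘(ℝ, Coord k r) x :=
    mfderiv 𝓘(ℝ, Coord k r) 𝓘(ℝ, Coord k r) e.symm (e x) with hB
  have hBA : ∀ v, B (A v) = v := fun v => DFunLike.congr_fun (hm.symm_comp_deriv hx) v
  have hAB : ∀ w, A (B w) = w := by
    intro w
    have h := hm.comp_symm_deriv (e.map_source hx)
    rw [e.left_inv hx] at h
    exact DFunLike.congr_fun h w
  refine ⟨fun j => B (Pi.single j 1), fun i j => ?_, fun v => ?_⟩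
  · rw [dq_apply he hx]
    change A (B (Pi.single j 1)) i = _
    rw [hAB, Pi.single_apply]
  · conv_lhs => rw [← hBA v, pi_eq_sum_univ' (A v), map_sum]
    refine Finset.sum_congr rfl fun j _ => ?_
    rw [map_smul, dq_apply he hx]; rfl

theorem dq_expand {e : OpenPartialHomeomorph M (Coord k r)} {x : M}
    {fr : Idx k r → TangentSpace 𝓘(ℝ, Coord k r) x} (h : ∀ v, v = ∑ j, dq e j x v • fr j)
    (α : Cotangent (k := k) (r := r) x) : α = ∑ j, α (fr j) • dq e j x := by
  ext v
  conv_lhs => rw [h v, map_sum]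
  rw [_root_.sum_apply]
  refine Finset.sum_congr rfl fun j _ => ?_
  rw [map_smul, _root_.smul_apply, smul_eq_mul, smul_eq_mul, mul_comm]

theorem dq_ne_zero {e : OpenPartialHomeomorph M (Coord k r)} (he : e ∈ Charts k r M) {x : M}
    (hx : x ∈ e.source) (i : Idx k r) : dq e i x ≠ 0 := by
  obtain ⟨fr, h1, -⟩ := exists_frame he hx
  intro h
  have := h1 i i
  rw [h] at this
  simp at this

theorem eq_zero_of_dq {e : OpenPartialHomeomorph M (Coord k r)} (he : e ∈ Charts k r M) {x : M}
    (hx : x ∈ e.source) {α : Cotangent (k := k) (r := r) x}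
    {T : Cotangent (k := k) (r := r) x →ₗ[ℝ] Cotangent (k := k) (r := r) x →ₗ[ℝ] ℝ}
    (h : ∀ j, T α (dq e j x) = 0) (β : Cotangent (k := k) (r := r) x) : T α β = 0 := by
  obtain ⟨fr, -, h2⟩ := exists_frame he hx
  rw [dq_expand h2 β, map_sum]
  exact Finset.sum_eq_zero fun j _ => by rw [map_smul, h j, smul_zero]

end Frames

/-! ### Covectors of eigenvectors -/

section Eigen

variable {k r : ℕ} {M : Type*} [TopologicalSpace M] [ChartedSpace (Coord k r) M]

theorem IsMetric.flat_unique {G : Tensor2 k r M} (hG : IsMetric G) {x : M}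
    {v : TangentSpace 𝓘(ℝ, Coord k r) x} {α α' : Cotangent (k := k) (r := r) x}
    (h : IsFlat G x v α) (h' : IsFlat G x v α') : α = α' := by
  refine sub_eq_zero.1 (hG.nondeg x _ fun β => ?_)
  rw [map_sub, LinearMap.sub_apply, h, h', sub_self]

theorem IsEigen.apply_flat {G K : Tensor2 k r M} (hG : IsMetric G) {x : M}
    {v : TangentSpace 𝓘(ℝ, Coord k r) x} {l : ℝ} (h : IsEigen G K x v l)
    {α : Cotangent (k := k) (r := r) x} (hα : IsFlat G x v α)
    (β : Cotangent (k := k) (r := r) x) : K x α β = l * G x α β := by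
  obtain ⟨-, α', h1, h2⟩ := h
  rw [hG.flat_unique hα h1]; exact h2 β

end Eigen

/-- The part of the definition of an adapted chart that does not involve the closure condition. -/
structure IsWeaklyAdapted {k r : ℕ} {M : Type*} [TopologicalSpace M] [ChartedSpace (Coord k r) M]
    (G : Tensor2 k r M) (D : Submodule ℝ (VField k r M)) (E : Fin (k + 1) → VField k r M)
    (e : OpenPartialHomeomorph M (Coord k r)) : Prop where
  chart : e ∈ Charts k r M
  orth : ∀ a, ∀ x ∈ e.source, ∃ c : ℝ, IsFlat G x (E a x) (c • dq e (Sum.inl a) x)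
  basis : ∃ X : Module.Basis (Fin r) ℝ D, ∀ α, ∀ x ∈ e.source, ∀ j,
    dq e j x ((X α : VField k r M) x) = if j = Sum.inr α then 1 else 0
  sect : ∀ a, ∀ x ∈ e.source, tcomp e G (Sum.inl a) (Sum.inl a) (e x) ≠ 0 →
    ∀ α, dq e (Sum.inr α) x (E a x) = 0

theorem IsAdapted.isWeaklyAdapted {k r : ℕ} {M : Type*} [TopologicalSpace M]
    [ChartedSpace (Coord k r) M] {G : Tensor2 k r M} {D : Submodule ℝ (VField k r M)}
    {𝒦 : Submodule ℝ (Tensor2 k r M)} {E : Fin (k + 1) → VField k r M} {m₀ : ℕ}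
    {e : OpenPartialHomeomorph M (Coord k r)} (h : IsAdapted G D 𝒦 E m₀ e) :
    IsWeaklyAdapted G D E e :=
  ⟨h.chart, h.orth, h.basis, h.sect⟩

/-- The properties of the components `g = (g^{ij})` of the metric and of the essential eigenvalues
`L c b` of the Killing tensors `K_c` in adapted coordinates on `V`, the last one of
which is `K_m = G`. The last field is the Eisenhart-Kalnins-Miller equation. -/
structure EisenhartData {k r : ℕ} (V : Set (Coord k r)) (g : Idx k r → Idx k r → Coord k r → ℝ)
    (L : Fin (k + 1) → Fin (k + 1) → Coord k r → ℝ) : Prop where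
  isOpen : IsOpen V
  smooth_g : ∀ i j, ContDiffOn ℝ ∞ (g i j) V
  smooth_L : ∀ c b, ContDiffOn ℝ ∞ (L c b) V
  symm : ∀ u ∈ V, ∀ i j, g i j u = g j i u
  det_ne : ∀ u ∈ V, (Matrix.of fun c b => L c b u).det ≠ 0
  last : ∀ u ∈ V, ∀ b, L (Fin.last k) b u = 1
  ignorable_g : ∀ u ∈ V, ∀ α i j, pd (Sum.inr α) (g i j) u = 0
  ignorable_L : ∀ u ∈ V, ∀ α c b, pd (Sum.inr α) (L c b) u = 0
  offdiag : ∀ u ∈ V, ∀ a b, a ≠ b → g (Sum.inl a) (Sum.inl b) u = 0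
  mixed : ∀ u ∈ V, ∀ a, g (Sum.inl a) (Sum.inl a) u ≠ 0 → ∀ α, g (Sum.inl a) (Sum.inr α) u = 0
  row_ne : ∀ u ∈ V, ∀ a, ∃ j, g (Sum.inl a) j u ≠ 0
  eisenhart : ∀ u ∈ V, ∀ c a b j, pd (Sum.inl a) (L c b) u * g (Sum.inl b) j u
    = (L c a u - L c b u) * pd (Sum.inl a) (g (Sum.inl b) j) u

/-! ### The metric and the eigenvalues in adapted coordinates -/

section Geometry

variable {k r : ℕ} {M : Type*} [TopologicalSpace M] [ChartedSpace (Coord k r) M]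
  {G : Tensor2 k r M} {D : Submodule ℝ (VField k r M)}
  {𝒦 : Submodule ℝ (Tensor2 k r M)} {E : Fin (k + 1) → VField k r M} {m₀ : ℕ}
  {K : Module.Basis (Fin (k + 1)) ℝ 𝒦} {Λ : M → Matrix (Fin (k + 1)) (Fin (k + 1)) ℝ}
  {e : OpenPartialHomeomorph M (Coord k r)}

theorem IsWeaklyAdapted.exists_flat (hA : IsSepKillingAlgebra G D 𝒦 E m₀)
    (hw : IsWeaklyAdapted G D E e) (a : Fin (k + 1)) {x : M} (hx : x ∈ e.source) :
    ∃ c : ℝ, c ≠ 0 ∧ IsFlat G x (E a x) (c • dq e (Sum.inl a) x) := by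
  obtain ⟨c, hc⟩ := hw.orth a x hx
  refine ⟨c, ?_, hc⟩
  rintro rfl
  have hE : E a x ≠ 0 := (hA.indep_E x).ne_zero a
  obtain ⟨fr, -, h2⟩ := exists_frame hw.chart hx
  refine hE ?_
  rw [h2 (E a x)]
  refine Finset.sum_eq_zero fun j _ => ?_
  rw [← hc, zero_smul, map_zero, LinearMap.zero_apply, zero_smul]

theorem IsWeaklyAdapted.eigen (hA : IsSepKillingAlgebra G D 𝒦 E m₀)
    (hw : IsWeaklyAdapted G D E e) {T : Tensor2 k r M} {a : Fin (k + 1)} {x : M} {l : ℝ}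
    (hT : IsEigen G T x (E a x) l)
    (hx : x ∈ e.source) (β : Cotangent (k := k) (r := r) x) :
    T x (dq e (Sum.inl a) x) β = l * G x (dq e (Sum.inl a) x) β := by
  obtain ⟨c, hc0, hc⟩ := hw.exists_flat hA a hx
  have := hT.apply_flat hA.metric hc β
  simp only [map_smul, LinearMap.smul_apply, smul_eq_mul] at this
  exact mul_left_cancel₀ hc0 (by linarith)

theorem IsWeaklyAdapted.row_ne (hA : IsSepKillingAlgebra G D 𝒦 E m₀)
    (hw : IsWeaklyAdapted G D E e) (i : Idx k r) {u : Coord k r} (hu : u ∈ e.target) :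
    ∃ j, tcomp e G i j u ≠ 0 := by
  by_contra! h
  exact dq_ne_zero hw.chart (e.map_target hu) i
    (hA.metric.nondeg _ _ (eq_zero_of_dq hw.chart (e.map_target hu) h))

theorem coe_sum_smul_apply (t : Fin (k + 1) → ℝ) (x : M)
    (α β : Cotangent (k := k) (r := r) x) :
    ((∑ c, t c • K c : 𝒦) : Tensor2 k r M) x α β = ∑ c, t c * (K c : Tensor2 k r M) x α β := by
  let φ : Tensor2 k r M →ₗ[ℝ] ℝ :=
    { toFun := fun T => T x α β, map_add' := fun _ _ => rfl, map_smul' := fun _ _ => rfl }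
  have h : (φ ∘ₗ 𝒦.subtype) (∑ c, t c • K c) = ∑ c, t c * (φ ∘ₗ 𝒦.subtype) (K c) := by
    rw [map_sum]
    exact Finset.sum_congr rfl fun c _ => by rw [map_smul, smul_eq_mul]
  exact h

theorem isEigen_sum (hA : IsSepKillingAlgebra G D 𝒦 E m₀)
    (hΛ : ∀ x c b, IsEigen G (K c : Tensor2 k r M) x (E b x) (Λ x c b)) {x : M}
    {t : Fin (k + 1) → ℝ} (ht : t ᵥ* Λ x = 0) (a : Fin (k + 1)) :
    IsEigen G ((∑ c, t c • K c : 𝒦) : Tensor2 k r M) x (E a x) 0 := by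
  obtain ⟨hE, α, hα, -⟩ := hΛ x 0 a
  refine ⟨hE, α, hα, fun β => ?_⟩
  have h3 : ∑ c, t c * Λ x c a = 0 := congrFun ht a
  have h4 : ∀ c, t c * (K c : Tensor2 k r M) x α β = t c * Λ x c a * G x α β := fun c => by
    rw [(hΛ x c a).apply_flat hA.metric hα, mul_assoc]
  rw [coe_sum_smul_apply, zero_mul, Finset.sum_congr rfl fun c _ => h4 c, ← Finset.sum_mul, h3,
    zero_mul]

/-- A left null vector of `Λ x` yields a nonzero tensor in `𝒦` all of whose essential eigenvalues
vanish at `x`, against `regular`. -/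
theorem eigen_det_ne_zero (hA : IsSepKillingAlgebra G D 𝒦 E m₀)
    (hΛ : ∀ x c b, IsEigen G (K c : Tensor2 k r M) x (E b x) (Λ x c b)) (x : M) :
    (Λ x).det ≠ 0 := by
  intro h
  obtain ⟨t, ht, ht0⟩ := Matrix.exists_vecMul_eq_zero_iff.2 h
  exact ht (coeff_eq_zero K (hA.regular ((∑ c, t c • K c : 𝒦) : Tensor2 k r M) (SetLike.coe_mem _) x
    (isEigen_sum hA hΛ ht0)))

theorem eigen_last (hA : IsSepKillingAlgebra G D 𝒦 E m₀)
    (hK : (K (Fin.last k) : Tensor2 k r M) = G)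
    (hΛ : ∀ x c b, IsEigen G (K c : Tensor2 k r M) x (E b x) (Λ x c b))
    (hw : IsWeaklyAdapted G D E e) {x : M} (hx : x ∈ e.source) (b : Fin (k + 1)) :
    Λ x (Fin.last k) b = 1 := by
  obtain ⟨j, hj⟩ := hw.row_ne hA (Sum.inl b) (e.map_source hx)
  have h1 := hw.eigen hA (hΛ x (Fin.last k) b) hx (dq e j x)
  rw [tcomp, e.left_inv hx] at hj
  rw [hK] at h1
  exact mul_right_cancel₀ hj (by linarith)

theorem eigen_combination (hA : IsSepKillingAlgebra G D 𝒦 E m₀)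
    (hΛ : ∀ x c b, IsEigen G (K c : Tensor2 k r M) x (E b x) (Λ x c b)) (x : M)
    (a : Fin (k + 1)) : ∃ t : Fin (k + 1) → ℝ, ∀ b, ∑ c, t c * Λ x c b = if b = a then 1 else 0 := by
  refine ⟨fun c => (Λ x)⁻¹ a c, fun b => ?_⟩
  rw [← mul_apply, nonsing_inv_mul _ (eigen_det_ne_zero hA hΛ x).isUnit, one_apply]
  simp only [eq_comm]

/-- The fields `∂_α` have constant components, so the Lie derivative along them acts on components
as the partial derivative. -/
theorem IsWeaklyAdapted.pd_inr_eq_zero (hw : IsWeaklyAdapted G D E e) {T : Tensor2 k r M}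
    (hT : ∀ X ∈ D, LieInvariant X T) {u : Coord k r} (hu : u ∈ e.target) (α : Fin r)
    (i j : Idx k r) : pd (Sum.inr α) (tcomp e T i j) u = 0 := by
  obtain ⟨X, hX⟩ := hw.basis
  have h1 := hT _ (X α).2 e hw.chart u hu i j
  have h2 : ∀ h, ∀ v ∈ e.target, vcomp e (X α : VField k r M) h v
      = if h = Sum.inr α then 1 else 0 := fun h v hv => hX α _ (e.map_target hv) h
  have h3 : ∀ l h, pd l (vcomp e (X α : VField k r M) h) u = 0 := by
    intro l h
    rw [pd_congr_on e.open_target (h2 h) hu, pd_const]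
  simpa [h2 _ u hu, h3] using h1

/-- Symmetry of `K_c` gives `(λ_c^a - λ_c^b) g^{ab} = 0` for all `c`, and a combination of the `K_c`
has eigenvalue 1 at `a` and 0 at `b`. -/
theorem offdiag_of_eigen (hA : IsSepKillingAlgebra G D 𝒦 E m₀)
    (hΛ : ∀ x c b, IsEigen G (K c : Tensor2 k r M) x (E b x) (Λ x c b))
    (hw : IsWeaklyAdapted G D E e) {x : M} (hx : x ∈ e.source) {a b : Fin (k + 1)} (hab : a ≠ b) :
    G x (dq e (Sum.inl a) x) (dq e (Sum.inl b) x) = 0 := by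
  obtain ⟨t, ht⟩ := eigen_combination hA hΛ x a
  have h1 : ∀ c, (Λ x c a - Λ x c b) * G x (dq e (Sum.inl a) x) (dq e (Sum.inl b) x) = 0 := by
    intro c
    have h2 := hw.eigen hA (hΛ x c a) hx (dq e (Sum.inl b) x)
    have h3 := hw.eigen hA (hΛ x c b) hx (dq e (Sum.inl a) x)
    rw [(hA.killing_K _ (K c).2).1.symm, hA.metric.symm, h2] at h3
    linarith
  have h4 : ∑ c, t c * ((Λ x c a - Λ x c b) * G x (dq e (Sum.inl a) x) (dq e (Sum.inl b) x)) = 0 :=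
    Finset.sum_eq_zero fun c _ => by rw [h1, mul_zero]
  simp only [← mul_assoc, ← Finset.sum_mul, mul_sub, Finset.sum_sub_distrib, ht] at h4
  simpa [hab.symm] using h4

/-- The isotropic indices at a point. -/
def nullSet (e : OpenPartialHomeomorph M (Coord k r)) (G : Tensor2 k r M) (u : Coord k r) :
    Set (Fin (k + 1)) :=
  {a | tcomp e G (Sum.inl a) (Sum.inl a) u = 0}

/-- The null `E a` form a basis of `Δ ∩ Δ^⊥`: the covector of a vector in the intersection is a
combination of the `dq^a`, and pairing it with `dq^b` for a non-null `b` shows that the coefficient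
of `dq^b` is zero. Constancy of this rank makes the null indices locally constant. -/
theorem ncard_nullSet (hA : IsSepKillingAlgebra G D 𝒦 E m₀)
    (hΛ : ∀ x c b, IsEigen G (K c : Tensor2 k r M) x (E b x) (Λ x c b))
    (hw : IsWeaklyAdapted G D E e) {u : Coord k r} (hu : u ∈ e.target) :
    (nullSet e G u).ncard = m₀ := by
  classical
  set x := e.symm u with hxdef
  have hx : x ∈ e.source := e.map_target hu
  obtain ⟨fr, h1, h2⟩ := exists_frame hw.chart hx
  obtain ⟨X, hX⟩ := hw.basis
  choose c hc0 hc using fun a => hw.exists_flat hA a hx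
  have hE : ∀ a j, dq e j x (E a x) = c a * G x (dq e (Sum.inl a) x) (dq e j x) := by
    intro a j
    rw [← hc a, map_smul, LinearMap.smul_apply, smul_eq_mul]
  have hX0 : ∀ α, (X α : VField k r M) x = fr (Sum.inr α) := by
    intro α
    rw [h2 ((X α : VField k r M) x)]
    simp only [hX α x hx]
    simp
  have hspan : (distr D x ⊓ distrPerp G D x : Submodule ℝ _)
      = Submodule.span ℝ (Set.range fun a : nullSet e G u => E a x) := by
    apply le_antisymm
    · rintro v ⟨hv1, α, hα, hα0⟩
      obtain ⟨Y, hY, rfl⟩ := hv1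
      have hY0 : ∀ b, dq e (Sum.inl b) x (Y x) = 0 := by
        intro b
        have : Y = ∑ α, X.repr ⟨Y, hY⟩ α • (X α : VField k r M) := by
          have := congrArg (Submodule.subtype D) (X.sum_repr ⟨Y, hY⟩)
          rw [map_sum] at this
          exact this.symm
        rw [this, Finset.sum_apply, map_sum]
        refine Finset.sum_eq_zero fun α _ => ?_
        rw [Pi.smul_apply, map_smul, hX α x hx]; simp
      -- The `dq^β` components of the covector are its values on `∂_β`, which lie in `Δ`.
      have hα' : α = ∑ a, α (fr (Sum.inl a)) • dq e (Sum.inl a) x := by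
        conv_lhs => rw [dq_expand h2 α, Fintype.sum_sum_type]
        rw [add_eq_left]
        refine Finset.sum_eq_zero fun β _ => ?_
        rw [← hX0, hα0, zero_smul]
        exact ⟨_, (X β).2, rfl⟩
      have hG : ∀ β, β (Y x) = ∑ a, α (fr (Sum.inl a)) * G x (dq e (Sum.inl a) x) β := by
        intro β
        have := hα β
        rw [hα', map_sum, LinearMap.sum_apply] at this
        rw [show β (Y x) = β ((LinearMap.proj x : VField k r M →ₗ[ℝ] _) Y) from rfl, ← this]
        refine Finset.sum_congr rfl fun a _ => ?_
        rw [map_smul, LinearMap.smul_apply, smul_eq_mul]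
      have hcoef : ∀ b, b ∉ nullSet e G u → α (fr (Sum.inl b)) = 0 := by
        intro b hb
        have := hG (dq e (Sum.inl b) x)
        rw [hY0, Finset.sum_eq_single b] at this
        · exact (mul_eq_zero.1 this.symm).resolve_right hb
        · intro a _ hab
          rw [offdiag_of_eigen hA hΛ hw hx hab, mul_zero]
        · simp
      have hYE : Y x = ∑ a, (α (fr (Sum.inl a)) * (c a)⁻¹) • E a x := by
        rw [h2 (Y x), h2 (∑ a, (α (fr (Sum.inl a)) * (c a)⁻¹) • E a x)]
        refine Finset.sum_congr rfl fun j _ => ?_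
        congr 1
        rw [hG, map_sum]
        refine Finset.sum_congr rfl fun a _ => ?_
        rw [map_smul, hE, smul_eq_mul]
        field_simp [hc0 a]
      change Y x ∈ _
      rw [hYE]
      refine Submodule.sum_mem _ fun a _ => ?_
      by_cases ha : a ∈ nullSet e G u
      · exact Submodule.smul_mem _ _ (Submodule.subset_span ⟨⟨a, ha⟩, rfl⟩)
      · rw [hcoef a ha, zero_mul, zero_smul]; exact Submodule.zero_mem _
    · rw [Submodule.span_le]
      rintro _ ⟨⟨a, ha⟩, rfl⟩
      refine ⟨?_, hA.perp_E a x⟩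
      have h0 : ∀ b, dq e (Sum.inl b) x (E a x) = 0 := by
        intro b
        rw [hE]
        by_cases hab : a = b
        · subst hab
          have : G x (dq e (Sum.inl a) x) (dq e (Sum.inl a) x) = 0 := ha
          rw [this, mul_zero]
        · rw [offdiag_of_eigen hA hΛ hw hx hab, mul_zero]
      refine ⟨∑ α, dq e (Sum.inr α) x (E a x) • (X α : VField k r M),
        Submodule.sum_mem _ fun α _ => Submodule.smul_mem _ _ (X α).2, ?_⟩
      change (∑ α, dq e (Sum.inr α) x (E a x) • (X α : VField k r M)) x = E a x
      conv_rhs => rw [h2 (E a x), Fintype.sum_sum_type]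
      simp only [h0, zero_smul, Finset.sum_const_zero, zero_add, Finset.sum_apply, Pi.smul_apply, hX0]
  have h3 := hA.rank_iso x
  have h4 : LinearIndependent ℝ (fun a : nullSet e G u => E a x) :=
    (hA.indep_E x).comp _ Subtype.val_injective
  rw [hspan, finrank_span_eq_card h4] at h3
  rw [← h3, Set.ncard_eq_toFinset_card', Set.toFinset_card]

end Geometry

/-! ### The Eisenhart equations and closedness of the forms `K_c · dg^{αβ}` -/

section Killing

variable {k r : ℕ} {M : Type*} [TopologicalSpace M] [ChartedSpace (Coord k r) M]
  {G : Tensor2 k r M} {D : Submodule ℝ (VField k r M)}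
  {𝒦 : Submodule ℝ (Tensor2 k r M)} {E : Fin (k + 1) → VField k r M} {m₀ : ℕ}
  {K : Module.Basis (Fin (k + 1)) ℝ 𝒦} {Λ : M → Matrix (Fin (k + 1)) (Fin (k + 1)) ℝ}
  {e : OpenPartialHomeomorph M (Coord k r)}

theorem tcomp_eigen (hA : IsSepKillingAlgebra G D 𝒦 E m₀)
    (hΛ : ∀ x c b, IsEigen G (K c : Tensor2 k r M) x (E b x) (Λ x c b))
    (hw : IsWeaklyAdapted G D E e) (c b : Fin (k + 1)) (j : Idx k r) {u : Coord k r}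
    (hu : u ∈ e.target) : tcomp e (K c : Tensor2 k r M) (Sum.inl b) j u
      = Λ (e.symm u) c b * tcomp e G (Sum.inl b) j u :=
  hw.eigen hA (hΛ (e.symm u) c b) (e.map_target hu) _

theorem tcomp_offdiag (hA : IsSepKillingAlgebra G D 𝒦 E m₀)
    (hΛ : ∀ x c b, IsEigen G (K c : Tensor2 k r M) x (E b x) (Λ x c b))
    (hw : IsWeaklyAdapted G D E e) {a b : Fin (k + 1)} (hab : a ≠ b) {u : Coord k r}
    (hu : u ∈ e.target) : tcomp e G (Sum.inl a) (Sum.inl b) u = 0 :=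
  offdiag_of_eigen hA hΛ hw (e.map_target hu) hab

theorem tcomp_mixed (hA : IsSepKillingAlgebra G D 𝒦 E m₀)
    (hw : IsWeaklyAdapted G D E e) {a : Fin (k + 1)} {u : Coord k r}
    (hu : u ∈ e.target) (ha : a ∉ nullSet e G u) (α : Fin r) :
    tcomp e G (Sum.inl a) (Sum.inr α) u = 0 := by
  have hx := e.map_target hu
  have h1 := hw.sect a _ hx (by rwa [e.right_inv hu]) α
  obtain ⟨c, hc0, hc⟩ := hw.exists_flat hA a hx
  rw [← hc, map_smul, LinearMap.smul_apply, smul_eq_mul] at h1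
  exact (mul_eq_zero.1 h1).resolve_left hc0

theorem contDiffOn_tcomp (hA : IsSepKillingAlgebra G D 𝒦 E m₀) (hw : IsWeaklyAdapted G D E e)
    (i j : Idx k r) : ContDiffOn ℝ ∞ (tcomp e G i j) e.target :=
  hA.metric.smooth e hw.chart i j

theorem contDiffOn_tcomp_basis (hA : IsSepKillingAlgebra G D 𝒦 E m₀)
    (hw : IsWeaklyAdapted G D E e) (c : Fin (k + 1))
    (i j : Idx k r) : ContDiffOn ℝ ∞ (tcomp e (K c : Tensor2 k r M) i j) e.target :=
  (hA.killing_K _ (K c).2).1.smooth e hw.chart i j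

/-- Near a point the eigenvalue is the quotient `K_c^{bj} / g^{bj}`, for an index `j` at which the
denominator does not vanish. -/
theorem contDiffOn_eigen (hA : IsSepKillingAlgebra G D 𝒦 E m₀)
    (hΛ : ∀ x c b, IsEigen G (K c : Tensor2 k r M) x (E b x) (Λ x c b))
    (hw : IsWeaklyAdapted G D E e) (c b : Fin (k + 1)) :
    ContDiffOn ℝ ∞ (fun u => Λ (e.symm u) c b) e.target := by
  intro u hu
  obtain ⟨j, hj⟩ := hw.row_ne hA (Sum.inl b) hu
  have hn := e.open_target.mem_nhds hu
  have h1 := (contDiffOn_tcomp hA hw (Sum.inl b) j).contDiffAt hn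
  have h2 := (contDiffOn_tcomp_basis (K := K) hA hw c (Sum.inl b) j).contDiffAt hn
  refine ((h2.div h1 hj).congr_of_eventuallyEq ?_).contDiffWithinAt
  filter_upwards [hn, h1.continuousAt.eventually_ne hj] with v hv hvj
  rw [Pi.div_apply, tcomp_eigen hA hΛ hw c b j hv, mul_div_cancel_right₀ _ hvj]

theorem pd_inr_eigen (hA : IsSepKillingAlgebra G D 𝒦 E m₀)
    (hΛ : ∀ x c b, IsEigen G (K c : Tensor2 k r M) x (E b x) (Λ x c b))
    (hw : IsWeaklyAdapted G D E e) (c b : Fin (k + 1)) {u : Coord k r} (hu : u ∈ e.target)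
    (α : Fin r) : pd (Sum.inr α) (fun u => Λ (e.symm u) c b) u = 0 := by
  obtain ⟨j, hj⟩ := hw.row_ne hA (Sum.inl b) hu
  have h1 := pd_congr_on e.open_target (fun v hv => tcomp_eigen hA hΛ hw c b j hv) hu (Sum.inr α)
  rw [pd_mul (differentiableAt_of_contDiffOn e.open_target (contDiffOn_eigen hA hΛ hw c b) hu)
    (differentiableAt_of_contDiffOn e.open_target (contDiffOn_tcomp hA hw _ _) hu),
    hw.pd_inr_eq_zero (fun X hX => hA.invariant X hX _ (K c).2) hu,
    hw.pd_inr_eq_zero (fun X hX => (hA.killing_D X hX).2) hu, mul_zero, add_zero] at h1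
  exact (mul_eq_zero.1 h1.symm).resolve_right hj

/-- Non-null indices remain non-null nearby, so the null set can only shrink; its cardinality `m₀`
forbids this. -/
theorem eventually_nullSet_eq (hA : IsSepKillingAlgebra G D 𝒦 E m₀)
    (hΛ : ∀ x c b, IsEigen G (K c : Tensor2 k r M) x (E b x) (Λ x c b))
    (hw : IsWeaklyAdapted G D E e) {u : Coord k r} (hu : u ∈ e.target) :
    ∀ᶠ v in nhds u, v ∈ e.target ∧ nullSet e G v = nullSet e G u := by
  have hn := e.open_target.mem_nhds hu
  have h1 : ∀ᶠ v in nhds u, ∀ a, a ∉ nullSet e G u → a ∉ nullSet e G v := by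
    rw [Filter.eventually_all]
    intro a
    by_cases ha : a ∈ nullSet e G u
    · simp [ha]
    · filter_upwards [((contDiffOn_tcomp hA hw _ _).contDiffAt hn).continuousAt.eventually_ne ha]
        with v hv _ using hv
  filter_upwards [h1, hn] with v hv hvt
  refine ⟨hvt, Set.eq_of_subset_of_ncard_le (fun a ha => ?_) ?_⟩
  · by_contra h
    exact hv a h ha
  · rw [ncard_nullSet hA hΛ hw hu, ncard_nullSet hA hΛ hw hvt]

theorem nullSet_eq (hA : IsSepKillingAlgebra G D 𝒦 E m₀)
    (hΛ : ∀ x c b, IsEigen G (K c : Tensor2 k r M) x (E b x) (Λ x c b))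
    (hw : IsWeaklyAdapted G D E e) (hc : IsPreconnected e.target) {u v : Coord k r}
    (hu : u ∈ e.target) (hv : v ∈ e.target) : nullSet e G u = nullSet e G v := by
  refine hc.induction₂ (fun u v => nullSet e G u = nullSet e G v) (fun x hx => ?_)
    (fun _ _ _ _ _ _ h h' => h.trans h') (fun _ _ _ _ h => h.symm) hu hv
  filter_upwards [nhdsWithin_le_nhds (eventually_nullSet_eq hA hΛ hw hx)] with v hv using hv.2.symm

/-- A relation between these rows gives a combination of null `dq^a` that is in the kernel of `G`,
because its pairings with the `dq^b` vanish anyway. -/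
theorem linearIndependent_null (hA : IsSepKillingAlgebra G D 𝒦 E m₀)
    (hΛ : ∀ x c b, IsEigen G (K c : Tensor2 k r M) x (E b x) (Λ x c b))
    (hw : IsWeaklyAdapted G D E e) {u : Coord k r} (hu : u ∈ e.target) :
    LinearIndependent ℝ (fun a : nullSet e G u => fun α => tcomp e G (Sum.inl a) (Sum.inr α) u) := by
  classical
  rw [Fintype.linearIndependent_iff]
  intro t ht a
  have hx := e.map_target hu
  obtain ⟨fr, h1, -⟩ := exists_frame hw.chart hx
  have h2 : (∑ b, t b • dq e (Sum.inl b) (e.symm u) : Cotangent (k := k) (r := r) (e.symm u)) = 0 := by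
    refine hA.metric.nondeg _ _ (eq_zero_of_dq hw.chart hx fun j => ?_)
    rw [map_sum, LinearMap.sum_apply]
    simp only [map_smul, LinearMap.smul_apply, smul_eq_mul]
    rcases j with b | α
    · refine Finset.sum_eq_zero fun a _ => ?_
      by_cases hab : (a : Fin (k + 1)) = b
      · subst hab
        rw [show G (e.symm u) (dq e (Sum.inl a) (e.symm u)) (dq e (Sum.inl a) (e.symm u)) = 0
          from a.2, mul_zero]
      · rw [offdiag_of_eigen hA hΛ hw hx hab, mul_zero]
    · have := congrFun ht α
      rw [Finset.sum_apply] at this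
      exact this
  have h3 := DFunLike.congr_fun h2 (fr (Sum.inl a))
  rw [_root_.sum_apply] at h3
  simp only [_root_.smul_apply, h1, smul_eq_mul] at h3
  rw [Finset.sum_eq_single a (fun b _ hb => by
    rw [if_neg fun h => hb (Subtype.ext (Sum.inl_injective h)), mul_zero]) (by simp)] at h3
  simpa using h3

theorem tcomp_symm {T : Tensor2 k r M} (hT : IsSymTensor T) (i j : Idx k r) :
    tcomp e T i j = tcomp e T j i :=
  funext fun _ => hT.symm _ _ _

theorem killing_equations (hA : IsSepKillingAlgebra G D 𝒦 E m₀)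
    (hΛ : ∀ x c b, IsEigen G (K c : Tensor2 k r M) x (E b x) (Λ x c b))
    (hw : IsWeaklyAdapted G D E e) {u : Coord k r} (hu : u ∈ e.target) :
    (∀ c a b j, pd (Sum.inl a) (fun u => Λ (e.symm u) c b) u * tcomp e G (Sum.inl b) j u
      = (Λ (e.symm u) c a - Λ (e.symm u) c b) * pd (Sum.inl a) (tcomp e G (Sum.inl b) j) u) ∧
    (m₀ ≤ 1 → ∀ c a α β, Λ (e.symm u) c a * pd (Sum.inl a) (tcomp e G (Sum.inr α) (Sum.inr β)) u
      = pd (Sum.inl a) (tcomp e (K c : Tensor2 k r M) (Sum.inr α) (Sum.inr β)) u) := by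
  have hVo := e.open_target
  have hnull := eventually_nullSet_eq hA hΛ hw hu
  set W : Fin (k + 1) → Fin (k + 1) → Idx k r → Idx k r → ℝ := fun c a i j =>
    Λ (e.symm u) c a * pd (Sum.inl a) (tcomp e G i j) u
      - pd (Sum.inl a) (tcomp e (K c : Tensor2 k r M) i j) u with hW
  have hKsym : ∀ c, IsSymTensor (K c : Tensor2 k r M) := fun c => (hA.killing_K _ (K c).2).1
  have hWs : ∀ c a i j, W c a i j = W c a j i := by
    intro c a i j
    simp only [hW]
    rw [tcomp_symm hA.metric.toIsSymTensor i j, tcomp_symm (hKsym c) i j]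
  have hWL : ∀ c a b j, W c a (Sum.inl b) j = (Λ (e.symm u) c a - Λ (e.symm u) c b)
      * pd (Sum.inl a) (tcomp e G (Sum.inl b) j) u
      - pd (Sum.inl a) (fun u => Λ (e.symm u) c b) u * tcomp e G (Sum.inl b) j u := by
    intro c a b j
    simp only [hW]
    rw [pd_congr_on hVo (fun v hv => tcomp_eigen hA hΛ hw c b j hv) hu,
      pd_mul (differentiableAt_of_contDiffOn hVo (contDiffOn_eigen hA hΛ hw c b) hu)
      (differentiableAt_of_contDiffOn hVo (contDiffOn_tcomp hA hw _ _) hu)]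
    ring
  -- Vanishing at the point alone would not control the derivatives in `W`. Vanishing nearby is
  -- available because the null set is locally constant.
  have hW0 : ∀ c a b j, (∀ᶠ v in nhds u, tcomp e G (Sum.inl b) j v = 0) →
      W c a (Sum.inl b) j = 0 := by
    intro c a b j h
    rw [hWL, pd_congr (g := fun _ => 0) h, pd_const, h.self_of_nhds]
    ring
  -- The Killing equation: `K_c^{ai} = λ_c^a g^{ai}` for essential `a`, and the terms with
  -- derivatives along the `∂_α` drop out by invariance.
  have hS : ∀ c i j l, ∑ a, (tcomp e G (Sum.inl a) i u * W c a j l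
      + tcomp e G (Sum.inl a) j u * W c a l i + tcomp e G (Sum.inl a) l u * W c a i j) = 0 := by
    intro c i j l
    have h1 := (hA.killing_K _ (K c).2).2 e hw.chart u hu i j l
    rw [Fintype.sum_sum_type, add_eq_left.2] at h1
    · rw [← h1]
      refine Finset.sum_congr rfl fun a _ => ?_
      simp only [tcomp_eigen hA hΛ hw _ _ _ hu, hW]
      ring
    · refine Finset.sum_eq_zero fun α _ => ?_
      simp only [hw.pd_inr_eq_zero (fun X hX => hA.invariant X hX _ (K c).2) hu,
        hw.pd_inr_eq_zero (fun X hX => (hA.killing_D X hX).2) hu]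
      ring
  obtain ⟨h1, h2⟩ := schouten_algebra (Λ (e.symm u)) (eigen_combination hA hΛ _) (nullSet e G u)
    (fun i j => tcomp e G i j u) (fun a b hab => tcomp_offdiag hA hΛ hw hab hu)
    (fun a => Iff.rfl) (fun a ha α => tcomp_mixed hA hw hu ha α)
    (linearIndependent_null hA hΛ hw hu) (fun a i j => pd (Sum.inl a) (tcomp e G i j) u)
    (fun c a b => pd (Sum.inl a) (fun u => Λ (e.symm u) c b) u) W hWs hWL
    (fun c a b b' hb => hW0 c a b _ (by
      filter_upwards [hVo.mem_nhds hu] with v hv using tcomp_offdiag hA hΛ hw hb hv))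
    (fun c a b hb α => hW0 c a b _ (by
      filter_upwards [hnull] with v hv
      exact tcomp_mixed hA hw hv.1 (hv.2 ▸ hb) α))
    (fun c a b hb => hW0 c a b _ (by
      filter_upwards [hnull] with v hv
      exact (hv.2 ▸ hb : b ∈ nullSet e G v))) hS
  refine ⟨fun c a b j => ?_, fun hm c a α β => ?_⟩
  · have := h1 c a b j
    rw [hWL] at this
    linarith
  · refine sub_eq_zero.1 (h2 ?_ c a α β)
    rw [← Set.ncard_le_one_iff_subsingleton, ncard_nullSet hA hΛ hw hu]
    exact hm

theorem eisenhartData (hA : IsSepKillingAlgebra G D 𝒦 E m₀)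
    (hK : (K (Fin.last k) : Tensor2 k r M) = G)
    (hΛ : ∀ x c b, IsEigen G (K c : Tensor2 k r M) x (E b x) (Λ x c b))
    (hw : IsWeaklyAdapted G D E e) :
    EisenhartData e.target (tcomp e G) (fun c b u => Λ (e.symm u) c b) where
  isOpen := e.open_target
  smooth_g := contDiffOn_tcomp hA hw
  smooth_L := contDiffOn_eigen hA hΛ hw
  symm _ _ i j := congrFun (tcomp_symm hA.metric.toIsSymTensor i j) _
  det_ne _ _ := eigen_det_ne_zero hA hΛ _
  last _ hu b := eigen_last hA hK hΛ hw (e.map_target hu) b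
  ignorable_g _ hu α i j := hw.pd_inr_eq_zero (fun X hX => (hA.killing_D X hX).2) hu α i j
  ignorable_L _ hu α c b := pd_inr_eigen hA hΛ hw c b hu α
  offdiag _ hu _ _ hab := tcomp_offdiag hA hΛ hw hab hu
  mixed _ hu _ ha := tcomp_mixed hA hw hu ha
  row_ne _ hu _ := hw.row_ne hA _ hu
  eisenhart _ hu := (killing_equations hA hΛ hw hu).1

/-- The one-forms `K_c · dg^{αβ}` are closed. -/
theorem closed_of_isAdapted (hA : IsSepKillingAlgebra G D 𝒦 E m₀)
    (hΛ : ∀ x c b, IsEigen G (K c : Tensor2 k r M) x (E b x) (Λ x c b))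
    (he : IsAdapted G D 𝒦 E m₀ e) {u : Coord k r} (hu : u ∈ e.target) (c a b : Fin (k + 1))
    (α β : Fin r) :
    pd (Sum.inl b) (fun v => Λ (e.symm v) c a
        * pd (Sum.inl a) (tcomp e G (Sum.inr α) (Sum.inr β)) v) u
      = pd (Sum.inl a) (fun v => Λ (e.symm v) c b
        * pd (Sum.inl b) (tcomp e G (Sum.inr α) (Sum.inr β)) v) u := by
  have hw := he.isWeaklyAdapted
  have hVo := e.open_target
  rcases le_or_gt m₀ 1 with hm | hm
  -- With at most one null index the Killing equation gives `K_c · dg^{αβ} = dK_c^{αβ}`, an exact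
  -- form. For `m₀ > 1` the closure condition is needed instead.
  · have h1 : ∀ a, ∀ v ∈ e.target, Λ (e.symm v) c a
        * pd (Sum.inl a) (tcomp e G (Sum.inr α) (Sum.inr β)) v
        = pd (Sum.inl a) (tcomp e (K c : Tensor2 k r M) (Sum.inr α) (Sum.inr β)) v :=
      fun a v hv => (killing_equations hA hΛ hw hv).2 hm c a α β
    rw [pd_congr_on hVo (h1 a) hu, pd_congr_on hVo (h1 b) hu]
    exact pd_pd_comm hVo (contDiffOn_tcomp_basis hA hw c _ _) hu _ _
  · have h1 : ∀ a, ∀ v ∈ e.target, kdform e G (K c : Tensor2 k r M)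
        (tcomp e G (Sum.inr α) (Sum.inr β)) (Sum.inl a) v
        = Λ (e.symm v) c a * pd (Sum.inl a) (tcomp e G (Sum.inr α) (Sum.inr β)) v := by
      intro a v hv
      set w : Idx k r → ℝ := fun j => pd j (tcomp e G (Sum.inr α) (Sum.inr β)) v with hwdef
      have hw0 : ∀ α, w (Sum.inr α) = 0 := fun α =>
        hw.pd_inr_eq_zero (fun X hX => (hA.killing_D X hX).2) hv α _ _
      -- The vector `w` has essential components only, and on these `K_c` acts as `g` after
      -- multiplication by the eigenvalues; cancelling `g` gives the components of `K_c · dg^{αβ}`.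
      have h2 : tmat e (K c : Tensor2 k r M) v *ᵥ w
          = tmat e G v *ᵥ fun j => Sum.elim (fun a => Λ (e.symm v) c a * w (Sum.inl a)) 0 j := by
        ext i
        simp only [mulVec, dotProduct, Fintype.sum_sum_type, hw0, Sum.elim_inl, Sum.elim_inr,
          Pi.zero_apply, mul_zero, Finset.sum_const_zero, add_zero, tmat, of_apply]
        refine Finset.sum_congr rfl fun a _ => ?_
        rw [tcomp_symm (hA.killing_K _ (K c).2).1, tcomp_eigen hA hΛ hw _ _ _ hv,
          tcomp_symm hA.metric.toIsSymTensor i]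
        ring
      have hdet : IsUnit (tmat e G v).det := by
        rw [isUnit_iff_ne_zero]
        intro h0
        obtain ⟨t, ht, ht0⟩ := Matrix.exists_vecMul_eq_zero_iff.2 h0
        have hx := e.map_target hv
        obtain ⟨fr, hf, -⟩ := exists_frame hw.chart hx
        have h3 : (∑ i, t i • dq e i (e.symm v) : Cotangent (k := k) (r := r) (e.symm v)) = 0 := by
          refine hA.metric.nondeg _ _ (eq_zero_of_dq hw.chart hx fun j => ?_)
          rw [map_sum, LinearMap.sum_apply]
          simp only [map_smul, LinearMap.smul_apply, smul_eq_mul]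
          exact congrFun ht0 j
        refine ht (funext fun i => ?_)
        have h4 := DFunLike.congr_fun h3 (fr i)
        rw [_root_.sum_apply] at h4
        simpa [_root_.smul_apply, hf] using h4
      rw [kdform, ← mulVec_mulVec, h2, mulVec_mulVec, nonsing_inv_mul _ hdet, one_mulVec]
      rfl
    rw [← pd_congr_on hVo (h1 a) hu, ← pd_congr_on hVo (h1 b) hu]
    exact he.closed hm _ (K c).2 α β u hu _ _

end Killing

/-! ### The Stäckel matrix as the inverse of `(λ_c^b φ^b)` -/

section Analysis

variable {k r : ℕ} {V : Set (Coord k r)} {g : Idx k r → Idx k r → Coord k r → ℝ}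
  {L : Fin (k + 1) → Fin (k + 1) → Coord k r → ℝ}

/-- `φ = (φ^b)` is a system of functions proportional to the rows `g^{bj}` of the metric up to
factors which depend on `q^b` only. -/
structure IsRowFactor (V : Set (Coord k r)) (g : Idx k r → Idx k r → Coord k r → ℝ)
    (φ : Fin (k + 1) → Coord k r → ℝ) : Prop where
  smooth : ∀ b, ContDiffOn ℝ ∞ (φ b) V
  ne_zero : ∀ u ∈ V, ∀ b, φ b u ≠ 0
  ignorable : ∀ u ∈ V, ∀ α b, pd (Sum.inr α) (φ b) u = 0
  proportional : ∀ u ∈ V, ∀ a b, a ≠ b → ∀ j, φ b u * pd (Sum.inl a) (g (Sum.inl b) j) u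
    = pd (Sum.inl a) (φ b) u * g (Sum.inl b) j u

/-- The matrix `(L_c^b φ^b)`, the inverse of a Stäckel matrix. -/
def stInv (L : Fin (k + 1) → Fin (k + 1) → Coord k r → ℝ) (φ : Fin (k + 1) → Coord k r → ℝ)
    (u : Coord k r) : Matrix (Fin (k + 1)) (Fin (k + 1)) ℝ :=
  Matrix.of fun c b => L c b u * φ b u

theorem stInv_eq (φ : Fin (k + 1) → Coord k r → ℝ) (u : Coord k r) :
    stInv L φ u = (Matrix.of fun c b => L c b u) * diagonal fun b => φ b u := by
  ext c b
  simp [stInv, mul_diagonal]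

variable {φ : Fin (k + 1) → Coord k r → ℝ}

theorem EisenhartData.contDiffOn_stInv (h : EisenhartData V g L) (hφ : IsRowFactor V g φ)
    (c b : Fin (k + 1)) : ContDiffOn ℝ ∞ (fun u => stInv L φ u c b) V :=
  (h.smooth_L c b).mul (hφ.smooth b)

theorem EisenhartData.det_stInv (h : EisenhartData V g L) (hφ : IsRowFactor V g φ) :
    ∀ u ∈ V, (stInv L φ u).det ≠ 0 := by
  intro u hu
  rw [stInv_eq, det_mul, det_diagonal]
  exact mul_ne_zero (h.det_ne u hu) (Finset.prod_ne_zero_iff.2 fun b _ => hφ.ne_zero u hu b)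

/-- This is the Eisenhart equation with the row `g^{bj}` replaced by `φ^b`. For `a ≠ b` the two have
the same logarithmic derivative along `q^a`; for `a = b` the equation says `∂_a λ_c^a = 0`. -/
theorem EisenhartData.pd_stInv (h : EisenhartData V g L) (hφ : IsRowFactor V g φ) {u : Coord k r}
    (hu : u ∈ V) (c a b : Fin (k + 1)) :
    pd (Sum.inl a) (fun v => stInv L φ v c b) u = L c a u * pd (Sum.inl a) (φ b) u := by
  have h1 : pd (Sum.inl a) (fun v => stInv L φ v c b) u
      = pd (Sum.inl a) (L c b) u * φ b u + L c b u * pd (Sum.inl a) (φ b) u :=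
    pd_mul (differentiableAt_of_contDiffOn h.isOpen (h.smooth_L c b) hu)
      (differentiableAt_of_contDiffOn h.isOpen (hφ.smooth b) hu) _
  obtain ⟨j, hj⟩ := h.row_ne u hu b
  have h2 := h.eisenhart u hu c a b j
  have h3 : pd (Sum.inl a) (L c b) u * φ b u
      = (L c a u - L c b u) * pd (Sum.inl a) (φ b) u := by
    by_cases hab : a = b
    · subst hab
      rw [sub_self, zero_mul] at h2 ⊢
      rw [(mul_eq_zero.1 h2).resolve_right hj, zero_mul]
    · refine mul_right_cancel₀ hj ?_
      have h4 := hφ.proportional u hu a b hab j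
      linear_combination φ b u * h2 + (L c a u - L c b u) * h4
  rw [h1, h3]; ring

theorem EisenhartData.contDiffOn_stInv_inv (h : EisenhartData V g L) (hφ : IsRowFactor V g φ)
    (j c : Fin (k + 1)) : ContDiffOn ℝ ∞ (fun u => (stInv L φ u)⁻¹ j c) V :=
  contDiffOn_inv_apply (h.contDiffOn_stInv hφ) (h.det_stInv hφ) j c

theorem EisenhartData.mul_inv (h : EisenhartData V g L) (hφ : IsRowFactor V g φ) :
    ∀ u ∈ V, stInv L φ u * (stInv L φ u)⁻¹ = 1 := fun u hu =>
  mul_nonsing_inv _ (h.det_stInv hφ u hu).isUnit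

/-- The first part annihilates the terms with potentials in `exists_eta`; the second shows that row
`j` of the inverse depends on no essential coordinate but `q^j`. -/
theorem EisenhartData.pd_inl_stInv_inv (h : EisenhartData V g L) (hφ : IsRowFactor V g φ)
    {u : Coord k r} (hu : u ∈ V) (a j c : Fin (k + 1)) :
    ((stInv L φ u)⁻¹ *ᵥ fun c => L c a u) j = (if j = a then (φ a u)⁻¹ else 0) ∧
    pd (Sum.inl a) (fun v => (stInv L φ v)⁻¹ j c) u = -(if j = a then (φ a u)⁻¹ else 0)
      * ((fun b => pd (Sum.inl a) (φ b) u) ᵥ* (stInv L φ u)⁻¹) c := by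
  refine staeckel_derivative (Matrix.of fun c b => L c b u) (stInv L φ u) (stInv L φ u)⁻¹
    (Matrix.of fun i j => pd (Sum.inl a) (fun v => stInv L φ v i j) u)
    (Matrix.of fun i j => pd (Sum.inl a) (fun v => (stInv L φ v)⁻¹ i j) u)
    (fun b => φ b u) (fun b => pd (Sum.inl a) (φ b) u) (hφ.ne_zero u hu) a
    (fun c b => rfl) (fun c b => h.pd_stInv hφ hu c a b) ?_ ?_ j c
  · exact nonsing_inv_mul _ (h.det_stInv hφ u hu).isUnit
  · exact pd_inverse h.isOpen (h.contDiffOn_stInv hφ) (h.contDiffOn_stInv_inv hφ)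
      (h.mul_inv hφ) hu _

theorem EisenhartData.pd_inr_stInv_inv (h : EisenhartData V g L) (hφ : IsRowFactor V g φ)
    {u : Coord k r} (hu : u ∈ V) (α : Fin r) (j c : Fin (k + 1)) :
    pd (Sum.inr α) (fun v => (stInv L φ v)⁻¹ j c) u = 0 := by
  have h1 := pd_inverse h.isOpen (h.contDiffOn_stInv hφ) (h.contDiffOn_stInv_inv hφ)
    (h.mul_inv hφ) hu (Sum.inr α)
  have h2 : (Matrix.of fun i j => pd (Sum.inr α) (fun v => stInv L φ v i j) u) = 0 := by
    ext i j
    have : pd (Sum.inr α) (fun v => stInv L φ v i j) u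
        = pd (Sum.inr α) (L i j) u * φ j u + L i j u * pd (Sum.inr α) (φ j) u :=
      pd_mul (differentiableAt_of_contDiffOn h.isOpen (h.smooth_L i j) hu)
        (differentiableAt_of_contDiffOn h.isOpen (hφ.smooth j) hu) _
    rw [of_apply, this, h.ignorable_L u hu, hφ.ignorable u hu]
    simp
  rw [h2, mul_zero, zero_mul, neg_zero] at h1
  exact congrFun (congrFun h1 j) c

theorem EisenhartData.vecMul_stInv_inv (h : EisenhartData V g L) (hφ : IsRowFactor V g φ)
    {u : Coord k r} (hu : u ∈ V) (c : Fin (k + 1)) :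
    ((fun b => φ b u) ᵥ* (stInv L φ u)⁻¹) c = if c = Fin.last k then 1 else 0 := by
  have h1 := congrFun (congrFun (h.mul_inv hφ u hu) (Fin.last k)) c
  rw [one_apply, mul_apply] at h1
  simp only [eq_comm (a := c), ← h1, vecMul, dotProduct, stInv, of_apply, h.last u hu, one_mul]

/-- The minor is a signed entry of the adjugate of `Λ`, and `Λ⁻¹ = diag(φ) · S`. All minors for a
fixed `a` thus share a nonzero factor and are, up to sign, row `a` of the Stäckel matrix. -/
theorem EisenhartData.minor_eq (h : EisenhartData V g L) (hφ : IsRowFactor V g φ)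
    {u : Coord k r} (hu : u ∈ V) (a c : Fin (k + 1)) :
    ((Matrix.of fun c b => L c b u).submatrix c.succAbove a.succAbove).det
      = (-1) ^ (c + a : ℕ) * ((Matrix.of fun c b => L c b u).det * φ a u)
        * (stInv L φ u)⁻¹ a c := by
  set A : Matrix (Fin (k + 1)) (Fin (k + 1)) ℝ := Matrix.of fun c b => L c b u with hA
  have h1 : (diagonal fun b => φ b u) * (stInv L φ u)⁻¹ = A⁻¹ := by
    have h2 := h.mul_inv hφ u hu
    rw [stInv_eq, mul_assoc] at h2
    rw [stInv_eq]
    exact (inv_eq_right_inv h2).symm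
  have h2 : φ a u * (stInv L φ u)⁻¹ a c = A⁻¹ a c := by
    rw [← h1, diagonal_mul]
  have h3 : A.adjugate a c = A.det * A⁻¹ a c := by
    rw [inv_def, Matrix.smul_apply, Ring.inverse_eq_inv', smul_eq_mul,
      mul_inv_cancel_left₀ (h.det_ne u hu)]
  rw [adjugate_fin_succ_eq_det_submatrix] at h3
  have h4 : ((-1 : ℝ) ^ (c + a : ℕ)) * (-1) ^ (c + a : ℕ) = 1 := by
    rw [← mul_pow]; simp
  calc _ = ((-1 : ℝ) ^ (c + a : ℕ) * (-1) ^ (c + a : ℕ))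
        * (A.submatrix c.succAbove a.succAbove).det := by rw [h4, one_mul]
    _ = (-1) ^ (c + a : ℕ) * (A.det * A⁻¹ a c) := by rw [← h3]; ring
    _ = _ := by rw [← h2]; ring

/-- If `∂_a φ^b = F φ^b` for all `b`, the entries in row `a` of the Stäckel matrix are constant,
except for the last one if `F ≠ 0`. -/
theorem EisenhartData.pd_row_eq_zero (h : EisenhartData V g L) (hφ : IsRowFactor V g φ)
    {a : Fin (k + 1)} {u : Coord k r} (hu : u ∈ V) {F : ℝ}
    (hF : ∀ b, pd (Sum.inl a) (φ b) u = F * φ b u) {c : Fin (k + 1)}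
    (hc : c = Fin.last k → F = 0) (i : Idx k r) :
    pd i (fun v => (stInv L φ v)⁻¹ a c) u = 0 := by
  rcases i with d | α
  · rw [(h.pd_inl_stInv_inv hφ hu d a c).2]
    by_cases hd : a = d
    · subst hd
      have h1 : (fun b => pd (Sum.inl a) (φ b) u) = F • fun b => φ b u := funext hF
      rw [h1, smul_vecMul, Pi.smul_apply, h.vecMul_stInv_inv hφ hu]
      by_cases hcl : c = Fin.last k
      · rw [hc hcl]; simp
      · simp [hcl]
    · simp [hd]
  · exact h.pd_inr_stInv_inv hφ hu α a c

end Analysis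

/-! ### Potentials of closed one-forms on convex sets -/

section Potential

variable {k r : ℕ} {V : Set (Coord k r)}

theorem fderiv_sum_smul_proj {p : Idx k r → Coord k r → ℝ} {u : Coord k r}
    (hp : ∀ j, DifferentiableAt ℝ (p j) u) (x y : Coord k r) :
    fderiv ℝ (fun v => ∑ j, p j v • (ContinuousLinearMap.proj j : Coord k r →L[ℝ] ℝ)) u x y
      = ∑ i, ∑ j, x i * y j * pd i (p j) u := by
  rw [fderiv_fun_sum (A := fun j v => p j v • (ContinuousLinearMap.proj j : Coord k r →L[ℝ] ℝ))
    fun j _ => (hp j).smul_const _, _root_.sum_apply, _root_.sum_apply,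
    Finset.sum_comm]
  refine Finset.sum_congr rfl fun j _ => ?_
  rw [((hp j).hasFDerivAt.smul_const
    (ContinuousLinearMap.proj j : Coord k r →L[ℝ] ℝ)).fderiv]
  simp only [ContinuousLinearMap.smulRight_apply, _root_.smul_apply, smul_eq_mul,
    ContinuousLinearMap.proj_apply, fderiv_eq_sum_pd, Finset.sum_mul]
  exact Finset.sum_congr rfl fun i _ => by ring

theorem exists_potential (hV : IsOpen V) (hc : Convex ℝ V) {p : Idx k r → Coord k r → ℝ}
    (hp : ∀ j, ContDiffOn ℝ ∞ (p j) V) (hcl : ∀ u ∈ V, ∀ i j, pd i (p j) u = pd j (p i) u) :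
    ∃ f : Coord k r → ℝ, ContDiffOn ℝ ∞ f V ∧ ∀ u ∈ V, ∀ j, pd j f u = p j u := by
  set w : Coord k r → Coord k r →L[ℝ] ℝ := fun v => ∑ j, p j v • (ContinuousLinearMap.proj j : Coord k r →L[ℝ] ℝ) with hw
  have hs : ContDiffOn ℝ ∞ w V := ContDiffOn.sum fun j _ => (hp j).smul contDiffOn_const
  obtain ⟨f, hf⟩ := hc.exists_forall_hasFDerivAt_of_fderiv_symmetric hV
    (show DifferentiableOn ℝ w V from hs.differentiableOn (by simp)) (by
      intro u hu x y
      have hd := fun j => differentiableAt_of_contDiffOn hV (hp j) hu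
      rw [hw, fderiv_sum_smul_proj hd, fderiv_sum_smul_proj hd, Finset.sum_comm]
      refine Finset.sum_congr rfl fun i _ => Finset.sum_congr rfl fun j _ => ?_
      rw [hcl u hu]; ring)
  refine ⟨f, ?_, fun u hu j => ?_⟩
  · rw [contDiffOn_infty_iff_fderiv_of_isOpen hV]
    exact ⟨fun u hu => (hf u hu).differentiableAt.differentiableWithinAt,
      hs.congr fun u hu => (hf u hu).fderiv⟩
  · rw [pd_eq_of_hasFDerivAt (hf u hu)]
    simp only [hw, _root_.sum_apply, _root_.smul_apply, ContinuousLinearMap.proj_apply, smul_eq_mul]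
    rw [Finset.sum_eq_single j (fun i _ hi => by simp [hi]) (by simp)]
    simp

end Potential

/-! ### Existence of the standard separable form -/

section StandardForm

variable {k r : ℕ} {V : Set (Coord k r)} {g : Idx k r → Idx k r → Coord k r → ℝ}
  {L : Fin (k + 1) → Fin (k + 1) → Coord k r → ℝ}

/-- Contracting the Eisenhart equations with row `a` of `Λ⁻¹` turns `λ^a - λ^b` into 1. The factor
`μ` does not depend on `j`, so the Euclidean norm of a null row scales along `q^a` like the row
itself. -/
theorem EisenhartData.exists_log_derivative (h : EisenhartData V g L) {u : Coord k r} (hu : u ∈ V)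
    {a b : Fin (k + 1)} (hab : a ≠ b) :
    ∃ μ : ℝ, ∀ j, pd (Sum.inl a) (g (Sum.inl b) j) u = μ * g (Sum.inl b) j u := by
  set A : Matrix (Fin (k + 1)) (Fin (k + 1)) ℝ := Matrix.of fun c b => L c b u with hA
  have ht : ∀ b, ∑ c, A⁻¹ a c * L c b u = if a = b then 1 else 0 := fun b => by
    have := congrFun (congrFun (nonsing_inv_mul A (h.det_ne u hu).isUnit) a) b
    rwa [mul_apply, one_apply] at this
  refine ⟨∑ c, A⁻¹ a c * pd (Sum.inl a) (L c b) u, fun j => ?_⟩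
  have h1 : ∑ c, A⁻¹ a c * (pd (Sum.inl a) (L c b) u * g (Sum.inl b) j u)
      = ∑ c, (A⁻¹ a c * L c a u - A⁻¹ a c * L c b u) * pd (Sum.inl a) (g (Sum.inl b) j) u :=
    Finset.sum_congr rfl fun c _ => by rw [h.eisenhart u hu]; ring
  rw [← Finset.sum_mul, Finset.sum_sub_distrib, ht, ht, if_pos rfl, if_neg hab] at h1
  rw [Finset.sum_mul]
  simp only [← mul_assoc] at h1
  rw [h1]; ring

open Classical in
/-- The canonical row factors: `g^{bb}` for the non-null rows and `|(g^{bβ})_β|` for the null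
ones. -/
noncomputable def rowFactor (N : Set (Fin (k + 1))) (g : Idx k r → Idx k r → Coord k r → ℝ) (b : Fin (k + 1))
    (u : Coord k r) : ℝ :=
  if b ∈ N then √(∑ β, g (Sum.inl b) (Sum.inr β) u * g (Sum.inl b) (Sum.inr β) u)
  else g (Sum.inl b) (Sum.inl b) u

theorem rowFactor_of_notMem {N : Set (Fin (k + 1))} {b : Fin (k + 1)} (hb : b ∉ N) :
    rowFactor N g b = g (Sum.inl b) (Sum.inl b) :=
  funext fun _ => if_neg hb

theorem rowFactor_of_mem {N : Set (Fin (k + 1))} {b : Fin (k + 1)} (hb : b ∈ N) :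
    rowFactor N g b = fun u => √(∑ β, g (Sum.inl b) (Sum.inr β) u * g (Sum.inl b) (Sum.inr β) u) :=
  funext fun _ => if_pos hb

theorem EisenhartData.isRowFactor (h : EisenhartData V g L) {N : Set (Fin (k + 1))}
    (hN : ∀ u ∈ V, ∀ a, g (Sum.inl a) (Sum.inl a) u = 0 ↔ a ∈ N) :
    IsRowFactor V g (rowFactor N g) := by
  have hpos : ∀ b ∈ N, ∀ u ∈ V,
      0 < ∑ β, g (Sum.inl b) (Sum.inr β) u * g (Sum.inl b) (Sum.inr β) u := by
    intro b hb u hu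
    obtain ⟨j, hj⟩ := h.row_ne u hu b
    rcases j with d | β
    · by_cases hbd : b = d
      · subst hbd; exact absurd ((hN u hu b).2 hb) hj
      · exact absurd (h.offdiag u hu b d hbd) hj
    · exact Finset.sum_pos' (fun β _ => mul_self_nonneg _) ⟨β, Finset.mem_univ _,
        mul_self_pos.2 hj⟩
  have hsm : ∀ b, ContDiffOn ℝ ∞ (rowFactor N g b) V := by
    intro b
    by_cases hb : b ∈ N
    · rw [rowFactor_of_mem hb]
      exact (ContDiffOn.sum fun β _ => (h.smooth_g _ _).mul (h.smooth_g _ _)).sqrt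
        fun u hu => (hpos b hb u hu).ne'
    · rw [rowFactor_of_notMem hb]; exact h.smooth_g _ _
  have hne : ∀ u ∈ V, ∀ b, rowFactor N g b u ≠ 0 := by
    intro u hu b
    by_cases hb : b ∈ N
    · rw [rowFactor_of_mem hb]; exact (Real.sqrt_pos.2 (hpos b hb u hu)).ne'
    · rw [rowFactor_of_notMem hb]; exact fun h0 => hb ((hN u hu b).1 h0)
  -- Differentiating the square of the norm avoids the derivative of the square root.
  have hpd : ∀ b ∈ N, ∀ u ∈ V, ∀ i, rowFactor N g b u * pd i (rowFactor N g b) u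
      = ∑ β, g (Sum.inl b) (Sum.inr β) u * pd i (g (Sum.inl b) (Sum.inr β)) u := by
    intro b hb u hu i
    have hd := differentiableAt_of_contDiffOn h.isOpen (hsm b) hu
    have hgd := fun β => differentiableAt_of_contDiffOn h.isOpen
      (h.smooth_g (Sum.inl b) (Sum.inr β)) hu
    have h1 : pd i (fun v => rowFactor N g b v * rowFactor N g b v) u
        = pd i (fun v => ∑ β, g (Sum.inl b) (Sum.inr β) v * g (Sum.inl b) (Sum.inr β) v) u :=
      pd_congr_on h.isOpen (fun v hv => by
        rw [rowFactor_of_mem hb, Real.mul_self_sqrt (hpos b hb v hv).le]) hu i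
    rw [pd_mul hd hd, pd_sum (f := fun β v => g (Sum.inl b) (Sum.inr β) v
      * g (Sum.inl b) (Sum.inr β) v) (fun β _ => (hgd β).mul (hgd β))] at h1
    simp only [fun β => pd_mul (hgd β) (hgd β) i] at h1
    have h2 : ∑ β, (pd i (g (Sum.inl b) (Sum.inr β)) u * g (Sum.inl b) (Sum.inr β) u
        + g (Sum.inl b) (Sum.inr β) u * pd i (g (Sum.inl b) (Sum.inr β)) u)
        = 2 * ∑ β, g (Sum.inl b) (Sum.inr β) u * pd i (g (Sum.inl b) (Sum.inr β)) u := by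
      rw [Finset.mul_sum]; exact Finset.sum_congr rfl fun β _ => by ring
    rw [h2] at h1
    linarith
  refine ⟨hsm, hne, fun u hu α b => ?_, fun u hu a b hab j => ?_⟩
  · by_cases hb : b ∈ N
    · have := hpd b hb u hu (Sum.inr α)
      simp only [h.ignorable_g u hu, mul_zero, Finset.sum_const_zero] at this
      exact (mul_eq_zero.1 this).resolve_left (hne u hu b)
    · rw [rowFactor_of_notMem hb]; exact h.ignorable_g u hu _ _ _
  · obtain ⟨μ, hμ⟩ := h.exists_log_derivative hu hab
    have h1 : pd (Sum.inl a) (rowFactor N g b) u = μ * rowFactor N g b u := by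
      by_cases hb : b ∈ N
      · refine mul_left_cancel₀ (hne u hu b) ?_
        rw [hpd b hb u hu]
        simp only [hμ]
        rw [mul_left_comm, show rowFactor N g b u * rowFactor N g b u = _ from by
          rw [rowFactor_of_mem hb, Real.mul_self_sqrt (hpos b hb u hu).le], Finset.mul_sum]
        exact Finset.sum_congr rfl fun β _ => by ring
      · rw [rowFactor_of_notMem hb]; exact hμ _
    rw [h1, hμ]; ring

theorem EisenhartData.exists_theta (h : EisenhartData V g L) (hc : Convex ℝ V)
    {φ : Fin (k + 1) → Coord k r → ℝ} (hφ : IsRowFactor V g φ) (b : Fin (k + 1)) (β : Fin r) :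
    ∃ θ : ℝ → ℝ, ∀ u ∈ V, θ (u (Sum.inl b)) = g (Sum.inl b) (Sum.inr β) u / φ b u := by
  have hq : ContDiffOn ℝ ∞ (fun u => g (Sum.inl b) (Sum.inr β) u / φ b u) V :=
    (h.smooth_g _ _).div (hφ.smooth b) fun u hu => hφ.ne_zero u hu b
  refine exists_coordinate_function h.isOpen hc hq _ fun u hu i hi => ?_
  have h1 : pd i (fun v => g (Sum.inl b) (Sum.inr β) v / φ b v * φ b v) u
      = pd i (g (Sum.inl b) (Sum.inr β)) u :=
    pd_congr_on h.isOpen (fun v hv => div_mul_cancel₀ _ (hφ.ne_zero v hv b)) hu i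
  rw [pd_mul (differentiableAt_of_contDiffOn h.isOpen hq hu)
    (differentiableAt_of_contDiffOn h.isOpen (hφ.smooth b) hu)] at h1
  have hne := hφ.ne_zero u hu b
  have h2 : φ b u * pd i (g (Sum.inl b) (Sum.inr β)) u
      = pd i (φ b) u * g (Sum.inl b) (Sum.inr β) u := by
    rcases i with a | α
    · exact hφ.proportional u hu a b (fun hab => hi (by rw [hab])) _
    · rw [h.ignorable_g u hu, hφ.ignorable u hu]; simp
  refine (mul_eq_zero.1 (?_ : pd i (fun u => g (Sum.inl b) (Sum.inr β) u / φ b u) u * φ b u = 0)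
    ).resolve_right hne
  have h3 : g (Sum.inl b) (Sum.inr β) u / φ b u * pd i (φ b) u
      = pd i (g (Sum.inl b) (Sum.inr β)) u := by
    field_simp
    linarith
  linarith

/-- Let `F_c` be potentials of the closed forms `λ_c · df`, with `F_m = f`, and put `H_j = Σ_c
S_{jc} F_c`. In `∂_a H_j` with `j ≠ a` both `∂_a S_{jc}` and `Σ_c S_{jc} λ_c^a` vanish, so `H_j`
depends on `q^j` only; and `φ · S = e_m` gives `Σ_b φ^b H_b = F_m = f`. -/
theorem EisenhartData.exists_eta (h : EisenhartData V g L) (hc : Convex ℝ V)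
    {φ : Fin (k + 1) → Coord k r → ℝ} (hφ : IsRowFactor V g φ) {f : Coord k r → ℝ}
    (hf : ContDiffOn ℝ ∞ f V) (hfα : ∀ u ∈ V, ∀ α, pd (Sum.inr α) f u = 0)
    (hcl : ∀ u ∈ V, ∀ c a b, pd (Sum.inl b) (fun v => L c a v * pd (Sum.inl a) f v) u
      = pd (Sum.inl a) (fun v => L c b v * pd (Sum.inl b) f v) u) :
    ∃ η : Fin (k + 1) → ℝ → ℝ,
      (∀ a, ContDiffOn ℝ ∞ (fun u : Coord k r => η a (u (Sum.inl a))) V) ∧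
      ∀ u ∈ V, f u = ∑ a, η a (u (Sum.inl a)) * φ a u := by
  have hpdα : ∀ u ∈ V, ∀ a α, pd (Sum.inr α) (pd (Sum.inl a) f) u = 0 := by
    intro u hu a α
    rw [pd_pd_comm h.isOpen hf hu, pd_congr_on h.isOpen (fun v hv => hfα v hv α) hu, pd_const]
  have hpot : ∀ c, ∃ F : Coord k r → ℝ, ContDiffOn ℝ ∞ F V ∧
      (∀ u ∈ V, ∀ a, pd (Sum.inl a) F u = L c a u * pd (Sum.inl a) f u) ∧
      (∀ u ∈ V, ∀ α, pd (Sum.inr α) F u = 0) ∧ (c = Fin.last k → F = f) := by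
    intro c
    -- For the last index `f` itself is taken, as an arbitrary potential would agree with it only up
    -- to a constant.
    by_cases hcl' : c = Fin.last k
    · subst hcl'
      exact ⟨f, hf, fun u hu a => by rw [h.last u hu, one_mul], hfα, fun _ => rfl⟩
    · have hsm : ∀ a, ContDiffOn ℝ ∞ (fun v => L c a v * pd (Sum.inl a) f v) V := fun a =>
        (h.smooth_L c a).mul (contDiffOn_pd h.isOpen hf _)
      have hα : ∀ u ∈ V, ∀ a α, pd (Sum.inr α) (fun v => L c a v * pd (Sum.inl a) f v) u = 0 := by
        intro u hu a α
        rw [pd_mul (differentiableAt_of_contDiffOn h.isOpen (h.smooth_L c a) hu)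
          (differentiableAt_of_contDiffOn h.isOpen (contDiffOn_pd h.isOpen hf _) hu),
          h.ignorable_L u hu, hpdα u hu]
        simp
      obtain ⟨F, hF, hF'⟩ := exists_potential h.isOpen hc
        (p := fun j => Sum.elim (fun a v => L c a v * pd (Sum.inl a) f v) (fun _ _ => 0) j)
        (by rintro (a | α)
            · exact hsm a
            · exact contDiffOn_const)
        (by rintro u hu (a | α) (b | β)
            · exact hcl u hu c b a
            · simp only [Sum.elim_inl, Sum.elim_inr, pd_const, hα u hu]
            · simp only [Sum.elim_inl, Sum.elim_inr, pd_const, hα u hu]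
            · simp only [Sum.elim_inr, pd_const])
      exact ⟨F, hF, fun u hu a => hF' u hu (Sum.inl a), fun u hu α => hF' u hu (Sum.inr α),
        fun h0 => absurd h0 hcl'⟩
  choose F hFs hFa hFα hFl using hpot
  set H : Fin (k + 1) → Coord k r → ℝ := fun j u => ∑ c, (stInv L φ u)⁻¹ j c * F c u with hH
  have hHs : ∀ j, ContDiffOn ℝ ∞ (H j) V := fun j =>
    ContDiffOn.sum fun c _ => (h.contDiffOn_stInv_inv hφ j c).mul (hFs c)
  have hHd : ∀ u ∈ V, ∀ j i, pd i (H j) u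
      = ∑ c, (pd i (fun v => (stInv L φ v)⁻¹ j c) u * F c u
        + (stInv L φ u)⁻¹ j c * pd i (F c) u) := by
    intro u hu j i
    have hd := fun c => differentiableAt_of_contDiffOn h.isOpen (h.contDiffOn_stInv_inv hφ j c) hu
    have hd' := fun c => differentiableAt_of_contDiffOn h.isOpen (hFs c) hu
    rw [hH, pd_sum (f := fun c u => (stInv L φ u)⁻¹ j c * F c u) fun c _ => (hd c).mul (hd' c)]
    exact Finset.sum_congr rfl fun c _ => pd_mul (hd c) (hd' c) i
  have hη : ∀ j, ∃ s : ℝ → ℝ, ∀ u ∈ V, s (u (Sum.inl j)) = H j u := by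
    intro j
    refine exists_coordinate_function h.isOpen hc (hHs j) _ fun u hu i hi => ?_
    rw [hHd u hu, Finset.sum_add_distrib]
    rcases i with a | α
    · have haj : j ≠ a := fun h0 => hi (by rw [h0])
      have h1 : ∀ c, pd (Sum.inl a) (fun v => (stInv L φ v)⁻¹ j c) u = 0 := fun c => by
        rw [(h.pd_inl_stInv_inv hφ hu a j c).2, if_neg haj]; simp
      have h2 := (h.pd_inl_stInv_inv hφ hu a j 0).1
      rw [if_neg haj] at h2
      simp only [h1, hFa _ u hu, zero_mul, Finset.sum_const_zero, zero_add, ← mul_assoc,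
        ← Finset.sum_mul]
      simp only [mulVec, dotProduct] at h2
      rw [h2, zero_mul]
    · simp only [h.pd_inr_stInv_inv hφ hu, hFα _ u hu]
      simp
  choose η hη' using hη
  refine ⟨η, fun a => (hHs a).congr fun u hu => hη' a u hu, fun u hu => ?_⟩
  have h1 : ∑ b, φ b u * H b u = f u := by
    simp only [hH, Finset.mul_sum]
    rw [Finset.sum_comm]
    have h2 := h.vecMul_stInv_inv hφ hu
    simp only [vecMul, dotProduct] at h2
    simp only [← mul_assoc, ← Finset.sum_mul, h2]
    simp [hFl (Fin.last k) rfl]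
  rw [← h1]
  exact Finset.sum_congr rfl fun b _ => by rw [hη' b u hu, mul_comm]

/-- On a convex coordinate domain the metric is in standard separable form, the Stäckel matrix being
the inverse of `(L_c^b φ^b)`. -/
theorem EisenhartData.exists_isStandardForm (h : EisenhartData V g L) (hc : Convex ℝ V)
    {N : Set (Fin (k + 1))} (hN : ∀ u ∈ V, ∀ a, g (Sum.inl a) (Sum.inl a) u = 0 ↔ a ∈ N)
    (hcl : ∀ u ∈ V, ∀ c a b α β,
      pd (Sum.inl b) (fun v => L c a v * pd (Sum.inl a) (g (Sum.inr α) (Sum.inr β)) v) u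
      = pd (Sum.inl a) (fun v => L c b v * pd (Sum.inl b) (g (Sum.inr α) (Sum.inr β)) v) u) :
    ∃ s θ η, IsStandardForm (fun u => Matrix.of fun i j => g i j u) V N s θ η ∧
      ∀ u ∈ V, smat s u = (stInv L (rowFactor N g) u)⁻¹ := by
  have hφ := h.isRowFactor hN
  have hs : ∀ j c, ∃ s : ℝ → ℝ, ∀ u ∈ V,
      s (u (Sum.inl j)) = (stInv L (rowFactor N g) u)⁻¹ j c := by
    intro j c
    refine exists_coordinate_function h.isOpen hc (h.contDiffOn_stInv_inv hφ j c) _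
      fun u hu i hi => ?_
    rcases i with a | α
    · rw [(h.pd_inl_stInv_inv hφ hu a j c).2, if_neg fun h0 => hi (by rw [h0])]; simp
    · exact h.pd_inr_stInv_inv hφ hu α j c
  choose s hs using hs
  choose θ hθ using fun b β => h.exists_theta hc hφ b β
  choose η hηs hη using fun α β => h.exists_eta hc hφ (h.smooth_g (Sum.inr α) (Sum.inr β))
    (fun u hu γ => h.ignorable_g u hu γ _ _) (fun u hu c a b => hcl u hu c a b α β)
  have hsmat : ∀ u ∈ V, smat s u = (stInv L (rowFactor N g) u)⁻¹ := fun u hu => by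
    ext j c; exact hs j c u hu
  have hphi : ∀ u ∈ V, ∀ b, phi s b u = rowFactor N g b u := fun u hu b => by
    rw [phi, hsmat u hu, nonsing_inv_nonsing_inv _ (h.det_stInv hφ u hu).isUnit]
    simp [stInv, h.last u hu]
  refine ⟨s, θ, fun a α β => η α β a, ?_, hsmat⟩
  exact
  { smooth_s := fun j i => (h.contDiffOn_stInv_inv hφ j i).congr fun u hu => hs j i u hu
    smooth_θ := fun a _ β => ((h.smooth_g _ _).div (hφ.smooth a) fun u hu =>
      hφ.ne_zero u hu a).congr fun u hu => hθ a β u hu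
    smooth_η := fun a α β => hηs α β a
    regular_s := fun u hu => by
      rw [hsmat u hu, det_nonsing_inv, Ring.inverse_eq_inv']
      exact inv_ne_zero (h.det_stInv hφ u hu)
    ignorable := fun u hu α i j => h.ignorable_g u hu α i j
    symm_g := fun u hu => by ext i j; exact h.symm u hu j i
    offdiag := h.offdiag
    hat_diag := fun u hu a ha => by rw [hphi u hu, rowFactor_of_notMem ha]; rfl
    hat_mixed := fun u hu a ha α => h.mixed u hu a (fun h0 => ha ((hN u hu a).1 h0)) α
    bar_diag := fun u hu a ha => (hN u hu a).2 ha
    bar_mixed := fun u hu a _ β => by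
      rw [hphi u hu, hθ a β u hu, div_mul_cancel₀ _ (hφ.ne_zero u hu a)]; rfl
    ignorable_block := fun u hu α β => by
      simp only [hphi u hu]; exact hη α β u hu }

/-- The functions `φ^b` of any standard separable form are row factors. -/
theorem EisenhartData.isRowFactor_phi (h : EisenhartData V g L) {N : Set (Fin (k + 1))}
    {s : Fin (k + 1) → Fin (k + 1) → ℝ → ℝ} {θ : Fin (k + 1) → Fin r → ℝ → ℝ}
    {η : Fin (k + 1) → Fin r → Fin r → ℝ → ℝ}
    (hst : IsStandardForm (fun u => Matrix.of fun i j => g i j u) V N s θ η)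
    (hne : ∀ u ∈ V, ∀ b, phi s b u ≠ 0) : IsRowFactor V g (phi s) := by
  have hsm : ∀ b, ContDiffOn ℝ ∞ (phi s b) V := fun b =>
    contDiffOn_inv_apply (A := fun u : Coord k r => smat s u) hst.smooth_s hst.regular_s _ b
  refine ⟨hsm, hne, fun u _ α b => pd_eq_zero_of_line fun t => ?_, fun u hu a b hab j => ?_⟩
  · simp [phi, smat]
  have hzero : ∀ j, (∀ v ∈ V, g (Sum.inl b) j v = 0) →
      phi s b u * pd (Sum.inl a) (g (Sum.inl b) j) u
        = pd (Sum.inl a) (phi s b) u * g (Sum.inl b) j u := by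
    intro j hj
    rw [pd_congr_on h.isOpen hj hu, pd_const, hj u hu]; ring
  by_cases hb : b ∈ N
  · rcases j with d | β
    · refine hzero _ fun v hv => ?_
      by_cases hbd : b = d
      · subst hbd; exact hst.bar_diag v hv b hb
      · exact h.offdiag v hv b d hbd
    · have h1 : pd (Sum.inl a) (g (Sum.inl b) (Sum.inr β)) u
          = pd (Sum.inl a) (fun v => θ b β (v (Sum.inl b)) * phi s b v) u :=
        pd_congr_on h.isOpen (fun v hv => hst.bar_mixed v hv b hb β) hu _
      rw [h1, pd_mul (differentiableAt_of_contDiffOn h.isOpen (hst.smooth_θ b hb β) hu)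
        (differentiableAt_of_contDiffOn h.isOpen (hsm b) hu),
        pd_coordinate_function (s := θ b β) (i := Sum.inl b) (fun h0 => hab (Sum.inl_injective h0)),
        show g (Sum.inl b) (Sum.inr β) u = _ from hst.bar_mixed u hu b hb β]
      ring
  · rcases j with d | β
    · by_cases hbd : b = d
      · subst hbd
        have h1 : ∀ v ∈ V, g (Sum.inl b) (Sum.inl b) v = phi s b v := fun v hv =>
          hst.hat_diag v hv b hb
        rw [pd_congr_on h.isOpen h1 hu, h1 u hu]; ring
      · exact hzero _ fun v hv => h.offdiag v hv b d hbd
    · exact hzero _ fun v hv => hst.hat_mixed v hv b hb β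

end StandardForm

/-! ### Diffeomorphisms of an interval with prescribed derivative -/

section Antiderivative

theorem isOpen_image_of_deriv_pos {f w : ℝ → ℝ} {s : Set ℝ} (hs : IsOpen s)
    (hf : ∀ x ∈ s, HasStrictDerivAt f (w x) x) (hw : ∀ x ∈ s, 0 < w x) : IsOpen (f '' s) := by
  rw [isOpen_iff_mem_nhds]
  rintro _ ⟨x, hx, rfl⟩
  rw [← (hf x hx).map_nhds_eq (hw x hx).ne']
  exact Filter.image_mem_map (hs.mem_nhds hx)

/-- A positive smooth function on an open interval is the derivative of a diffeomorphism. -/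
theorem exists_antiderivative_diffeo {I : Set ℝ} (hI : IsOpen I) (hc : Convex ℝ I) {w : ℝ → ℝ}
    (hw : ContDiffOn ℝ ∞ w I) (hpos : ∀ x ∈ I, 0 < w x) :
    ∃ τ : OpenPartialHomeomorph ℝ ℝ, τ.source = I ∧ (∀ x ∈ I, HasDerivAt τ (w x) x) ∧
      ContDiffOn ℝ ∞ τ I ∧ ContDiffOn ℝ ∞ τ.symm τ.target := by
  set v : ℝ → ℝ →L[ℝ] ℝ := fun x => w x • ContinuousLinearMap.id ℝ ℝ with hv
  have hvs : ContDiffOn ℝ ∞ v I := hw.smul contDiffOn_const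
  obtain ⟨f, hf⟩ := hc.exists_forall_hasFDerivAt_of_fderiv_symmetric hI
    (show DifferentiableOn ℝ v I from hvs.differentiableOn (by simp)) (by
      intro x _ y z
      -- Every bilinear form on `ℝ` is symmetric, so the form `w dx` is closed.
      have h1 : ∀ (T : ℝ →L[ℝ] ℝ →L[ℝ] ℝ) (y z : ℝ), T y z = y * z * T 1 1 := by
        intro T y z
        have h2 : T y = y • T 1 := by rw [← map_smul, smul_eq_mul, mul_one]
        have h3 : T 1 z = z * T 1 1 := by rw [← smul_eq_mul, ← map_smul, smul_eq_mul, mul_one]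
        rw [h2, _root_.smul_apply, h3, smul_eq_mul, mul_assoc]
      rw [h1, h1 _ z y]; ring)
  have hd : ∀ x ∈ I, HasDerivAt f (w x) x := fun x hx => by
    simpa [hv] using (hf x hx).hasDerivAt
  have hfs : ContDiffOn ℝ ∞ f I := by
    rw [contDiffOn_infty_iff_fderiv_of_isOpen hI]
    exact ⟨fun u hu => (hf u hu).differentiableAt.differentiableWithinAt,
      hvs.congr fun u hu => (hf u hu).fderiv⟩
  have hst : ∀ x ∈ I, HasStrictDerivAt f (w x) x := fun x hx =>
    (hfs.contDiffAt (hI.mem_nhds hx)).hasStrictDerivAt' (hd x hx) (by simp)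
  have hmono : StrictMonoOn f I := strictMonoOn_of_deriv_pos hc hfs.continuousOn fun x hx => by
    rw [(hd x (interior_subset hx)).deriv]; exact hpos x (interior_subset hx)
  let τ : OpenPartialHomeomorph ℝ ℝ := OpenPartialHomeomorph.ofContinuousOpenRestrict
    (hmono.injOn.toPartialEquiv f I) hfs.continuousOn (by
      intro U hU
      obtain ⟨O, hO, rfl⟩ := isOpen_induced_iff.1 hU
      have : I.domRestrict f '' (Subtype.val ⁻¹' O) = f '' (I ∩ O) := by
        ext y; constructor
        · rintro ⟨x, hx, rfl⟩; exact ⟨x, ⟨x.2, hx⟩, rfl⟩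
        · rintro ⟨x, ⟨hx, hx'⟩, rfl⟩; exact ⟨⟨x, hx⟩, hx', rfl⟩
      exact this ▸ isOpen_image_of_deriv_pos (hI.inter hO) (fun x hx => hst x hx.1)
        fun x hx => hpos x hx.1) hI
  refine ⟨τ, rfl, hd, hfs, fun y hy => ?_⟩
  have hy' : τ.symm y ∈ I := τ.map_target hy
  exact (τ.contDiffAt_symm_deriv (hpos _ hy').ne' hy (hd _ hy')
    (hfs.contDiffAt (hI.mem_nhds hy'))).contDiffWithinAt

end Antiderivative

/-! ### Rescaling one essential coordinate -/

section Rescaling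

/-- The function `f` of the coordinate `q^j` in terms of the rescaled coordinates, and divided
by `w ^ n` for the coordinate `q^a = σ(q̆^a)` that is rescaled. -/
noncomputable def rescaleFn (a : Fin (k + 1)) (σ w : ℝ → ℝ) (n : ℕ) (j : Fin (k + 1)) (f : ℝ → ℝ)
    (t : ℝ) : ℝ :=
  if j = a then f (σ t) / w (σ t) ^ n else f t

/-- The scale factor of the coordinate `q^j`. -/
noncomputable def scale (a : Fin (k + 1)) (w : ℝ → ℝ) (j : Fin (k + 1)) (u : Coord k r) : ℝ :=
  if j = a then w (u (Sum.inl a)) else 1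

theorem rescaleFn_apply {k r : ℕ} {M : Type*} [TopologicalSpace M]
    {e e' : OpenPartialHomeomorph M (Coord k r)} {a : Fin (k + 1)} {σ w : ℝ → ℝ}
    (hcoord : ∀ x ∈ e'.source, ∀ j, j ≠ Sum.inl a → e' x j = e x j)
    (hσ : ∀ x ∈ e'.source, σ (e' x (Sum.inl a)) = e x (Sum.inl a)) (n : ℕ) (j : Fin (k + 1))
    (f : ℝ → ℝ) {u : Coord k r} (hu : u ∈ e'.target) :
    rescaleFn a σ w n j f (u (Sum.inl j))
      = f (e (e'.symm u) (Sum.inl j)) / scale a w j (e (e'.symm u)) ^ n := by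
  have hx := e'.map_target hu
  unfold rescaleFn scale
  by_cases hj : j = a
  · subst hj
    have h1 := hσ _ hx
    rw [e'.right_inv hu] at h1
    simp only [if_true, h1]
  · have h1 := hcoord _ hx (Sum.inl j) (fun h0 => hj (Sum.inl_injective h0))
    rw [e'.right_inv hu] at h1
    simp [hj, h1]

variable {k r : ℕ} {M : Type*} [TopologicalSpace M] [ChartedSpace (Coord k r) M]
  {e e' : OpenPartialHomeomorph M (Coord k r)} {a : Fin (k + 1)}

theorem contDiffOn_transition (he : e ∈ Charts k r M) (he' : e' ∈ Charts k r M)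
    (h : e'.source ⊆ e.source) : ContDiffOn ℝ ∞ (fun u => e (e'.symm u)) e'.target := by
  rw [← contMDiffOn_iff_contDiffOn]
  exact (contMDiffOn_of_mem_maximalAtlas he).comp (contMDiffOn_symm_of_mem_maximalAtlas he')
    fun u hu => h (e'.map_target hu)

theorem contDiffAt_update {i : Idx k r} (u : Coord k r) (t : ℝ) :
    ContDiffAt ℝ ∞ (fun t => Function.update u i t) t := by
  rw [contDiffAt_pi]
  intro j
  by_cases hj : j = i
  · subst hj; simp only [Function.update_self]; exact contDiffAt_id
  · simpa [hj] using contDiffAt_const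

/-- No regularity of `ρ` is given. Near a value that is attained, `ρ` is a component of the smooth
transition map restricted to a coordinate line. -/
theorem differentiableAt_rescaling (he : e ∈ Charts k r M) (he' : e' ∈ Charts k r M)
    (hs : e'.source ⊆ e.source) {ρ : ℝ → ℝ}
    (hρ : ∀ x ∈ e'.source,
      e' x = Function.update (e x) (Sum.inl a) (ρ (e x (Sum.inl a)))) {x : M}
    (hx : x ∈ e'.source) : DifferentiableAt ℝ ρ (e x (Sum.inl a)) := by
  set t₀ := e x (Sum.inl a) with ht₀
  have hx' := hs hx
  have h0 : Function.update (e x) (Sum.inl a) t₀ = e x := Function.update_eq_self _ _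
  have h1 : MDifferentiableAt 𝓘(ℝ, Coord k r) 𝓘(ℝ, Coord k r) (e' ∘ e.symm) (e x) := by
    have h2 := (mdifferentiable_chart he).mdifferentiableAt_symm (e.map_source hx')
    refine MDifferentiableAt.comp (e x) ?_ h2
    rw [e.left_inv hx']
    exact (mdifferentiable_chart he').mdifferentiableAt hx
  have h2 : DifferentiableAt ℝ (e' ∘ e.symm) (Function.update (e x) (Sum.inl a) t₀) := by
    rw [h0]; exact mdifferentiableAt_iff_differentiableAt.1 h1
  have h3 : DifferentiableAt ℝ (fun t => (e' ∘ e.symm) (Function.update (e x) (Sum.inl a) t)) t₀ :=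
    h2.comp t₀ ((contDiffAt_update (e x) t₀).differentiableAt (by simp))
  have h4 := (differentiableAt_pi.1 h3) (Sum.inl a)
  refine h4.congr_of_eventuallyEq ?_
  have hcont : Filter.Tendsto (fun t => e.symm (Function.update (e x) (Sum.inl a) t)) (nhds t₀)
      (nhds x) := by
    have h5 : ContinuousAt e.symm (Function.update (e x) (Sum.inl a) t₀) := by
      rw [h0]; exact e.continuousAt_symm (e.map_source hx')
    have h6 := h5.tendsto.comp (contDiffAt_update (i := Sum.inl a) (e x) t₀).continuousAt.tendsto
    rwa [h0, e.left_inv hx'] at h6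
  have hcont' : Filter.Tendsto (fun t => Function.update (e x) (Sum.inl a) t) (nhds t₀)
      (nhds (e x)) := by
    have h6 := (contDiffAt_update (i := Sum.inl a) (e x) t₀).continuousAt.tendsto
    rwa [h0] at h6
  filter_upwards [hcont.eventually (e'.open_source.mem_nhds hx),
    hcont'.eventually (e.open_target.mem_nhds (e.map_source hx'))] with t ht ht'
  rw [Function.comp_apply, hρ _ ht, e.right_inv ht']
  simp

theorem dq_rescaling (he : e ∈ Charts k r M)
    (hs : e'.source ⊆ e.source) {ρ : ℝ → ℝ}
    (hρ : ∀ x ∈ e'.source,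
      e' x = Function.update (e x) (Sum.inl a) (ρ (e x (Sum.inl a)))) {x : M}
    (hx : x ∈ e'.source) {w : ℝ} (hw : HasDerivAt ρ w (e x (Sum.inl a))) (j : Idx k r) :
    dq e' j x = (if j = Sum.inl a then w else 1) • dq e j x := by
  by_cases hj : j = Sum.inl a
  · subst hj
    have h1 : (fun y => e' y (Sum.inl a)) =ᶠ[nhds x] fun y => ρ (e y (Sum.inl a)) := by
      filter_upwards [e'.open_source.mem_nhds hx] with y hy
      rw [hρ y hy]; simp
    have h2 : MDifferentiableAt 𝓘(ℝ, Coord k r) 𝓘(ℝ, ℝ) (fun y => e y (Sum.inl a)) x := by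
      have h3 := ((mdifferentiable_chart he).mdifferentiableAt (hs hx)).hasMFDerivAt
      have h4 : HasMFDerivAt 𝓘(ℝ, Coord k r) 𝓘(ℝ, ℝ) (fun w : Coord k r => w (Sum.inl a)) (e x)
          (ContinuousLinearMap.proj (R := ℝ) (φ := fun _ : Idx k r => ℝ) (Sum.inl a)) :=
        (hasFDerivAt_apply (Sum.inl a) (e x)).hasMFDerivAt
      exact (h4.comp x h3).mdifferentiableAt
    have h3 := (hw.hasFDerivAt.hasMFDerivAt).comp x h2.hasMFDerivAt
    have h4 : dq e' (Sum.inl a) x = _ := h1.mfderiv_eq.trans h3.mfderiv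
    rw [h4, if_pos rfl]
    exact ContinuousLinearMap.ext fun v => mul_comm (dq e (Sum.inl a) x v : ℝ) w
  · have h1 : (fun y => e' y j) =ᶠ[nhds x] fun y => e y j := by
      filter_upwards [e'.open_source.mem_nhds hx] with y hy
      rw [hρ y hy]; simp [hj]
    rw [if_neg hj, one_smul]
    exact h1.mfderiv_eq

theorem IsRescaling.exists_weight (he : e ∈ Charts k r M) (h : IsRescaling e e' a) :
    ∃ w : ℝ → ℝ, (∀ x ∈ e'.source, w (e x (Sum.inl a)) ≠ 0) ∧ ∀ x ∈ e'.source, ∀ j,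
      dq e' j x = (if j = Sum.inl a then w (e x (Sum.inl a)) else 1) • dq e j x := by
  obtain ⟨he', hs, ρ, hρ⟩ := h
  have h1 : ∀ x ∈ e'.source, ∀ j, dq e' j x
      = (if j = Sum.inl a then deriv ρ (e x (Sum.inl a)) else 1) • dq e j x := fun x hx j =>
    dq_rescaling he hs hρ hx (differentiableAt_rescaling he he' hs hρ hx).hasDerivAt j
  refine ⟨deriv ρ, fun x hx h0 => ?_, h1⟩
  refine dq_ne_zero he' hx (Sum.inl a) ?_
  rw [h1 x hx, if_pos rfl, h0, zero_smul]

theorem tcomp_rescaling {T : Tensor2 k r M} (hs : e'.source ⊆ e.source) {w : ℝ → ℝ}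
    (hdq : ∀ x ∈ e'.source, ∀ j,
      dq e' j x = (if j = Sum.inl a then w (e x (Sum.inl a)) else 1) • dq e j x)
    {u : Coord k r} (hu : u ∈ e'.target) (i j : Idx k r) :
    tcomp e' T i j u = (if i = Sum.inl a then w (e (e'.symm u) (Sum.inl a)) else 1)
      * (if j = Sum.inl a then w (e (e'.symm u) (Sum.inl a)) else 1)
      * tcomp e T i j (e (e'.symm u)) := by
  have hx := e'.map_target hu
  rw [tcomp, tcomp, e.left_inv (hs hx), hdq _ hx, hdq _ hx, map_smul, map_smul,
    LinearMap.smul_apply, smul_eq_mul, smul_eq_mul]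
  ring

/-- Consequently the Eisenhart equations hold in every rescaled chart, with the same eigenvalues. -/
theorem IsWeaklyAdapted.rescaling {G : Tensor2 k r M} {D : Submodule ℝ (VField k r M)}
    {E : Fin (k + 1) → VField k r M} (hw : IsWeaklyAdapted G D E e) (h : IsRescaling e e' a) :
    IsWeaklyAdapted G D E e' := by
  obtain ⟨w, hw0, hdq⟩ := h.exists_weight hw.chart
  have hs := h.2.1
  refine ⟨h.1, fun b x hx => ?_, ?_, fun b x hx hne α => ?_⟩
  · obtain ⟨c, hc⟩ := hw.orth b x (hs hx)
    by_cases hb : b = a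
    · subst hb
      refine ⟨c * (w (e x (Sum.inl b)))⁻¹, ?_⟩
      rw [hdq x hx, if_pos rfl, smul_smul, inv_mul_cancel_right₀ (hw0 x hx)]
      exact hc
    · refine ⟨c, ?_⟩
      rw [hdq x hx, if_neg (fun h0 => hb (Sum.inl_injective h0)), one_smul]
      exact hc
  · obtain ⟨X, hX⟩ := hw.basis
    refine ⟨X, fun α x hx j => ?_⟩
    rw [hdq x hx, _root_.smul_apply, hX α x (hs hx), smul_eq_mul]
    by_cases hj : j = Sum.inl a
    · subst hj; simp
    · simp [hj]
  · rw [hdq x hx, if_neg (by simp), one_smul]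
    refine hw.sect b x (hs hx) (fun h0 => hne ?_) α
    rw [tcomp_rescaling hs hdq (e'.map_source hx), e'.left_inv hx, h0, mul_zero]

/-- The component `g^{aa}` is multiplied by `w²` and `g^{aβ}` by `w`, while `g^{αβ}` is unchanged.
Giving `φ^a` the factor `w²` therefore requires dividing row `a` of `S` and `η_a` by `w²`, but `θ_a`
by `w` only; this explains the exponents 2 and 1. -/
theorem IsStandardForm.rescaling {G : Tensor2 k r M} {D : Submodule ℝ (VField k r M)}
    {𝒦 : Submodule ℝ (Tensor2 k r M)} {E : Fin (k + 1) → VField k r M} {m₀ : ℕ}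
    {N : Set (Fin (k + 1))}
    {s : Fin (k + 1) → Fin (k + 1) → ℝ → ℝ} {θ : Fin (k + 1) → Fin r → ℝ → ℝ}
    {η : Fin (k + 1) → Fin r → Fin r → ℝ → ℝ} (hA : IsSepKillingAlgebra G D 𝒦 E m₀)
    (he : e ∈ Charts k r M) (he' : IsWeaklyAdapted G D E e') (hs : e'.source ⊆ e.source)
    (hst : IsStandardForm (tmat e G) e.target N s θ η) {σ w : ℝ → ℝ}
    (hcoord : ∀ x ∈ e'.source, ∀ j, j ≠ Sum.inl a → e' x j = e x j)
    (hσ : ∀ x ∈ e'.source, σ (e' x (Sum.inl a)) = e x (Sum.inl a))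
    (hw0 : ∀ x ∈ e'.source, w (e x (Sum.inl a)) ≠ 0)
    (hws : ContDiffOn ℝ ∞ (fun u : Coord k r => w (u (Sum.inl a))) e.target)
    (hdq : ∀ x ∈ e'.source, ∀ j,
      dq e' j x = (if j = Sum.inl a then w (e x (Sum.inl a)) else 1) • dq e j x) :
    IsStandardForm (tmat e' G) e'.target N (fun j c => rescaleFn a σ w 2 j (s j c))
      (fun j β => rescaleFn a σ w 1 j (θ j β)) (fun j α β => rescaleFn a σ w 2 j (η j α β)) ∧
    ∀ u ∈ e'.target, ∀ b, phi (fun j c => rescaleFn a σ w 2 j (s j c)) b u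
      = scale a w b (e (e'.symm u)) ^ 2 * phi s b (e (e'.symm u)) := by
  have hF := contDiffOn_transition he he'.chart hs
  have hmaps : ∀ u ∈ e'.target, e (e'.symm u) ∈ e.target := fun u hu =>
    e.map_source (hs (e'.map_target hu))
  have hsc0 : ∀ u ∈ e'.target, ∀ j, scale a w j (e (e'.symm u)) ≠ 0 := by
    intro u hu j
    unfold scale
    split_ifs
    · exact hw0 _ (e'.map_target hu)
    · exact one_ne_zero
  have hscs : ∀ j, ContDiffOn ℝ ∞ (fun u => scale a w j (e (e'.symm u))) e'.target := by
    intro j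
    unfold scale
    by_cases hj : j = a
    · simp only [hj, if_true]; exact hws.comp hF hmaps
    · simp only [hj, if_false]; exact contDiffOn_const
  have hsmooth : ∀ n j (f : ℝ → ℝ),
      ContDiffOn ℝ ∞ (fun u : Coord k r => f (u (Sum.inl j))) e.target →
      ContDiffOn ℝ ∞ (fun u : Coord k r => rescaleFn a σ w n j f (u (Sum.inl j))) e'.target := by
    intro n j f hf
    exact ((hf.comp hF hmaps).div ((hscs j).pow n) fun u hu => pow_ne_zero _ (hsc0 u hu j)).congr
      fun u hu => rescaleFn_apply hcoord hσ n j f hu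
  have hsmat : ∀ u ∈ e'.target, smat (fun j c => rescaleFn a σ w 2 j (s j c)) u
      = diagonal (fun j => (scale a w j (e (e'.symm u)) ^ 2)⁻¹) * smat s (e (e'.symm u)) := by
    intro u hu
    ext j c
    rw [diagonal_mul]
    simp only [smat, of_apply]
    rw [rescaleFn_apply hcoord hσ 2 j _ hu]
    ring
  have hphi : ∀ u ∈ e'.target, ∀ b, phi (fun j c => rescaleFn a σ w 2 j (s j c)) b u
      = scale a w b (e (e'.symm u)) ^ 2 * phi s b (e (e'.symm u)) := by
    intro u hu b
    have hinv : (smat (fun j c => rescaleFn a σ w 2 j (s j c)) u)⁻¹ = (smat s (e (e'.symm u)))⁻¹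
        * diagonal (fun j => scale a w j (e (e'.symm u)) ^ 2) := by
      refine inv_eq_right_inv ?_
      rw [hsmat u hu, mul_assoc, ← mul_assoc (smat s _),
        mul_nonsing_inv _ (hst.regular_s _ (hmaps u hu)).isUnit, one_mul, diagonal_mul_diagonal,
        ← diagonal_one]
      congr 1
      funext j
      exact inv_mul_cancel₀ (pow_ne_zero _ (hsc0 u hu j))
    rw [phi, hinv, mul_diagonal, phi, mul_comm]
  have hg : ∀ u ∈ e'.target, ∀ i j, tmat e' G u i j
      = (if i = Sum.inl a then w (e (e'.symm u) (Sum.inl a)) else 1)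
      * (if j = Sum.inl a then w (e (e'.symm u) (Sum.inl a)) else 1)
      * tmat e G (e (e'.symm u)) i j := fun u hu i j => tcomp_rescaling hs hdq hu i j
  have hinl : ∀ (u : Coord k r) b, (if (Sum.inl b : Idx k r) = Sum.inl a then w (u (Sum.inl a)) else 1)
      = scale a w b u := by
    intro u b
    simp only [scale, Sum.inl.injEq]
  refine ⟨?_, hphi⟩
  exact
  { smooth_s := fun j i => hsmooth 2 j _ (hst.smooth_s j i)
    smooth_θ := fun j hj β => hsmooth 1 j _ (hst.smooth_θ j hj β)
    smooth_η := fun j α β => hsmooth 2 j _ (hst.smooth_η j α β)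
    regular_s := fun u hu => by
      rw [hsmat u hu, det_mul, det_diagonal]
      exact mul_ne_zero (Finset.prod_ne_zero_iff.2 fun j _ =>
        inv_ne_zero (pow_ne_zero _ (hsc0 u hu j))) (hst.regular_s _ (hmaps u hu))
    ignorable := fun u hu α i j =>
      he'.pd_inr_eq_zero (fun X hX => (hA.killing_D X hX).2) hu α i j
    symm_g := fun u hu => by
      ext i j
      exact congrFun (tcomp_symm hA.metric.toIsSymTensor j i) u
    offdiag := fun u hu b c hbc => by
      rw [hg u hu, hst.offdiag _ (hmaps u hu) b c hbc, mul_zero]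
    hat_diag := fun u hu b hb => by
      rw [hg u hu, hst.hat_diag _ (hmaps u hu) b hb, hphi u hu, hinl]; ring
    hat_mixed := fun u hu b hb α => by
      rw [hg u hu, hst.hat_mixed _ (hmaps u hu) b hb, mul_zero]
    bar_diag := fun u hu b hb => by
      rw [hg u hu, hst.bar_diag _ (hmaps u hu) b hb, mul_zero]
    bar_mixed := fun u hu b hb β => by
      rw [hg u hu, hst.bar_mixed _ (hmaps u hu) b hb, hphi u hu, hinl, if_neg (by simp),
        rescaleFn_apply hcoord hσ 1 b _ hu]
      have := hsc0 u hu b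
      field_simp
    ignorable_block := fun u hu α β => by
      rw [hg u hu, hst.ignorable_block _ (hmaps u hu), if_neg (by simp), if_neg (by simp), one_mul,
        one_mul]
      refine Finset.sum_congr rfl fun b _ => ?_
      rw [hphi u hu, rescaleFn_apply hcoord hσ 2 b _ hu]
      have := hsc0 u hu b
      field_simp }

theorem mem_charts_trans (he : e ∈ Charts k r M)
    [IsManifold 𝓘(ℝ, Coord k r) ∞ M] {R : OpenPartialHomeomorph (Coord k r) (Coord k r)}
    (hR : ContDiffOn ℝ ∞ R R.source) (hR' : ContDiffOn ℝ ∞ R.symm R.target) :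
    e.trans R ∈ Charts k r M := by
  refine OpenPartialHomeomorph.mem_maximalAtlas_of_contMDiffOn (I := 𝓘(ℝ, Coord k r)) (n := ∞)
    (e.trans R) ?_ ?_
  · refine (contMDiffOn_iff_contDiffOn.2 hR).comp
      ((contMDiffOn_of_mem_maximalAtlas he).mono ?_) ?_
    · intro x hx; rw [OpenPartialHomeomorph.trans_source] at hx; exact hx.1
    · intro x hx; rw [OpenPartialHomeomorph.trans_source] at hx; exact hx.2
  · refine (contMDiffOn_symm_of_mem_maximalAtlas he).comp
      ((contMDiffOn_iff_contDiffOn.2 hR').mono ?_) ?_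
    · intro x hx; rw [OpenPartialHomeomorph.trans_target] at hx; exact hx.1
    · intro x hx; rw [OpenPartialHomeomorph.trans_target] at hx; exact hx.2

theorem contDiffOn_update {i : Idx k r} {f : ℝ → ℝ} {s : Set ℝ} (hf : ContDiffOn ℝ ∞ f s) :
    ContDiffOn ℝ ∞ (fun u : Coord k r => Function.update u i (f (u i))) {u | u i ∈ s} := by
  rw [contDiffOn_pi]
  intro j
  by_cases hj : j = i
  · subst hj
    simp only [Function.update_self]
    exact hf.comp (contDiff_apply ℝ ℝ j).contDiffOn fun u hu => hu
  · simpa [hj] using (contDiff_apply ℝ ℝ j).contDiffOn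

/-- The coordinate change that applies `τ` to the coordinate `q^i`. -/
noncomputable def updateHomeo (i : Idx k r) (τ : OpenPartialHomeomorph ℝ ℝ)
    (h : ContDiffOn ℝ ∞ τ τ.source) (h' : ContDiffOn ℝ ∞ τ.symm τ.target) :
    OpenPartialHomeomorph (Coord k r) (Coord k r) where
  toFun u := Function.update u i (τ (u i))
  invFun u := Function.update u i (τ.symm (u i))
  source := {u | u i ∈ τ.source}
  target := {u | u i ∈ τ.target}
  map_source' u hu := by simpa using τ.map_source hu
  map_target' u hu := by simpa using τ.map_target hu
  left_inv' u hu := by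
    have h1 : τ.symm (τ (u i)) = u i := τ.left_inv hu
    simp [h1]
  right_inv' u hu := by
    have h1 : τ (τ.symm (u i)) = u i := τ.right_inv hu
    simp [h1]
  open_source := τ.open_source.preimage (continuous_apply i)
  open_target := τ.open_target.preimage (continuous_apply i)
  continuousOn_toFun := (contDiffOn_update h).continuousOn
  continuousOn_invFun := (contDiffOn_update h').continuousOn

theorem exists_rescaled_chart [IsManifold 𝓘(ℝ, Coord k r) ∞ M] (he : e ∈ Charts k r M)
    (hc : Convex ℝ e.target) (a : Fin (k + 1)) {w : ℝ → ℝ}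
    (hws : ContDiffOn ℝ ∞ (fun u : Coord k r => w (u (Sum.inl a))) e.target)
    (hpos : ∀ u ∈ e.target, 0 < w (u (Sum.inl a))) :
    ∃ (e' : OpenPartialHomeomorph M (Coord k r)) (ρ σ : ℝ → ℝ), e' ∈ Charts k r M ∧
      e'.source = e.source ∧
      (∀ x ∈ e'.source, e' x = Function.update (e x) (Sum.inl a) (ρ (e x (Sum.inl a)))) ∧
      (∀ x ∈ e'.source, HasDerivAt ρ (w (e x (Sum.inl a))) (e x (Sum.inl a))) ∧
      ∀ x ∈ e'.source, σ (e' x (Sum.inl a)) = e x (Sum.inl a) := by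
  set I : Set ℝ := (fun u : Coord k r => u (Sum.inl a)) '' e.target with hI
  have hIo : IsOpen I := isOpenMap_eval (Sum.inl a) _ e.open_target
  have hIc : Convex ℝ I :=
    hc.linear_image (LinearMap.proj (R := ℝ) (φ := fun _ : Idx k r => ℝ) (Sum.inl a))
  -- Smoothness is known for `w` as a function on the coordinate domain; it is transferred to the
  -- interval by restriction to a coordinate line.
  have hwI : ContDiffOn ℝ ∞ w I := by
    rintro _ ⟨u, hu, rfl⟩
    have h0 : Function.update u (Sum.inl a) (u (Sum.inl a)) = u := Function.update_eq_self _ _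
    have h1 : ContDiffAt ℝ ∞ (fun u : Coord k r => w (u (Sum.inl a)))
        (Function.update u (Sum.inl a) (u (Sum.inl a))) := by
      rw [h0]; exact hws.contDiffAt (e.open_target.mem_nhds hu)
    have h2 := h1.comp (u (Sum.inl a)) (contDiffAt_update u (u (Sum.inl a)))
    refine (h2.congr_of_eventuallyEq (Filter.Eventually.of_forall fun t => ?_)).contDiffWithinAt
    simp
  obtain ⟨τ, hτs, hτd, hτ, hτ'⟩ := exists_antiderivative_diffeo hIo hIc hwI
    (by rintro _ ⟨u, hu, rfl⟩; exact hpos u hu)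
  have hτ1 : ContDiffOn ℝ ∞ τ τ.source := by rw [hτs]; exact hτ
  have hmem : ∀ x ∈ e.source, e x (Sum.inl a) ∈ τ.source := fun x hx => by
    rw [hτs]; exact ⟨e x, e.map_source hx, rfl⟩
  have hsrc : (e.trans (updateHomeo (Sum.inl a) τ hτ1 hτ')).source = e.source := by
    rw [OpenPartialHomeomorph.trans_source]
    exact Set.inter_eq_left.2 fun x hx => hmem x hx
  refine ⟨e.trans (updateHomeo (Sum.inl a) τ hτ1 hτ'), τ, τ.symm,
    mem_charts_trans he (contDiffOn_update hτ1) (contDiffOn_update hτ'), hsrc, fun x _ => rfl,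
    fun x hx => hτd _ ⟨e x, e.map_source (hsrc ▸ hx), rfl⟩, fun x hx => ?_⟩
  have h1 : (e.trans (updateHomeo (Sum.inl a) τ hτ1 hτ')) x
    = Function.update (e x) (Sum.inl a) (τ (e x (Sum.inl a))) := rfl
  rw [h1, Function.update_self]
  exact τ.left_inv (hmem x (hsrc ▸ hx))

end Rescaling

/-! ### Constant ratios on connected sets -/

section Ratios

/-- If finitely many continuous functions without common zeros on a preconnected set have constant
(or undefined) ratios, they are constant multiples of one of them, which has no zeros. -/
theorem exists_common_factor {X ι : Type*} [TopologicalSpace X] [LinearOrder ι] [Finite ι]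
    {U : Set X} (hU : IsPreconnected U) (hne : U.Nonempty) {f : ι → X → ℝ}
    (hf : ∀ c, ContinuousOn (f c) U) {C : Set ι} (hC : ∀ x ∈ U, ∃ c ∈ C, f c x ≠ 0)
    (h : ∀ b ∈ C, ∀ c ∈ C, c < b → (∀ x ∈ U, f c x = 0) ∨
      ∃ κ : ℝ, ∀ x ∈ U, f c x ≠ 0 → f b x / f c x = κ) :
    ∃ c₀ ∈ C, (∀ x ∈ U, f c₀ x ≠ 0) ∧ ∀ c ∈ C, ∃ κ : ℝ, ∀ x ∈ U, f c x = κ * f c₀ x := by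
  obtain ⟨x₀, hx₀⟩ := hne
  obtain ⟨c₁, hc₁, hc₁'⟩ := hC x₀ hx₀
  -- The least index whose function is not identically zero: smaller ones vanish identically, and
  -- larger ones are governed by the hypothesis, which concerns `c < b` only.
  obtain ⟨c₀, ⟨hc₀, x₁, hx₁, hne₁⟩, hmin⟩ :=
    (Set.toFinite {c | c ∈ C ∧ ∃ x ∈ U, f c x ≠ 0}).exists_minimal ⟨c₁, hc₁, x₀, hx₀, hc₁'⟩
  have hκ : ∀ c ∈ C, ∃ κ : ℝ, ∀ x ∈ U, f c₀ x ≠ 0 → f c x = κ * f c₀ x := by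
    intro c hc
    rcases lt_trichotomy c c₀ with hlt | rfl | hlt
    · refine ⟨0, fun x hx _ => ?_⟩
      by_contra hne
      rw [zero_mul] at hne
      exact absurd (hmin ⟨hc, x, hx, hne⟩ hlt.le) (not_le.2 hlt)
    · exact ⟨1, fun x _ _ => (one_mul _).symm⟩
    · rcases h c hc c₀ hc₀ hlt with h0 | ⟨κ, hκ⟩
      · exact absurd (h0 x₁ hx₁) hne₁
      · exact ⟨κ, fun x hx hx0 => by rw [← hκ x hx hx0, div_mul_cancel₀ _ hx0]⟩
  -- The zero set of `f c₀` is open in `U`: at a zero some other `f c` is nonzero, so `f c ≠ κ * f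
  -- c₀` nearby, which is possible only where `f c₀` vanishes.
  have hiff : ∀ x ∈ U, ∀ y ∈ U, (f c₀ x ≠ 0 ↔ f c₀ y ≠ 0) := by
    intro x hx y hy
    refine hU.induction₂ (fun x y => (f c₀ x ≠ 0 ↔ f c₀ y ≠ 0)) (fun x hx => ?_)
      (fun _ _ _ _ _ _ h h' => h.trans h') (fun _ _ _ _ h => h.symm) hx hy
    by_cases hx0 : f c₀ x = 0
    · obtain ⟨c, hc, hcx⟩ := hC x hx
      obtain ⟨κ, hκ⟩ := hκ c hc
      have h1 : ContinuousWithinAt (fun y => f c y - κ * f c₀ y) U x :=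
        (hf c x hx).sub (continuousWithinAt_const.mul (hf c₀ x hx))
      have h2 : f c x - κ * f c₀ x ≠ 0 := by rwa [hx0, mul_zero, sub_zero]
      filter_upwards [h1.eventually_ne h2, self_mem_nhdsWithin] with y hy hyU
      have : f c₀ y = 0 := by
        by_contra h0
        exact hy (sub_eq_zero.2 (hκ y hyU h0))
      simp [hx0, this]
    · filter_upwards [(hf c₀ x hx).eventually_ne hx0] with y hy
      simp [hx0, hy]
  have hall : ∀ x ∈ U, f c₀ x ≠ 0 := fun x hx => (hiff x₁ hx₁ x hx).1 hne₁
  refine ⟨c₀, hc₀, hall, fun c hc => ?_⟩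
  obtain ⟨κ, hκ⟩ := hκ c hc
  exact ⟨κ, fun x hx => hκ x hx (hall x hx)⟩

theorem exists_sign {X : Type*} [TopologicalSpace X] {U : Set X} (hU : IsPreconnected U)
    {f : X → ℝ} (hf : ContinuousOn f U) (hne : ∀ x ∈ U, f x ≠ 0) :
    ∃ ε : ℝ, ε ≠ 0 ∧ ∀ x ∈ U, 0 < ε * f x := by
  by_cases h : ∀ x ∈ U, 0 < f x
  · exact ⟨1, one_ne_zero, fun x hx => by rw [one_mul]; exact h x hx⟩
  · push Not at h
    obtain ⟨x, hx, hx0⟩ := h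
    refine ⟨-1, by norm_num, fun y hy => ?_⟩
    by_contra hy0
    obtain ⟨z, hz, hz0⟩ := hU.intermediate_value hx hy hf
      (Set.mem_Icc.2 ⟨hx0, by linarith⟩ : (0 : ℝ) ∈ _)
    exact hne z hz hz0

/-- Constancy of the ratio is propagated in the cross-multiplied form, to allow zeros of the
denominator. That relation alone is not transitive; it becomes so together with the equivalence of
vanishing at the two points. -/
theorem fundConstOrUndef_of_locally {k : ℕ} {M : Type*} [TopologicalSpace M]
    {Λ : M → Matrix (Fin (k + 1)) (Fin (k + 1)) ℝ} {U : Set M} (hU : IsPreconnected U)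
    {a : Fin (k + 1)} {C : Set (Fin (k + 1))}
    (h : ∀ x ∈ U, ∃ κ : Fin (k + 1) → ℝ, ∀ᶠ y in nhds x, ∃ t : ℝ, t ≠ 0 ∧
      ∀ c ∈ C, minor Λ a c y = κ c * t) {b c : Fin (k + 1)} (hb : b ∈ C) (hc : c ∈ C) :
    FundConstOrUndef Λ U a b c := by
  have hP : ∀ x ∈ U, ∀ y ∈ U, (minor Λ a c x = 0 ↔ minor Λ a c y = 0) ∧
      minor Λ a b x * minor Λ a c y = minor Λ a b y * minor Λ a c x := by
    intro x hx y hy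
    refine hU.induction₂ (fun x y => (minor Λ a c x = 0 ↔ minor Λ a c y = 0) ∧
      minor Λ a b x * minor Λ a c y = minor Λ a b y * minor Λ a c x) (fun x hx => ?_)
      (fun x y z _ _ _ h h' => ?_) (fun _ _ _ _ h => ⟨h.1.symm, h.2.symm⟩) hx hy
    · obtain ⟨κ, hκ⟩ := h x hx
      obtain ⟨t, ht, htC⟩ := hκ.self_of_nhds
      filter_upwards [nhdsWithin_le_nhds hκ] with y ⟨t', ht', htC'⟩
      rw [htC c hc, htC b hb, htC' c hc, htC' b hb]
      exact ⟨by simp [ht, ht'], by ring⟩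
    · refine ⟨h.1.trans h'.1, ?_⟩
      by_cases hy0 : minor Λ a c y = 0
      · rw [h.1.2 hy0, h'.1.1 hy0, mul_zero, mul_zero]
      · refine mul_right_cancel₀ hy0 ?_
        linear_combination minor Λ a c z * h.2 + minor Λ a c x * h'.2
  by_cases h0 : ∀ x ∈ U, minor Λ a c x = 0
  · exact Or.inl h0
  · push Not at h0
    obtain ⟨x₀, hx₀, hne⟩ := h0
    refine Or.inr ⟨minor Λ a b x₀ / minor Λ a c x₀, fun x hx hx0 => ?_⟩
    rw [fund, div_eq_div_iff hx0 hne]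
    exact (hP x hx x₀ hx₀).2

/-- If only the minor of the last row could be nonzero, row `a` of `adj A · A = det A · 1` would
have all entries equal, the last row of `A` being constant 1. With at least two columns this forces
`det A = 0`. -/
theorem exists_minor_ne_zero {k : ℕ} {A : Matrix (Fin (k + 1)) (Fin (k + 1)) ℝ} (hA : A.det ≠ 0)
    (hlast : ∀ b, A (Fin.last k) b = 1) (a : Fin (k + 1)) {C : Set (Fin (k + 1))}
    (hC : ∀ c, c ≠ Fin.last k → c ∈ C) (hC' : Fin.last k ∈ C ∨ 0 < k) :
    ∃ c ∈ C, (A.submatrix c.succAbove a.succAbove).det ≠ 0 := by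
  by_contra! h
  have h0 : ∀ c ∈ C, A.adjugate a c = 0 := fun c hc => by
    rw [adjugate_fin_succ_eq_det_submatrix, h c hc, mul_zero]
  have h1 : ∀ b, ∑ c, A.adjugate a c * A c b = if a = b then A.det else 0 := fun b => by
    have := congrFun (congrFun (adjugate_mul A) a) b
    rw [mul_apply, Matrix.smul_apply, one_apply] at this
    simpa using this
  have h2 : ∀ b, A.adjugate a (Fin.last k) = if a = b then A.det else 0 := fun b => by
    rw [← h1 b, Finset.sum_eq_single (Fin.last k)
      (fun c _ hc => by rw [h0 c (hC c hc), zero_mul]) (by simp), hlast, mul_one]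
  have h3 := h2 a
  rw [if_pos rfl] at h3
  rcases hC' with hl | hk
  · exact hA (by rw [← h3, h0 _ hl])
  · have : Nontrivial (Fin (k + 1)) := Fin.nontrivial_iff_two_le.2 (by omega)
    obtain ⟨b, hb⟩ := exists_ne a
    have h4 := h2 b
    rw [if_neg hb.symm] at h4
    exact hA (by rw [← h3, h4])

theorem FundConstOrUndef.mono {k : ℕ} {M : Type*} {Λ : M → Matrix (Fin (k + 1)) (Fin (k + 1)) ℝ}
    {U U' : Set M} {a b c : Fin (k + 1)} (h : FundConstOrUndef Λ U a b c) (hU : U' ⊆ U) :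
    FundConstOrUndef Λ U' a b c :=
  h.imp (fun h x hx => h x (hU hx)) fun ⟨κ, h⟩ => ⟨κ, fun x hx => h x (hU hx)⟩

end Ratios

/-- If the entries of row `a` of the Stäckel matrix are constant, except for the last one, then
`∂_a` is a conformal Stäckel symmetry. -/
theorem pd_phi_of_constant_row {k r : ℕ} {V : Set (Coord k r)} (hV : IsOpen V)
    {s : Fin (k + 1) → Fin (k + 1) → ℝ → ℝ}
    (hs : ∀ j i, ContDiffOn ℝ ∞ (fun u : Coord k r => s j i (u (Sum.inl j))) V)
    (hd : ∀ u ∈ V, (smat s u).det ≠ 0) {a : Fin (k + 1)}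
    (hconst : ∀ c, c ≠ Fin.last k → ∃ κ, ∀ u ∈ V, s a c (u (Sum.inl a)) = κ) {u : Coord k r}
    (hu : u ∈ V) (b : Fin (k + 1)) :
    pd (Sum.inl a) (phi s b) u
      = -(phi s a u * pd (Sum.inl a) (fun v => s a (Fin.last k) (v (Sum.inl a))) u)
        * phi s b u := by
  have hA : ∀ i j, ContDiffOn ℝ ∞ (fun u : Coord k r => smat s u i j) V := fun i j => hs i j
  have h1 := pd_inverse hV hA (contDiffOn_inv_apply hA hd)
    (fun u hu => mul_nonsing_inv _ (hd u hu).isUnit) hu (Sum.inl a)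
  set S' : Matrix (Fin (k + 1)) (Fin (k + 1)) ℝ :=
    Matrix.of fun i j => pd (Sum.inl a) (fun v => smat s v i j) u with hS'
  have h2 : ∀ j c, S' j c = if j = a then if c = Fin.last k then
      pd (Sum.inl a) (fun v => s a (Fin.last k) (v (Sum.inl a))) u else 0 else 0 := by
    intro j c
    change pd (Sum.inl a) (fun v => s j c (v (Sum.inl j))) u = _
    by_cases hj : j = a
    · subst hj
      by_cases hc : c = Fin.last k
      · simp [hc]
      · obtain ⟨κ, hκ⟩ := hconst c hc
        rw [pd_congr_on hV hκ hu, pd_const]; simp [hc]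
    · rw [if_neg hj]
      exact pd_coordinate_function (fun h => hj (Sum.inl_injective h).symm) u
  have h3 := congrFun (congrFun h1 (Fin.last k)) b
  rw [of_apply, Matrix.neg_apply, mul_apply] at h3
  simp only [mul_apply, h2] at h3
  rw [show phi s b = fun v => (smat s v)⁻¹ (Fin.last k) b from rfl, h3]
  simp [phi]

/-! ### The equivalence, for both kinds of symmetry -/

section Main

variable {k r : ℕ} {M : Type*} [TopologicalSpace M] [ChartedSpace (Coord k r) M]
  {G : Tensor2 k r M} {D : Submodule ℝ (VField k r M)}
  {𝒦 : Submodule ℝ (Tensor2 k r M)} {E : Fin (k + 1) → VField k r M} {m₀ : ℕ}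
  {K : Module.Basis (Fin (k + 1)) ℝ 𝒦} {Λ : M → Matrix (Fin (k + 1)) (Fin (k + 1)) ℝ}
  {e e' : OpenPartialHomeomorph M (Coord k r)} {a : Fin (k + 1)} {C : Set (Fin (k + 1))}

/-- The common generalization of conformal Stäckel symmetries (for `m ∉ C`) and Stäckel symmetries
(for `m ∈ C`). -/
def IsSymmetryFor (C : Set (Fin (k + 1))) (G : Tensor2 k r M)
    (e : OpenPartialHomeomorph M (Coord k r)) (a : Fin (k + 1)) : Prop :=
  ∃ null s θ η, IsStandardForm (tmat e G) e.target null s θ η ∧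
    ∃ F : Coord k r → ℝ, (Fin.last k ∈ C → ∀ u ∈ e.target, F u = 0) ∧ ∀ u ∈ e.target, ∀ b,
      phi s b u ≠ 0 ∧ pd (Sum.inl a) (phi s b) u = F u * phi s b u

theorem isSymmetryFor_iff_isCSSymmetry (hC : Fin.last k ∉ C) :
    IsSymmetryFor C G e a ↔ IsCSSymmetry G e a := by
  simp [IsSymmetryFor, IsCSSymmetry, hC]

theorem isSymmetryFor_iff_isSSymmetry (hC : Fin.last k ∈ C) :
    IsSymmetryFor C G e a ↔ IsSSymmetry G e a := by
  constructor
  · rintro ⟨N, s, θ, η, hst, F, hF, h⟩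
    refine ⟨N, s, θ, η, hst, fun u hu b => ⟨(h u hu b).1, ?_⟩⟩
    rw [(h u hu b).2, hF hC u hu, zero_mul]
  · rintro ⟨N, s, θ, η, hst, h⟩
    refine ⟨N, s, θ, η, hst, 0, fun _ _ _ => rfl, fun u hu b => ⟨(h u hu b).1, ?_⟩⟩
    rw [(h u hu b).2, Pi.zero_apply, zero_mul]

/-- The Stäckel matrix used is the inverse of `(λ_c^b φ^b)`, with `φ` taken from the given standard
form and the eigenvalues from `Λ`; it need not be the matrix `smat s` of that form. Its row `a` is
constant in the columns of `C` on a ball, and the common factor `t` of the minors is `det Λ · φ^a`.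
-/
theorem minor_locally (hA : IsSepKillingAlgebra G D 𝒦 E m₀)
    (hK : (K (Fin.last k) : Tensor2 k r M) = G)
    (hΛ : ∀ x c b, IsEigen G (K c : Tensor2 k r M) x (E b x) (Λ x c b))
    (hw : IsWeaklyAdapted G D E e) (hsym : IsSymmetryFor C G e a) {x : M} (hx : x ∈ e.source) :
    ∃ κ : Fin (k + 1) → ℝ, ∀ᶠ y in nhds x, ∃ t : ℝ, t ≠ 0 ∧
      ∀ c ∈ C, minor Λ a c y = κ c * t := by
  obtain ⟨N, s, θ, η, hst, F, hF0, hF⟩ := hsym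
  have h := eisenhartData hA hK hΛ hw
  have hφ := h.isRowFactor_phi hst fun u hu b => (hF u hu b).1
  set S : Coord k r → Matrix (Fin (k + 1)) (Fin (k + 1)) ℝ := fun u =>
    (stInv (fun c b u => Λ (e.symm u) c b) (phi s) u)⁻¹ with hS
  obtain ⟨ε, hε, hball⟩ := Metric.isOpen_iff.1 e.open_target (e x) (e.map_source hx)
  have hconst : ∀ c ∈ C, ∀ u ∈ Metric.ball (e x) ε, S u a c = S (e x) a c := by
    intro c hc u hu
    refine eq_of_pd_eq_zero Metric.isOpen_ball (convex_ball _ _)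
      ((h.contDiffOn_stInv_inv hφ a c).mono hball) hu (Metric.mem_ball_self hε)
      fun z hz i => Or.inr ?_
    exact h.pd_row_eq_zero hφ (hball hz) (fun b => (hF z (hball hz) b).2)
      (fun h0 => hF0 (h0 ▸ hc) z (hball hz)) i
  refine ⟨fun c => (-1) ^ (c + a : ℕ) * S (e x) a c, ?_⟩
  filter_upwards [e.open_source.mem_nhds hx,
    (e.continuousAt hx).eventually (Metric.ball_mem_nhds (e x) hε)] with y hy hyb
  have hyt := e.map_source hy
  refine ⟨(Λ y).det * phi s a (e y), mul_ne_zero (eigen_det_ne_zero hA hΛ y)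
    (hφ.ne_zero _ hyt a), fun c hc => ?_⟩
  have h1 := h.minor_eq hφ hyt a c
  have h2 := hconst c hc (e y) hyb
  simp only [hS] at h2 ⊢
  rw [h2] at h1
  simp only [e.left_inv hy] at h1
  rw [show minor Λ a c y = ((Λ y).submatrix c.succAbove a.succAbove).det from rfl]
  refine Eq.trans h1 ?_
  rw [show (Matrix.of fun c b => Λ y c b) = Λ y from rfl]
  ring

theorem continuousOn_minor (hA : IsSepKillingAlgebra G D 𝒦 E m₀)
    (hΛ : ∀ x c b, IsEigen G (K c : Tensor2 k r M) x (E b x) (Λ x c b))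
    (hw : IsWeaklyAdapted G D E e) (a c : Fin (k + 1)) :
    ContinuousOn (minor Λ a c) e.source := by
  have h1 : ContDiffOn ℝ ∞ (fun u => minor Λ a c (e.symm u)) e.target :=
    contDiffOn_det (A := fun u => (Λ (e.symm u)).submatrix c.succAbove a.succAbove) fun i j =>
      contDiffOn_eigen hA hΛ hw _ _
  refine (h1.continuousOn.comp e.continuousOn e.mapsTo).congr fun x hx => ?_
  simp [e.left_inv hx]

theorem isRescaling_refl (he : e ∈ Charts k r M) : IsRescaling e e a :=
  ⟨he, subset_rfl, id, fun _ _ => (Function.update_eq_self _ _).symm⟩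

theorem exists_rescaling [IsManifold 𝓘(ℝ, Coord k r) ∞ M] (hA : IsSepKillingAlgebra G D 𝒦 E m₀)
    (hK : (K (Fin.last k) : Tensor2 k r M) = G)
    (hΛ : ∀ x c b, IsEigen G (K c : Tensor2 k r M) x (E b x) (Λ x c b))
    (he : IsAdapted G D 𝒦 E m₀ e) (hc : Convex ℝ e.target)
    (hC : ∀ c, c ≠ Fin.last k → c ∈ C) (hC' : Fin.last k ∈ C ∨ 0 < k)
    (h : ∀ b ∈ C, ∀ c ∈ C, c < b → FundConstOrUndef Λ e.source a b c) :
    ∃ e', IsRescaling e e' a ∧ e'.source = e.source ∧ IsSymmetryFor C G e' a := by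
  have hw := he.isWeaklyAdapted
  have hD := eisenhartData hA hK hΛ hw
  have hcl : ∀ u ∈ e.target, ∀ c a b α β, _ := fun u hu c a b α β =>
    closed_of_isAdapted hA hΛ he hu c a b α β
  -- The set of null indices is read off at a base point, so the empty domain is treated apart.
  rcases e.target.eq_empty_or_nonempty with hemp | ⟨u₀, hu₀⟩
  · obtain ⟨s, θ, η, hst, -⟩ := hD.exists_isStandardForm hc (N := ∅) (by simp [hemp]) hcl
    exact ⟨e, isRescaling_refl he.chart, rfl, ∅, s, θ, η, hst, 0, fun _ _ _ => rfl, by simp [hemp]⟩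
  have hN : ∀ u ∈ e.target, ∀ a, tcomp e G (Sum.inl a) (Sum.inl a) u = 0 ↔ a ∈ nullSet e G u₀ := by
    intro u hu a
    rw [nullSet_eq hA hΛ hw hc.isPreconnected hu₀ hu]; rfl
  obtain ⟨s, θ, η, hst, hsmat⟩ := hD.exists_isStandardForm hc hN hcl
  have hφ := hD.isRowFactor hN
  set N := nullSet e G u₀ with hNdef
  have hsa : ∀ u ∈ e.target, ∀ c, s a c (u (Sum.inl a))
      = (stInv (fun c b u => Λ (e.symm u) c b) (rowFactor N (tcomp e G)) u)⁻¹ a c := fun u hu c =>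
    congrFun (congrFun (hsmat u hu) a) c
  have hphi : ∀ u ∈ e.target, ∀ b, phi s b u ≠ 0 := fun u hu b => by
    rw [phi, hsmat u hu, nonsing_inv_nonsing_inv _ (hD.det_stInv hφ u hu).isUnit]
    simpa [stInv, hD.last u hu] using hφ.ne_zero u hu b
  have hsrc : IsPreconnected e.source := by
    rw [← e.symm_image_target_eq_source]
    exact hc.isPreconnected.image _ e.continuousOn_symm
  obtain ⟨c₀, hc₀, hne, hκ⟩ := exists_common_factor hsrc ⟨_, e.map_target hu₀⟩
    (continuousOn_minor hA hΛ hw a) (C := C) (fun x hx => exists_minor_ne_zero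
      (eigen_det_ne_zero hA hΛ x) (eigen_last hA hK hΛ hw hx) a hC hC') h
  set f : Coord k r → ℝ := fun u => (Λ (e.symm u)).det * rowFactor N (tcomp e G) a u with hf
  have hf0 : ∀ u ∈ e.target, f u ≠ 0 := fun u hu =>
    mul_ne_zero (eigen_det_ne_zero hA hΛ _) (hφ.ne_zero u hu a)
  have hminor : ∀ u ∈ e.target, ∀ c, minor Λ a c (e.symm u)
      = (-1) ^ (c + a : ℕ) * f u * s a c (u (Sum.inl a)) := fun u hu c => by
    rw [hsa u hu]; exact hD.minor_eq hφ hu a c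
  have hs0 : ∀ u ∈ e.target, s a c₀ (u (Sum.inl a)) ≠ 0 := by
    intro u hu h0
    refine hne _ (e.map_target hu) ?_
    rw [hminor u hu, h0, mul_zero]
  have hsκ : ∀ c ∈ C, ∃ κ : ℝ, ∀ u ∈ e.target,
      s a c (u (Sum.inl a)) = κ * s a c₀ (u (Sum.inl a)) := by
    intro c hc
    obtain ⟨κ, hκ⟩ := hκ c hc
    refine ⟨(-1) ^ (c + a : ℕ) * κ * (-1) ^ (c₀ + a : ℕ), fun u hu => ?_⟩
    have h1 := hκ _ (e.map_target hu)
    rw [hminor u hu, hminor u hu] at h1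
    have h2 : ((-1 : ℝ) ^ (c + a : ℕ)) * (-1) ^ (c + a : ℕ) = 1 := by
      rw [← mul_pow]; simp
    refine mul_left_cancel₀ (hf0 u hu) ?_
    linear_combination (-1 : ℝ) ^ (c + a : ℕ) * h1 - f u * s a c (u (Sum.inl a)) * h2
  -- The scale factor `w` is chosen so that `w²` is the entry of row `a` in column `c₀`, made
  -- positive by `ε`.
  obtain ⟨ε, hε0, hε⟩ := exists_sign hc.isPreconnected (hst.smooth_s a c₀).continuousOn hs0
  set w : ℝ → ℝ := fun t => √(ε * s a c₀ t) with hwdef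
  have hws : ContDiffOn ℝ ∞ (fun u : Coord k r => w (u (Sum.inl a))) e.target :=
    (contDiffOn_const.mul (hst.smooth_s a c₀)).sqrt fun u hu => (hε u hu).ne'
  have hwpos : ∀ u ∈ e.target, 0 < w (u (Sum.inl a)) := fun u hu => Real.sqrt_pos.2 (hε u hu)
  obtain ⟨e', ρ, σ, he', hes, hρ, hρd, hσ⟩ := exists_rescaled_chart he.chart hc a hws hwpos
  have hres : IsRescaling e e' a := ⟨he', hes.le, ρ, hρ⟩
  have hw' := hw.rescaling hres
  have hcoord : ∀ x ∈ e'.source, ∀ j, j ≠ Sum.inl a → e' x j = e x j := fun x hx j hj => by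
    rw [hρ x hx, Function.update_of_ne hj]
  have hmaps : ∀ u ∈ e'.target, e (e'.symm u) ∈ e.target := fun u hu =>
    e.map_source (hes.le (e'.map_target hu))
  obtain ⟨hst', hphi'⟩ := hst.rescaling hA he.chart hw' hes.le hcoord hσ
    (fun x hx => (hwpos _ (e.map_source (hes.le hx))).ne') hws
    (fun x hx j => dq_rescaling he.chart hes.le hρ hx (hρd x hx) j)
  have hconst : ∀ c ∈ C, ∃ κ : ℝ, ∀ u ∈ e'.target,
      rescaleFn a σ w 2 a (s a c) (u (Sum.inl a)) = κ := by
    intro c hc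
    obtain ⟨κ, hκ⟩ := hsκ c hc
    -- After the rescaling the entry is `κ s / (ε s)`, where `s` is the entry in column `c₀`.
    refine ⟨κ / ε, fun u hu => ?_⟩
    rw [rescaleFn_apply hcoord hσ 2 a _ hu, hκ _ (hmaps u hu), scale, if_pos rfl,
      Real.sq_sqrt (hε _ (hmaps u hu)).le]
    have := hs0 _ (hmaps u hu)
    field_simp
  -- The factor `F` is the one of `pd_phi_of_constant_row`. It vanishes if the last column belongs
  -- to `C`, since its entry is then constant too.
  refine ⟨e', hres, hes, N, _, _, _, hst', fun u =>
    -(phi (fun j c => rescaleFn a σ w 2 j (s j c)) a u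
      * pd (Sum.inl a) (fun v => rescaleFn a σ w 2 a (s a (Fin.last k)) (v (Sum.inl a))) u),
    fun hl u hu => ?_, fun u hu b => ⟨?_, ?_⟩⟩
  · obtain ⟨κ, hκ⟩ := hconst _ hl
    beta_reduce
    rw [pd_congr_on e'.open_target hκ hu, pd_const, mul_zero, neg_zero]
  · rw [hphi' u hu, scale]
    refine mul_ne_zero (pow_ne_zero _ ?_) (hphi _ (hmaps u hu) b)
    split_ifs
    · exact (hwpos _ (hmaps u hu)).ne'
    · exact one_ne_zero
  · exact pd_phi_of_constant_row e'.open_target hst'.smooth_s hst'.regular_s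
      (fun c hc => hconst c (hC c hc)) hu b

/-- The standard form is built on convex domains, so the local statement is reduced to a coordinate
ball. -/
theorem exists_restriction [IsManifold 𝓘(ℝ, Coord k r) ∞ M]
    (he : IsAdapted G D 𝒦 E m₀ e) {x : M} (hx : x ∈ e.source) :
    ∃ e', IsAdapted G D 𝒦 E m₀ e' ∧ Convex ℝ e'.target ∧ x ∈ e'.source ∧ e'.source ⊆ e.source ∧
      ∀ y, e' y = e y := by
  obtain ⟨ε, hε, hball⟩ := Metric.isOpen_iff.1 e.open_target (e x) (e.map_source hx)
  set R := OpenPartialHomeomorph.ofSet (Metric.ball (e x) ε) Metric.isOpen_ball with hR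
  have hsub : (e.trans R).source ⊆ e.source := by
    rw [OpenPartialHomeomorph.trans_source]; exact Set.inter_subset_left
  have htgt : (e.trans R).target = Metric.ball (e x) ε := by
    rw [OpenPartialHomeomorph.trans_target]
    exact Set.inter_eq_left.2 fun u hu => hball hu
  have htsub : (e.trans R).target ⊆ e.target := htgt ▸ hball
  refine ⟨e.trans R, ?_, htgt ▸ convex_ball _ _, ?_, hsub, fun _ => rfl⟩
  · refine ⟨mem_charts_trans he.chart contDiffOn_id contDiffOn_id,
      fun a y hy => he.orth a y (hsub hy), ?_, fun a y hy => he.sect a y (hsub hy),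
      fun hm T hT α β u hu i j => he.closed hm T hT α β u (htsub hu) i j⟩
    obtain ⟨X, hX⟩ := he.basis
    exact ⟨X, fun α y hy => hX α y (hsub hy)⟩
  · rw [OpenPartialHomeomorph.trans_source]
    exact ⟨hx, Metric.mem_ball_self hε⟩

/-- The condition `P` need only lie between constancy for all pairs in `C` and constancy for pairs
with `c < b`. This covers both versions in the theorem. -/
theorem symmetry_iff [IsManifold 𝓘(ℝ, Coord k r) ∞ M] (hA : IsSepKillingAlgebra G D 𝒦 E m₀)
    (hK : (K (Fin.last k) : Tensor2 k r M) = G)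
    (hΛ : ∀ x c b, IsEigen G (K c : Tensor2 k r M) x (E b x) (Λ x c b))
    (he : IsAdapted G D 𝒦 E m₀ e) (hconn : IsPreconnected e.source)
    (hC : ∀ c, c ≠ Fin.last k → c ∈ C) (hC' : Fin.last k ∈ C ∨ 0 < k) {P : Prop}
    (hP : P → ∀ b ∈ C, ∀ c ∈ C, c < b → FundConstOrUndef Λ e.source a b c)
    (hP' : (∀ b ∈ C, ∀ c ∈ C, FundConstOrUndef Λ e.source a b c) → P) :
    ((∀ x ∈ e.source, ∃ e', IsRescaling e e' a ∧ x ∈ e'.source ∧ IsSymmetryFor C G e' a) ↔ P) ∧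
    (Convex ℝ e.target →
      ((∃ e', IsRescaling e e' a ∧ e'.source = e.source ∧ IsSymmetryFor C G e' a) ↔ P)) := by
  have hw := he.isWeaklyAdapted
  have h1 : (∀ x ∈ e.source, ∃ e', IsRescaling e e' a ∧ x ∈ e'.source ∧ IsSymmetryFor C G e' a)
      → P := by
    intro h
    refine hP' fun b hb c hc => fundConstOrUndef_of_locally hconn (fun x hx => ?_) hb hc
    obtain ⟨e', hr, hx', hs⟩ := h x hx
    exact minor_locally hA hK hΛ (hw.rescaling hr) hs hx'
  refine ⟨⟨h1, fun h x hx => ?_⟩, fun hc => ⟨?_, fun h => ?_⟩⟩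
  · obtain ⟨e₁, he₁, hc₁, hx₁, hs₁, hval⟩ := exists_restriction he hx
    obtain ⟨e', ⟨hch, hsub, ρ, hρ⟩, hes, hs⟩ := exists_rescaling (a := a) hA hK hΛ he₁ hc₁ hC hC'
      fun b hb c hc hcb => (hP h b hb c hc hcb).mono hs₁
    refine ⟨e', ⟨hch, hsub.trans hs₁, ρ, fun y hy => ?_⟩, hes ▸ hx₁, hs⟩
    rw [hρ y hy, hval]
  · rintro ⟨e', hr, hes, hs⟩
    exact h1 fun x hx => ⟨e', hr, hes ▸ hx, hs⟩
  · exact exists_rescaling hA hK hΛ he hc hC hC' (hP h)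

end Main

end SepKilling

theorem theorem4p9 {k r : ℕ} {M : Type*} [TopologicalSpace M]
    [ChartedSpace (SepKilling.Coord k r) M] [IsManifold 𝓘(ℝ, SepKilling.Coord k r) ∞ M]
    (G : SepKilling.Tensor2 k r M) (D : Submodule ℝ (SepKilling.VField k r M))
    (𝒦 : Submodule ℝ (SepKilling.Tensor2 k r M)) (E : Fin (k + 1) → SepKilling.VField k r M)
    (m₀ : ℕ) (hA : SepKilling.IsSepKillingAlgebra G D 𝒦 E m₀)
    (K : Module.Basis (Fin (k + 1)) ℝ 𝒦)
    (hK : (K (Fin.last k) : SepKilling.Tensor2 k r M) = G)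
    (Λ : M → Matrix (Fin (k + 1)) (Fin (k + 1)) ℝ)
    (hΛ : ∀ x c b, SepKilling.IsEigen G (K c : SepKilling.Tensor2 k r M) x (E b x) (Λ x c b))
    (e : OpenPartialHomeomorph M (SepKilling.Coord k r))
    (he : SepKilling.IsAdapted G D 𝒦 E m₀ e) (hconn : IsPreconnected e.source)
    (a : Fin (k + 1)) :
    (2 < k + 1 →
      ((∀ x ∈ e.source, ∃ e', SepKilling.IsRescaling e e' a ∧ x ∈ e'.source ∧
            SepKilling.IsCSSymmetry G e' a) ↔
          ∀ b c, c < b → b < Fin.last k → SepKilling.FundConstOrUndef Λ e.source a b c) ∧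
      (Convex ℝ e.target →
        ((∃ e', SepKilling.IsRescaling e e' a ∧ e'.source = e.source ∧
            SepKilling.IsCSSymmetry G e' a) ↔
          ∀ b c, c < b → b < Fin.last k → SepKilling.FundConstOrUndef Λ e.source a b c))) ∧
    (((∀ x ∈ e.source, ∃ e', SepKilling.IsRescaling e e' a ∧ x ∈ e'.source ∧
            SepKilling.IsSSymmetry G e' a) ↔
          ∀ b c, SepKilling.FundConstOrUndef Λ e.source a b c) ∧
      (Convex ℝ e.target →
        ((∃ e', SepKilling.IsRescaling e e' a ∧ e'.source = e.source ∧
            SepKilling.IsSSymmetry G e' a) ↔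
          ∀ b c, SepKilling.FundConstOrUndef Λ e.source a b c))) := by
  constructor
  · intro hk
    -- A conformal symmetry leaves the last column free; `C` is nonempty because `m ≥ 2`.
    have h := SepKilling.symmetry_iff (a := a) (C := {c | c ≠ Fin.last k}) hA hK hΛ he hconn
      (fun c hc => hc) (Or.inr (by omega))
      (P := ∀ b c, c < b → b < Fin.last k → SepKilling.FundConstOrUndef Λ e.source a b c)
      (fun h b hb c _ hcb => h b c hcb (Fin.lt_last_iff_ne_last.2 hb))
      (fun h b c hcb hb => h b hb.ne c (hcb.trans hb).ne)
    simpa only [SepKilling.isSymmetryFor_iff_isCSSymmetry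
      (C := {c | c ≠ Fin.last k}) (fun h => h rfl)] using h
  · have h := SepKilling.symmetry_iff (a := a) (C := Set.univ) hA hK hΛ he hconn
      (fun _ _ => Set.mem_univ _) (Or.inl (Set.mem_univ _))
      (P := ∀ b c, SepKilling.FundConstOrUndef Λ e.source a b c)
      (fun h b _ c _ _ => h b c) (fun h b c => h b (Set.mem_univ _) c (Set.mem_univ _))
    simpa only [SepKilling.isSymmetryFor_iff_isSSymmetry (Set.mem_univ _)] using h
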